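/- There is an absolute constant $C>0$ such that the following holds. Let $d,n\in\mathbb N$, $\alpha\in(0,1)$ and $\eta\in[0,1/2)$. Then there is a measurable function $\widehat{\mathsf E}_\star$ from $(\mathbb R^d)^n$ to the symmetric positive semidefinite $d\times d$ matrices, depending only on $\alpha$, $\eta$, $n$ (and the dimension $d$), with the following property. Let $X_1,\dots,X_n$ be i.i.d. copies of a random vector $X$ in $\mathbb R^d$ with $\mathbb E\|X\|^p<\infty$ for some real $p\ge 4$, with $\mathbb E X=0$ and with covariance matrix $\Sigma\neq 0$. For $q\in\{4,p\}$ put \[\kappa_q:=\sup_{v\in\mathbb R^d,\ \langle v,\Sigma v\rangle=1}\big(\mathbb E|\langle X,v\rangle|^q\big)^{1/q},\] and put $r(\Sigma):=\operatorname{tr}(\Sigma)/\|\Sigma\|$, where $\|\cdot\|$ denotes the Euclidean norm of vectors and the corresponding operator norm of matrices. Let $Y_1,\dots,Y_n$ be random vectors in $\mathbb R^d$, defined on the same probability space and otherwise arbitrary, such that $\#\{i\in\{1,\dots,n\}: Y_i\neq X_i\}\le \eta n$ almost surely. If \[\eta\le\frac{1}{C\kappa_4^4}\qquad\text{and}\qquad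 n\ge C\big(r(\Sigma)+\log(2/\alpha)\big),\] then, with probability at least $1-\alpha$, \[\big\|\widehat{\mathsf E}_\star(Y_1,\dots,Y_n)-\Sigma\big\|\le C\kappa_4^2\|\Sigma\|\left(\sqrt{\frac{r(\Sigma)}{n}}+\sqrt{\frac{\log(2/\alpha)}{n}}\right)+C\kappa_p^2\|\Sigma\|\,\eta^{1-2/p}.\] -/

import Mathlib

open MeasureTheory ProbabilityTheory

noncomputable section

namespace RobustCov

/-- The operator norm of a real square matrix, with respect to the Euclidean norm. -/
def opNorm {d : ℕ} (A : Matrix (Fin d) (Fin d) ℝ) : ℝ :=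
  ‖Matrix.toEuclideanCLM (n := Fin d) (𝕜 := ℝ) A‖

/-- The quadratic form `⟨v, A v⟩`. -/
def quadForm {d : ℕ} (A : Matrix (Fin d) (Fin d) ℝ) (v : EuclideanSpace ℝ (Fin d)) : ℝ :=
  inner ℝ v (Matrix.toEuclideanCLM (n := Fin d) (𝕜 := ℝ) A v)

/-- The stable rank `r(A) = tr A / ‖A‖` of a nonzero positive semidefinite matrix. -/
def stableRank {d : ℕ} (A : Matrix (Fin d) (Fin d) ℝ) : ℝ :=
  A.trace / opNorm A

/-- The covariance matrix of a law `μ` on `ℝ^d`. -/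
def covMatrix {d : ℕ} (μ : Measure (EuclideanSpace ℝ (Fin d))) : Matrix (Fin d) (Fin d) ℝ :=
  Matrix.of fun i j => cov[fun x => x i, fun x => x j; μ]

/-- The `L^p`-`L^2` marginal moment constant
`κ_p = sup {E[|⟨X, v⟩|^p]^{1/p} : ⟨v, Σ v⟩ = 1}` of a law `μ` on `ℝ^d` with covariance `Σ`. If
`Σ ≠ 0` and `E‖X‖^p < ∞`, the supremum is over a nonempty bounded set of reals. -/
def kappa {d : ℕ} (μ : Measure (EuclideanSpace ℝ (Fin d))) (p : ℝ) : ℝ :=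
  sSup {s : ℝ | ∃ v : EuclideanSpace ℝ (Fin d), quadForm (covMatrix μ) v = 1 ∧
    s = (∫ x, |inner ℝ x v| ^ p ∂μ) ^ (1 / p)}

end RobustCov

end

/-! Estimate `⟨v, Σ v⟩` by the smallest sum of the `⟨Y_i, v⟩ ^ 2` left after removing at most `k`
indices, divided by `n`. If `k` dominates the number of corruptions, `log (2 / α)` and `r(Σ)`, then
uniformly over unit `v` only a small part of the `k` removals is needed for genuinely large sample
points. The trimmed sum then lies between truncated sums of the clean sample, and what remains is a
uniform deviation bound for truncated quadratic forms plus a bias of order `k B`, where `B` is the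
quantile of `⟨X, v⟩ ^ 2` at level about `k / n`. The `p`-th moment turns the bias into `κ_p ^ 2 ‖Σ‖
η ^ (1 - 2 / p)` when corruption dominates, and the fourth moment turns it into the statistical rate
otherwise (`measure_trimmedSum_deviation`).

Uniformity in `v` is dimension-free because it comes from PAC-Bayes (`pacBayes`): `v` is replaced by
a Gaussian of covariance `I / β` centred at `v`, whose relative entropy to the centred one is `β ‖v‖
^ 2 / 2`. With `β` of order `r(Σ) + log (2 / α)` this costs the desired rate, and the noise has
variance about `‖X‖ ^ 2 / β` along `X`, which is subtracted from the truncated square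
(`smoothedLoss`).

The estimator may not depend on `r(Σ)`, so the level is read off the data. Starting at a multiple
`128 j` of `η n + log (2 / α)`, it grows until some direction shows more large values than `S / k ^
(3/2)` explains, where `S` is the root of the trimmed sum of the `‖Y_i‖ ^ 4`; with high probability
`S` is at most a multiple of `√n κ_4 ^ 2 ‖Σ‖ r(Σ)`. Overshooting an ideal level is harmless: at
every level passed, the failure to stop bounds the loss of one more removal, and the bounds sum to
about `S / √k` (`trimmedSum_le_stopLevel_add`). Stopping early is harmless too: a clean sample obeys
an `envelope` for its directional order statistics, so stopping forces the norm part of the envelope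
below its marginal part, and the envelope summed up to the ideal level is about `√(n k)`
(`trimmedSum_stopLevel_le_add`).

All bad events concern clean samples admitting some bad corruption within the budget, so nothing is
assumed about how the corruption arises. Finally the estimator is a measurable, nearly best positive
semidefinite approximation of the trimmed form on the sphere. -/

/-! ### Gaussian change of measure and the PAC-Bayes inequality. -/

theorem gaussianReal_setIntegral_exp (w : ℝ) {s : Set ℝ} (hs : MeasurableSet s) :
    ENNReal.ofReal (∫ x, s.indicator (fun x => Real.exp (w * x - w ^ 2 / 2)) x
      ∂(gaussianReal 0 1)) = gaussianReal w 1 s := by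
  rw [gaussianReal_apply_eq_integral w one_ne_zero, integral_gaussianReal_eq_integral_smul one_ne_zero,
    ← integral_indicator hs]
  congr 2
  ext x
  by_cases hx : x ∈ s
  · simp only [Set.indicator_of_mem hx, smul_eq_mul, gaussianPDFReal]
    rw [mul_assoc, ← Real.exp_add]
    congr 2
    push_cast
    ring
  · simp [Set.indicator_of_notMem hx]

theorem gaussianReal_pi_withDensity {ι : Type*} [Fintype ι] (w : ι → ℝ) :
    (Measure.pi fun _ : ι => gaussianReal 0 1).withDensity
      (fun x => ENNReal.ofReal (Real.exp (∑ i, (w i * x i - w i ^ 2 / 2)))) =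
    Measure.pi fun i => gaussianReal (w i) 1 := by
  symm
  refine Measure.pi_eq fun s hs => ?_
  rw [withDensity_apply _ (MeasurableSet.univ_pi hs)]
  have hint : ∀ i, Integrable (fun x : ℝ => (s i).indicator
      (fun x => Real.exp (w i * x - w i ^ 2 / 2)) x) (gaussianReal 0 1) := fun i => by
    refine Integrable.indicator ?_ (hs i)
    simp_rw [Real.exp_sub]
    exact (integrable_exp_mul_gaussianReal (w i)).div_const _
  have key : ∀ x : ι → ℝ, (Set.univ.pi s).indicator
      (fun x => ENNReal.ofReal (Real.exp (∑ i, (w i * x i - w i ^ 2 / 2)))) x =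
      ENNReal.ofReal (∏ i, (s i).indicator (fun x => Real.exp (w i * x - w i ^ 2 / 2)) (x i)) := by
    intro x
    by_cases hx : x ∈ Set.univ.pi s
    · rw [Set.indicator_of_mem hx, Real.exp_sum]
      congr 1
      exact Finset.prod_congr rfl fun i _ => by rw [Set.indicator_of_mem (hx i trivial)]
    · rw [Set.indicator_of_notMem hx]
      obtain ⟨i, hi⟩ : ∃ i, x i ∉ s i := by simpa [Set.mem_pi] using hx
      rw [Finset.prod_eq_zero (Finset.mem_univ i) (by simp [hi])]
      simp
  rw [← lintegral_indicator (MeasurableSet.univ_pi hs), lintegral_congr key,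
    ← ofReal_integral_eq_lintegral_ofReal (Integrable.fintype_prod hint), integral_fintype_prod_eq_prod
      (f := fun i x => (s i).indicator (fun x => Real.exp (w i * x - w i ^ 2 / 2)) x),
    ENNReal.ofReal_prod_of_nonneg]
  · exact Finset.prod_congr rfl fun i _ => gaussianReal_setIntegral_exp (w i) (hs i)
  · exact fun i _ => integral_nonneg fun x => Set.indicator_nonneg (fun _ _ => (Real.exp_pos _).le) _
  · exact .of_forall fun x => Finset.prod_nonneg fun i _ =>
      Set.indicator_nonneg (fun _ _ => (Real.exp_pos _).le) _

/-- The finite-dimensional Cameron–Martin formula, carried over from the product measure, where the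
density factors over coordinates. -/
theorem stdGaussian_map_add {d : ℕ} (w : EuclideanSpace ℝ (Fin d)) :
    (stdGaussian (EuclideanSpace ℝ (Fin d))).map (fun g => g + w) =
    (stdGaussian (EuclideanSpace ℝ (Fin d))).withDensity
      (fun g => ENNReal.ofReal (Real.exp (inner ℝ g w - ‖w‖ ^ 2 / 2))) := by
  have hT : MeasurableEmbedding (WithLp.toLp 2 : (Fin d → ℝ) → EuclideanSpace ℝ (Fin d)) :=
    (MeasurableEquiv.toLp 2 (Fin d → ℝ)).measurableEmbedding
  rw [← map_pi_eq_stdGaussian, Measure.map_map (by fun_prop) (by fun_prop)]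
  have h1 : Measure.pi (fun i => gaussianReal (w i) 1) =
      (Measure.pi fun _ : Fin d => gaussianReal 0 1).map (fun x i => x i + w i) := by
    have h := Measure.pi_map_pi (μ := fun _ : Fin d => gaussianReal 0 1)
      (f := fun i (y : ℝ) => y + w i) (fun i => by fun_prop)
    rw [h]
    simp [gaussianReal_map_add_const]
  have h2 : ((fun g => g + w) ∘ WithLp.toLp 2 : (Fin d → ℝ) → EuclideanSpace ℝ (Fin d)) =
      WithLp.toLp 2 ∘ (fun x i => x i + w i) := by
    ext x i; simp
  rw [h2, ← Measure.map_map (by fun_prop) (by fun_prop), ← h1, ← gaussianReal_pi_withDensity]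
  ext s hs
  rw [hT.map_apply, withDensity_apply _ hs, hT.restrict_map, hT.lintegral_map,
    withDensity_apply _ (hT.measurable hs)]
  refine lintegral_congr fun x => ?_
  congr 2
  rw [EuclideanSpace.real_norm_sq_eq, Finset.sum_sub_distrib, PiLp.inner_apply, Finset.sum_div]
  simp

/-- Change of measure for a Gaussian shift. -/
theorem exp_integral_shift_le {d : ℕ} (F : EuclideanSpace ℝ (Fin d) → ℝ) (hF : Measurable F)
    (K : ℝ) (hK : ∀ g, |F g| ≤ K) (w : EuclideanSpace ℝ (Fin d)) :
    Real.exp (∫ g, F (g + w) ∂(stdGaussian (EuclideanSpace ℝ (Fin d))) - ‖w‖ ^ 2 / 2) ≤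
      ∫ g, Real.exp (F g) ∂(stdGaussian (EuclideanSpace ℝ (Fin d))) := by
  set γ := stdGaussian (EuclideanSpace ℝ (Fin d)) with hγ
  have e1 : ∫ g, Real.exp (F g) ∂γ =
      ∫ g, Real.exp (F g - inner ℝ g w + ‖w‖ ^ 2 / 2) ∂(γ.map (fun g => g + w)) := by
    rw [hγ, stdGaussian_map_add, integral_withDensity_eq_integral_toReal_smul (by fun_prop)
      (.of_forall fun _ => ENNReal.ofReal_lt_top)]
    · refine integral_congr_ae (.of_forall fun g => ?_)
      simp only [smul_eq_mul]
      rw [ENNReal.toReal_ofReal (Real.exp_pos _).le, ← Real.exp_add]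
      congr 1; ring
  have hexp : ∀ c : EuclideanSpace ℝ (Fin d), Integrable (fun g => Real.exp (inner ℝ g c)) γ := by
    intro c
    have := IsGaussian.map_eq_gaussianReal (μ := γ) (innerSL ℝ c)
    have h := integrable_exp_mul_gaussianReal (μ := γ[innerSL ℝ c])
      (v := (Var[innerSL ℝ c; γ]).toNNReal) 1
    rw [← this] at h
    have h' := h.comp_aemeasurable (by fun_prop)
    refine h'.congr (.of_forall fun g => ?_)
    simp [real_inner_comm]
  rw [e1, integral_map (by fun_prop) (Measurable.aestronglyMeasurable (by fun_prop))]
  have hlin : Integrable (fun g : EuclideanSpace ℝ (Fin d) => (inner ℝ g w : ℝ)) γ := by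
    have := (IsGaussian.integrable_dual γ (innerSL ℝ w))
    refine this.congr (.of_forall fun g => ?_)
    simp [real_inner_comm]
  have hFi : Integrable (fun g => F (g + w)) γ :=
    Integrable.of_bound (Measurable.aestronglyMeasurable (by fun_prop)) K
      (.of_forall fun g => by simpa using hK _)
  have hz : ∫ g, (inner ℝ g w : ℝ) ∂γ = 0 := by
    have := integral_strongDual_stdGaussian (E := EuclideanSpace ℝ (Fin d)) (innerSL ℝ w)
    rw [← this]
    exact integral_congr_ae (.of_forall fun g => by simp [real_inner_comm])
  have hA : Integrable (fun g => F (g + w) - inner ℝ g w - ‖w‖ ^ 2 / 2) γ :=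
    (hFi.sub hlin).sub (integrable_const _)
  have e2 : ∫ g, F (g + w) ∂γ - ‖w‖ ^ 2 / 2 =
      ∫ g, (F (g + w) - inner ℝ g w - ‖w‖ ^ 2 / 2) ∂γ := by
    have h1 : ∫ g, (F (g + w) - inner ℝ g w - ‖w‖ ^ 2 / 2) ∂γ =
        ∫ g, (F (g + w) - inner ℝ g w) ∂γ - ∫ _, ‖w‖ ^ 2 / 2 ∂γ :=
      integral_sub (hFi.sub hlin) (integrable_const _)
    rw [h1, integral_sub hFi hlin, hz]
    simp
  have e3 : ∀ g, F (g + w) - inner ℝ (g + w) w + ‖w‖ ^ 2 / 2 =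
      F (g + w) - inner ℝ g w - ‖w‖ ^ 2 / 2 := fun g => by
    rw [inner_add_left, real_inner_self_eq_norm_sq]; ring
  simp_rw [e3]
  rw [e2]
  -- Jensen's inequality under the shifted law, after the log-density has been moved into the
  -- exponent. This is the Gibbs variational inequality, with relative entropy `‖w‖ ^ 2 / 2`.
  refine convexOn_exp.map_integral_le Real.continuous_exp.continuousOn isClosed_univ (by simp) hA ?_
  refine ((hexp (-w)).const_mul (Real.exp K)).mono'
    (Measurable.aestronglyMeasurable (by fun_prop)) (.of_forall fun g => ?_)
  simp only [Function.comp, Real.norm_eq_abs, Real.abs_exp, ← Real.exp_add, inner_neg_right]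
  apply Real.exp_le_exp.2
  have := (abs_le.1 (hK (g + w))).2
  nlinarith [sq_nonneg ‖w‖]

theorem integrable_of_abs_le {α : Type*} [MeasurableSpace α] {μ : Measure α} [IsFiniteMeasure μ]
    {f : α → ℝ} (hf : Measurable f) {K : ℝ} (hK : ∀ x, |f x| ≤ K) : Integrable f μ :=
  Integrable.of_bound hf.aestronglyMeasurable K (.of_forall hK)

theorem exp_le_one_add_add_sq {y : ℝ} (hy : |y| ≤ 1) : Real.exp y ≤ 1 + (y + y ^ 2) := by
  have := (abs_le.1 (Real.abs_exp_sub_one_sub_id_le hy)).2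
  linarith

/-- The PAC-Bayes inequality with Gaussian smoothing. -/
theorem pacBayes {d : ℕ} (μ : Measure (EuclideanSpace ℝ (Fin d))) [IsProbabilityMeasure μ] (n : ℕ)
    (f : EuclideanSpace ℝ (Fin d) → EuclideanSpace ℝ (Fin d) → ℝ)
    (hf : Measurable (Function.uncurry f)) (hf1 : ∀ x θ, |f x θ| ≤ 1) {β : ℝ} (hβ : 0 < β) (t : ℝ) :
    (Measure.pi fun _ : Fin n => μ) {x | ∃ v : EuclideanSpace ℝ (Fin d),
      n * ∫ g, ∫ y, (f y (v + (√β)⁻¹ • g) + f y (v + (√β)⁻¹ • g) ^ 2) ∂μ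
        ∂(stdGaussian (EuclideanSpace ℝ (Fin d))) + β * ‖v‖ ^ 2 / 2 + t ≤
      ∑ i, ∫ g, f (x i) (v + (√β)⁻¹ • g) ∂(stdGaussian (EuclideanSpace ℝ (Fin d)))} ≤
    ENNReal.ofReal (Real.exp (-t)) := by
  set γ := stdGaussian (EuclideanSpace ℝ (Fin d)) with hγ
  set P := Measure.pi fun _ : Fin n => μ with hP
  set c := (√β)⁻¹ with hc
  have hf' : ∀ θ, Measurable fun y => f y θ := fun θ =>
    hf.comp (measurable_id.prodMk measurable_const)
  set Λ : EuclideanSpace ℝ (Fin d) → ℝ := fun θ => ∫ y, (f y θ + f y θ ^ 2) ∂μ with hΛ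
  have hΛm : Measurable Λ := by
    have : StronglyMeasurable (fun p : EuclideanSpace ℝ (Fin d) × EuclideanSpace ℝ (Fin d) =>
        f p.2 p.1 + f p.2 p.1 ^ 2) := by
      have h := hf.comp (measurable_swap (α := EuclideanSpace ℝ (Fin d))
        (β := EuclideanSpace ℝ (Fin d)))
      exact (h.add (h.pow_const 2)).stronglyMeasurable
    exact this.integral_prod_right'.measurable
  have hq : ∀ y θ, |f y θ + f y θ ^ 2| ≤ 2 := fun y θ => by
    have h1 := abs_le.1 (hf1 y θ)
    rw [abs_le]; constructor <;> nlinarith [sq_nonneg (f y θ)]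
  have hΛ2 : ∀ θ, |Λ θ| ≤ 2 := fun θ => by
    have := norm_integral_le_of_norm_le_const (μ := μ) (C := 2)
      (f := fun y => f y θ + f y θ ^ 2) (.of_forall fun y => hq y θ)
    simpa using this
  -- The compensator makes `exp (F x θ)` have mean at most `1` for each fixed `θ`, because `exp y ≤
  -- 1 + y + y ^ 2` on `[-1, 1]`. By Fubini the same holds after averaging over the Gaussian prior,
  -- and Markov's inequality yields one event that serves all `v`.
  let F : (Fin n → EuclideanSpace ℝ (Fin d)) → EuclideanSpace ℝ (Fin d) → ℝ :=
    fun x θ => ∑ i, f (x i) θ - n * Λ θ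
  have hFm : Measurable (Function.uncurry F) := by
    refine Measurable.sub (Finset.measurable_sum _ fun i _ => ?_)
      ((hΛm.comp measurable_snd).const_mul _)
    have : Measurable fun p : (Fin n → EuclideanSpace ℝ (Fin d)) × EuclideanSpace ℝ (Fin d) =>
      (p.1 i, p.2) := by fun_prop
    exact hf.comp this
  have hFb : ∀ x θ, |F x θ| ≤ 3 * n := fun x θ => by
    have h1 : |∑ i, f (x i) θ| ≤ n := by
      refine (Finset.abs_sum_le_sum_abs _ _).trans ?_
      refine (Finset.sum_le_sum fun i _ => hf1 (x i) θ).trans ?_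
      simp
    have h2 : |n * Λ θ| ≤ n * 2 := by
      rw [abs_mul, Nat.abs_cast]; gcongr; exact hΛ2 θ
    calc |F x θ| ≤ |∑ i, f (x i) θ| + |n * Λ θ| := abs_sub _ _
      _ ≤ 3 * n := by linarith
  have hFcm : Measurable fun p : (Fin n → EuclideanSpace ℝ (Fin d)) × EuclideanSpace ℝ (Fin d) =>
      Real.exp (F p.1 (c • p.2)) := by
    have : Measurable fun p : (Fin n → EuclideanSpace ℝ (Fin d)) × EuclideanSpace ℝ (Fin d) =>
      (p.1, c • p.2) := by fun_prop
    exact Real.measurable_exp.comp (hFm.comp this)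
  have hFcb : ∀ p : (Fin n → EuclideanSpace ℝ (Fin d)) × EuclideanSpace ℝ (Fin d),
      |Real.exp (F p.1 (c • p.2))| ≤ Real.exp (3 * n) := fun p => by
    rw [Real.abs_exp]; exact Real.exp_le_exp.2 (abs_le.1 (hFb _ _)).2
  let Z : (Fin n → EuclideanSpace ℝ (Fin d)) → ℝ := fun x => ∫ g, Real.exp (F x (c • g)) ∂γ
  have hZi : Integrable Z P := (integrable_of_abs_le (μ := P.prod γ) hFcm hFcb).integral_prod_left
  have hmean : ∀ θ, ∫ x, Real.exp (F x θ) ∂P ≤ 1 := fun θ => by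
    have e : ∀ x, Real.exp (F x θ) = Real.exp (-(n * Λ θ)) * ∏ i, Real.exp (f (x i) θ) := fun x => by
      rw [← Real.exp_sum, ← Real.exp_add]; congr 1; simp only [F]; ring
    simp_rw [e]
    rw [integral_const_mul, hP, integral_fintype_prod_eq_prod (f := fun _ y => Real.exp (f y θ)),
      Finset.prod_const, Finset.card_univ, Fintype.card_fin]
    have h1 : ∫ y, Real.exp (f y θ) ∂μ ≤ Real.exp (Λ θ) := by
      have hi : Integrable (fun y => f y θ + f y θ ^ 2) μ :=
        integrable_of_abs_le ((hf' θ).add ((hf' θ).pow_const 2)) (fun y => hq y θ)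
      calc ∫ y, Real.exp (f y θ) ∂μ ≤ ∫ y, (1 + (f y θ + f y θ ^ 2)) ∂μ := by
            refine integral_mono (integrable_of_abs_le (K := Real.exp 1)
              (Real.measurable_exp.comp (hf' θ)) fun y => ?_) ((integrable_const 1).add hi)
              fun y => exp_le_one_add_add_sq (hf1 y θ)
            simp only [Real.abs_exp]
            exact Real.exp_le_exp.2 (abs_le.1 (hf1 y θ)).2
        _ = 1 + Λ θ := by rw [integral_add (integrable_const 1) hi]; simp [hΛ]
        _ ≤ Real.exp (Λ θ) := by linarith [Real.add_one_le_exp (Λ θ)]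
    calc Real.exp (-(n * Λ θ)) * (∫ y, Real.exp (f y θ) ∂μ) ^ n
        ≤ Real.exp (-(n * Λ θ)) * (Real.exp (Λ θ)) ^ n := by
          gcongr
      _ = 1 := by rw [← Real.exp_nat_mul, ← Real.exp_add]; simp
  have hZ1 : ∫ x, Z x ∂P ≤ 1 := by
    have := integral_integral_swap (f := fun x g => Real.exp (F x (c • g)))
      (integrable_of_abs_le (μ := P.prod γ) hFcm hFcb)
    rw [show ∫ x, Z x ∂P = _ from this]
    calc ∫ g, ∫ x, Real.exp (F x (c • g)) ∂P ∂γ ≤ ∫ _, (1 : ℝ) ∂γ :=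
          integral_mono (integrable_of_abs_le (μ := P.prod γ) hFcm hFcb).integral_prod_right
            (integrable_const 1) (fun g => hmean _)
      _ = 1 := by simp
  have hmarkov := mul_meas_ge_le_integral_of_nonneg (μ := P) (f := Z)
    (.of_forall fun x => integral_nonneg fun g => (Real.exp_pos _).le) hZi (Real.exp t)
  have hm2 : P {x | Real.exp t ≤ Z x} ≤ ENNReal.ofReal (Real.exp (-t)) := by
    rw [← ofReal_measureReal]
    apply ENNReal.ofReal_le_ofReal
    rw [Real.exp_neg, ← one_div, le_div_iff₀ (Real.exp_pos t)]
    linarith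
  refine (measure_mono ?_).trans hm2
  rintro x ⟨v, hv⟩
  have hFx : Measurable fun g => F x (c • g) := by
    have : Measurable fun g : EuclideanSpace ℝ (Fin d) => (x, c • g) := by fun_prop
    exact hFm.comp this
  -- Prior and posterior are images of the standard Gaussian under scaling by `c = 1 / √β`, so
  -- centring at `v` is a shift by `√β • v` and costs `β ‖v‖ ^ 2 / 2`.
  have hshift := exp_integral_shift_le (fun g => F x (c • g)) hFx (3 * n) (fun g => hFb _ _) (√β • v)
  have hsq : (0 : ℝ) < √β := Real.sqrt_pos.2 hβ
  have e1 : ∀ g, F x (c • (g + √β • v)) = ∑ i, f (x i) (v + c • g) - n * Λ (v + c • g) := fun g => by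
    have : c • (g + √β • v) = v + c • g := by
      rw [smul_add, smul_smul, hc, inv_mul_cancel₀ hsq.ne', one_smul, add_comm]
    rw [this]
  have hmeas : Measurable fun g : EuclideanSpace ℝ (Fin d) => v + c • g := by fun_prop
  have i1 : ∀ i, Integrable (fun g => f (x i) (v + c • g)) γ := fun i =>
    integrable_of_abs_le (hf.comp (measurable_const.prodMk hmeas)) fun g => hf1 _ _
  have e2 : ∫ g, F x (c • (g + √β • v)) ∂γ =
      ∑ i, ∫ g, f (x i) (v + c • g) ∂γ - n * ∫ g, Λ (v + c • g) ∂γ := by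
    simp_rw [e1]
    rw [integral_sub (integrable_finsetSum _ fun i _ => i1 i), integral_finsetSum _ fun i _ => i1 i,
      integral_const_mul]
    exact (integrable_of_abs_le (hΛm.comp hmeas) fun g => hΛ2 _).const_mul _
  have hnorm : ‖√β • v‖ ^ 2 = β * ‖v‖ ^ 2 := by
    rw [norm_smul, mul_pow, Real.norm_eq_abs, sq_abs, Real.sq_sqrt hβ.le]
  rw [e2, hnorm] at hshift
  refine le_trans (Real.exp_le_exp.2 ?_) hshift
  linarith

/-! ### Gaussian marginals and symmetric smoothing. -/

section GaussianMarginals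

variable {d : ℕ}

theorem map_inner_stdGaussian (x : EuclideanSpace ℝ (Fin d)) :
    (stdGaussian (EuclideanSpace ℝ (Fin d))).map (fun g => (inner ℝ x g : ℝ)) =
      gaussianReal 0 (‖x‖ ^ 2).toNNReal := by
  have := IsGaussian.map_eq_gaussianReal (μ := stdGaussian (EuclideanSpace ℝ (Fin d))) (innerSL ℝ x)
  rw [integral_strongDual_stdGaussian, variance_dual_stdGaussian, innerSL_apply_norm] at this
  exact this

theorem integral_inner_stdGaussian (x : EuclideanSpace ℝ (Fin d)) :
    ∫ g, (inner ℝ x g : ℝ) ∂(stdGaussian (EuclideanSpace ℝ (Fin d))) = 0 :=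
  integral_strongDual_stdGaussian (E := EuclideanSpace ℝ (Fin d)) (innerSL ℝ x)

theorem integrable_pow_inner_stdGaussian (x : EuclideanSpace ℝ (Fin d)) (k : ℕ) :
    Integrable (fun g => (inner ℝ x g : ℝ) ^ k) (stdGaussian (EuclideanSpace ℝ (Fin d))) := by
  have h : MemLp id (k : ENNReal) (gaussianReal 0 (‖x‖ ^ 2).toNNReal) :=
    memLp_id_gaussianReal' _ (by simp)
  rw [← map_inner_stdGaussian] at h
  have h2 := (h.comp_of_map (by fun_prop)).integrable_norm_pow'
  refine (integrable_norm_iff (by fun_prop)).1 (h2.congr (.of_forall fun g => by simp))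

theorem integral_inner_sq_stdGaussian (x : EuclideanSpace ℝ (Fin d)) :
    ∫ g, (inner ℝ x g : ℝ) ^ 2 ∂(stdGaussian (EuclideanSpace ℝ (Fin d))) = ‖x‖ ^ 2 := by
  have := variance_dual_stdGaussian (innerSL ℝ x)
  rw [variance_of_integral_eq_zero (by fun_prop) (integral_strongDual_stdGaussian _),
    innerSL_apply_norm] at this
  simpa using this

/-- A crude stand-in for the exact constant `3`: `y ^ 4 ≤ 24 (e ^ y + e ^ (-y))` has Gaussian mean
`48 √e < 80`. -/
theorem integral_inner_four_stdGaussian_le (x : EuclideanSpace ℝ (Fin d)) :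
    ∫ g, (inner ℝ x g : ℝ) ^ 4 ∂(stdGaussian (EuclideanSpace ℝ (Fin d))) ≤ 80 * ‖x‖ ^ 4 := by
  have h1 : ∫ y : ℝ, y ^ 4 ∂(gaussianReal 0 1) ≤ 80 := by
    have e1 := integrable_exp_mul_gaussianReal (μ := 0) (v := 1) 1
    have e2 := integrable_exp_mul_gaussianReal (μ := 0) (v := 1) (-1)
    have m1 := congrFun (mgf_id_gaussianReal (μ := 0) (v := 1)) 1
    have m2 := congrFun (mgf_id_gaussianReal (μ := 0) (v := 1)) (-1)
    simp only [mgf, id] at m1 m2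
    have key : ∀ y : ℝ, y ^ 4 ≤ 24 * (Real.exp (1 * y) + Real.exp (-1 * y)) := fun y => by
      have := Real.pow_div_factorial_le_exp |y| (abs_nonneg y) 4
      rw [show |y| ^ 4 = y ^ 4 by rw [show 4 = 2 * 2 from rfl, pow_mul, sq_abs, ← pow_mul]] at this
      norm_num [Nat.factorial] at this
      have h3 : Real.exp |y| ≤ Real.exp (1 * y) + Real.exp (-1 * y) := by
        rcases abs_cases y with ⟨h, _⟩ | ⟨h, _⟩ <;> rw [h]
        · simp [Real.exp_nonneg]
        · simp [Real.exp_nonneg]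
      linarith
    calc ∫ y : ℝ, y ^ 4 ∂(gaussianReal 0 1)
        ≤ ∫ y, 24 * (Real.exp (1 * y) + Real.exp (-1 * y)) ∂(gaussianReal 0 1) := by
          refine integral_mono ?_ ((e1.add e2).const_mul 24) key
          refine ((e1.add e2).const_mul 24).mono' (by fun_prop) (.of_forall fun y => ?_)
          rw [Real.norm_of_nonneg (by positivity)]; exact key y
      _ ≤ 80 := by
          rw [integral_const_mul, integral_add e1 e2, m1, m2]
          norm_num
          have : Real.exp (1 / 2) ≤ 1.6488 := by
            rw [show (1.6488 : ℝ) = √(1.6488 ^ 2) by rw [Real.sqrt_sq]; norm_num, Real.exp_half]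
            apply Real.sqrt_le_sqrt
            have := Real.exp_one_lt_d9
            norm_num at this ⊢
            linarith
          linarith
  have h2 : gaussianReal 0 (‖x‖ ^ 2).toNNReal = (gaussianReal 0 1).map (fun y => ‖x‖ * y) := by
    rw [gaussianReal_map_const_mul]
    congr 1
    · simp
    · rw [mul_one]; ext; simp
  have h3 : ∫ g, (inner ℝ x g : ℝ) ^ 4 ∂(stdGaussian (EuclideanSpace ℝ (Fin d))) =
      ∫ y, y ^ 4 ∂(gaussianReal 0 (‖x‖ ^ 2).toNNReal) := by
    rw [← map_inner_stdGaussian, integral_map (by fun_prop) (by fun_prop)]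
  rw [h3, h2, integral_map (by fun_prop) (by fun_prop)]
  simp_rw [mul_pow]
  rw [integral_const_mul]
  nlinarith [pow_nonneg (norm_nonneg x) 4]

theorem stdGaussian_map_neg :
    (stdGaussian (EuclideanSpace ℝ (Fin d))).map (fun g => -g) =
      stdGaussian (EuclideanSpace ℝ (Fin d)) :=
  stdGaussian_map (LinearIsometryEquiv.neg ℝ (E := EuclideanSpace ℝ (Fin d)))

/-- Symmetric smoothing does not decrease, up to a constant, an increasing function of the square. -/
theorem smoothing_lower_bound {h : ℝ → ℝ} (hm : Monotone h) (h0 : ∀ y, 0 ≤ h y) (h1 : ∀ y, h y ≤ 1)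
    {G : Set (EuclideanSpace ℝ (Fin d))} (hG : MeasurableSet G) (hGs : ∀ g ∈ G, -g ∈ G)
    (x v : EuclideanSpace ℝ (Fin d)) (c : ℝ) :
    (stdGaussian (EuclideanSpace ℝ (Fin d))).real G / 2 * h ((inner ℝ x v) ^ 2) ≤
      ∫ g, G.indicator (fun g => h ((inner ℝ x (v + c • g)) ^ 2)) g
        ∂(stdGaussian (EuclideanSpace ℝ (Fin d))) := by
  set γ := stdGaussian (EuclideanSpace ℝ (Fin d)) with hγ
  set Φ : EuclideanSpace ℝ (Fin d) → ℝ :=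
    G.indicator (fun g => h ((inner ℝ x (v + c • g)) ^ 2)) with hΦ
  have hΦm : Measurable Φ := by
    refine Measurable.indicator ?_ hG
    exact hm.measurable.comp (by fun_prop)
  have hb : ∀ g, |Φ g| ≤ 1 := fun g => by
    by_cases hg : g ∈ G
    · simp only [hΦ, Set.indicator_of_mem hg, abs_of_nonneg (h0 _)]; exact h1 _
    · simp [hΦ, Set.indicator_of_notMem hg]
  have hneg : ∫ g, Φ g ∂γ = ∫ g, Φ (-g) ∂γ := by
    conv_lhs => rw [hγ, ← stdGaussian_map_neg]
    rw [integral_map (by fun_prop) hΦm.aestronglyMeasurable]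
  have i1 : Integrable Φ γ := integrable_of_abs_le hΦm hb
  have i2 : Integrable (fun g => Φ (-g)) γ :=
    integrable_of_abs_le (hΦm.comp measurable_neg) fun g => hb _
  -- Of the two points `g` and `-g`, one moves `⟨x, v⟩` away from zero; the loss is a factor `2` and
  -- the mass of `G`.
  have hle : ∫ g, G.indicator (fun _ => h ((inner ℝ x v) ^ 2)) g ∂γ ≤ ∫ g, (Φ g + Φ (-g)) ∂γ := by
    refine integral_mono ((integrable_const _).indicator hG) (i1.add i2) fun g => ?_
    by_cases hg : g ∈ G
    · simp only [hΦ, Set.indicator_of_mem hg, Set.indicator_of_mem (hGs g hg)]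
      have e1 : inner ℝ x (v + c • g) = inner ℝ x v + c * inner ℝ x g := by
        rw [inner_add_right, inner_smul_right]
      have e2 : inner ℝ x (v + c • -g) = inner ℝ x v - c * inner ℝ x g := by
        rw [inner_add_right, inner_smul_right, inner_neg_right]; ring
      rw [e1, e2]
      rcases le_total 0 (inner ℝ x v * (c * inner ℝ x g)) with hs | hs
      · have := hm (show (inner ℝ x v) ^ 2 ≤ (inner ℝ x v + c * inner ℝ x g) ^ 2 by
          nlinarith [sq_nonneg (c * inner ℝ x g)])
        linarith [h0 ((inner ℝ x v - c * inner ℝ x g) ^ 2)]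
      · have := hm (show (inner ℝ x v) ^ 2 ≤ (inner ℝ x v - c * inner ℝ x g) ^ 2 by
          nlinarith [sq_nonneg (c * inner ℝ x g)])
        linarith [h0 ((inner ℝ x v + c * inner ℝ x g) ^ 2)]
    · have hg' : -g ∉ G := fun h' => hg (by simpa using hGs _ h')
      simp [hΦ, Set.indicator_of_notMem hg, Set.indicator_of_notMem hg']
  rw [integral_indicator_const _ hG, integral_add i1 i2, ← hneg, smul_eq_mul] at hle
  linarith

end GaussianMarginals

theorem add_pow_four_le (a b : ℝ) : (a + b) ^ 4 ≤ 8 * (a ^ 4 + b ^ 4) := by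
  nlinarith [sq_nonneg (a - b), sq_nonneg (a ^ 2 - b ^ 2), sq_nonneg (a * b), sq_nonneg (a + b),
    mul_nonneg (sq_nonneg (a - b)) (sq_nonneg (a - b)), mul_nonneg (sq_nonneg (a - b)) (sq_nonneg (a + b)),
    mul_nonneg (sq_nonneg (a - b)) (sq_nonneg a), mul_nonneg (sq_nonneg (a - b)) (sq_nonneg b)]

/-- The effect of centred smoothing on the truncated square. -/
theorem abs_integral_min_sq_sub_le {Ω : Type*} [MeasurableSpace Ω] {γ : Measure Ω}
    [IsProbabilityMeasure γ] {h : Ω → ℝ} (hm : Measurable h) (hi : ∀ k : ℕ, Integrable (fun g => h g ^ k) γ)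
    (hz : ∫ g, h g ∂γ = 0) {τ : ℝ} (hτ : ∫ g, h g ^ 2 ∂γ = τ) (h4 : ∫ g, h g ^ 4 ∂γ ≤ 80 * τ ^ 2)
    (a : ℝ) {s : ℝ} (hs : 0 < s) :
    |∫ g, min ((a + h g) ^ 2) s ∂γ - min (a ^ 2) s - min τ s| ≤
      640 / s * (min (a ^ 2) s ^ 2 + min τ s ^ 2) := by
  have hτ0 : 0 ≤ τ := hτ ▸ integral_nonneg fun g => sq_nonneg _
  have hmin : Integrable (fun g => min ((a + h g) ^ 2) s) γ := by
    refine integrable_of_abs_le (K := s) (by fun_prop) fun g => ?_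
    rw [abs_of_nonneg (le_min (sq_nonneg _) hs.le)]; exact min_le_right _ _
  have hlo : 0 ≤ ∫ g, min ((a + h g) ^ 2) s ∂γ :=
    integral_nonneg fun g => le_min (sq_nonneg _) hs.le
  have hhi : ∫ g, min ((a + h g) ^ 2) s ∂γ ≤ s := by
    calc _ ≤ ∫ _, s ∂γ := integral_mono hmin (integrable_const _) fun g => min_le_right _ _
      _ = s := by simp
  have hA0 : 0 ≤ min (a ^ 2) s := le_min (sq_nonneg _) hs.le
  have hT0 : 0 ≤ min τ s := le_min hτ0 hs.le
  -- If neither square exceeds `s`, expand using `z - z ^ 2 / s ≤ min z s ≤ z`. Otherwise the right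
  -- side is at least `640 s` and the claim is trivial.
  by_cases hc : a ^ 2 ≤ s ∧ τ ≤ s
  · rw [min_eq_left hc.1, min_eq_left hc.2]
    have i1 : Integrable h γ := by simpa using hi 1
    have hsq : Integrable (fun g => (a + h g) ^ 2) γ := by
      have : Integrable (fun g => a ^ 2 + 2 * a * h g + h g ^ 2) γ :=
        ((integrable_const _).add (i1.const_mul _)).add (hi 2)
      exact this.congr (.of_forall fun g => by ring)
    have hsq' : ∫ g, (a + h g) ^ 2 ∂γ = a ^ 2 + τ := by
      have e : ∀ g, (a + h g) ^ 2 = (a ^ 2 + 2 * a * h g) + h g ^ 2 := fun g => by ring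
      simp_rw [e]
      have j1 : Integrable (fun g => a ^ 2 + 2 * a * h g) γ :=
        (integrable_const _).add (i1.const_mul _)
      rw [integral_add j1 (hi 2), integral_add (integrable_const _) (i1.const_mul _),
        integral_const_mul, hz, hτ]
      simp
    have up : ∫ g, min ((a + h g) ^ 2) s ∂γ ≤ a ^ 2 + τ := by
      rw [← hsq']
      exact integral_mono hmin hsq fun g => min_le_left _ _
    have i4 : Integrable (fun g => 8 / s * (a ^ 4 + h g ^ 4)) γ :=
      ((integrable_const _).add (hi 4)).const_mul _
    have lo : a ^ 2 + τ - 8 / s * (a ^ 4 + 80 * τ ^ 2) ≤ ∫ g, min ((a + h g) ^ 2) s ∂γ := by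
      calc a ^ 2 + τ - 8 / s * (a ^ 4 + 80 * τ ^ 2)
          ≤ a ^ 2 + τ - 8 / s * (a ^ 4 + ∫ g, h g ^ 4 ∂γ) := by gcongr
        _ = ∫ g, ((a + h g) ^ 2 - 8 / s * (a ^ 4 + h g ^ 4)) ∂γ := by
            rw [integral_sub hsq i4, hsq', integral_const_mul,
              integral_add (integrable_const _) (hi 4)]
            simp
        _ ≤ _ := by
            refine integral_mono (hsq.sub i4) hmin fun g => ?_
            have h8 := add_pow_four_le a (h g)
            have : (a + h g) ^ 4 / s ≤ 8 / s * (a ^ 4 + h g ^ 4) := by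
              rw [div_mul_eq_mul_div]; gcongr
            refine le_min (by simp only [sub_le_self_iff]; positivity) ?_
            have h9 : (a + h g) ^ 2 - (a + h g) ^ 4 / s ≤ s := by
              rw [sub_le_iff_le_add, ← sub_le_iff_le_add', le_div_iff₀ hs]
              nlinarith [sq_nonneg ((a + h g) ^ 2 - s)]
            simp only; linarith
    have e8 : 8 / s * (a ^ 4 + 80 * τ ^ 2) ≤ 640 / s * ((a ^ 2) ^ 2 + τ ^ 2) := by
      rw [div_mul_eq_mul_div, div_mul_eq_mul_div]
      refine div_le_div_of_nonneg_right ?_ hs.le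
      nlinarith [sq_nonneg (a ^ 2)]
    rw [abs_le]; constructor
    · linarith
    · have : 0 ≤ 640 / s * ((a ^ 2) ^ 2 + τ ^ 2) := by positivity
      linarith
  · have h2 : s ^ 2 ≤ min (a ^ 2) s ^ 2 + min τ s ^ 2 := by
      rw [not_and_or, not_le, not_le] at hc
      rcases hc with hc | hc
      · rw [min_eq_right hc.le]; nlinarith [sq_nonneg (min τ s)]
      · rw [min_eq_right hc.le]; nlinarith [sq_nonneg (min (a ^ 2) s)]
    have h3 : 640 * s ≤ 640 / s * (min (a ^ 2) s ^ 2 + min τ s ^ 2) := by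
      calc 640 * s = 640 / s * s ^ 2 := by field_simp
        _ ≤ _ := by gcongr
    have h5 := min_le_right (a ^ 2) s
    have h6 := min_le_right τ s
    rw [abs_le]; constructor <;> linarith

/-! ### Trimmed sums. -/

noncomputable section

/-- The smallest sum that is left after the removal of at most `k` terms. -/
def trimmedSum {n : ℕ} (k : ℕ) (a : Fin n → ℝ) : ℝ :=
  (Finset.univ.filter fun J : Finset (Fin n) => J.card ≤ k).inf' ⟨∅, by simp⟩ fun J => ∑ i ∈ Jᶜ, a i

section trimmedSum

variable {n : ℕ} {a : Fin n → ℝ}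

theorem trimmedSum_le {k : ℕ} {J : Finset (Fin n)} (hJ : J.card ≤ k) :
    trimmedSum k a ≤ ∑ i ∈ Jᶜ, a i :=
  Finset.inf'_le _ (by simpa using hJ)

theorem exists_trimmedSum_eq (k : ℕ) (a : Fin n → ℝ) :
    ∃ J : Finset (Fin n), J.card ≤ k ∧ trimmedSum k a = ∑ i ∈ Jᶜ, a i := by
  obtain ⟨J, hJ, h⟩ := Finset.exists_mem_eq_inf' (s := Finset.univ.filter
    fun J : Finset (Fin n) => J.card ≤ k) ⟨∅, by simp⟩ fun J => ∑ i ∈ Jᶜ, a i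
  exact ⟨J, by simpa using hJ, h⟩

theorem trimmedSum_nonneg (k : ℕ) (ha : ∀ i, 0 ≤ a i) : 0 ≤ trimmedSum k a := by
  obtain ⟨J, _, h⟩ := exists_trimmedSum_eq k a
  exact h ▸ Finset.sum_nonneg fun i _ => ha i

theorem trimmedSum_antitone (a : Fin n → ℝ) : Antitone fun k => trimmedSum k a := fun k l hkl => by
  obtain ⟨J, hJ, h⟩ := exists_trimmedSum_eq k a
  simp only [h]
  exact trimmedSum_le (hJ.trans hkl)

theorem trimmedSum_le_sum_min (ha : ∀ i, 0 ≤ a i) {k : ℕ} {b : ℝ} (hb : 0 ≤ b)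
    (hk : (Finset.univ.filter fun i => b < a i).card ≤ k) :
    trimmedSum k a ≤ ∑ i, min (a i) b := by
  refine (trimmedSum_le hk).trans ?_
  calc ∑ i ∈ (Finset.univ.filter fun i => b < a i)ᶜ, a i
      = ∑ i ∈ (Finset.univ.filter fun i => b < a i)ᶜ, min (a i) b := by
        refine Finset.sum_congr rfl fun i hi => ?_
        rw [min_eq_left]; simpa using hi
    _ ≤ _ := Finset.sum_le_sum_of_subset_of_nonneg (Finset.subset_univ _)
        fun i _ _ => le_min (ha i) hb

theorem sum_min_sub_le_trimmedSum (k : ℕ) (a : Fin n → ℝ) {b : ℝ} (hb : 0 ≤ b) :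
    ∑ i, min (a i) b - k * b ≤ trimmedSum k a := by
  obtain ⟨J, hJ, h⟩ := exists_trimmedSum_eq k a
  rw [h, ← Finset.sum_add_sum_compl J fun i => min (a i) b]
  have h1 : ∑ i ∈ J, min (a i) b ≤ k * b := by
    calc _ ≤ ∑ _i ∈ J, b := Finset.sum_le_sum fun i _ => min_le_right _ _
      _ = J.card * b := by simp
      _ ≤ k * b := by gcongr
  have h2 : ∑ i ∈ Jᶜ, min (a i) b ≤ ∑ i ∈ Jᶜ, a i := Finset.sum_le_sum fun i _ => min_le_left _ _
  linarith

/-- Take an optimal set of at most `k + 1` removed indices. If it has a term of size at most `s`,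
put that one back; otherwise all its terms exceed `s`, so it has at most `k` elements already. -/
theorem trimmedSum_le_succ_add {k : ℕ} {s : ℝ} (hs : 0 ≤ s)
    (hk : (Finset.univ.filter fun i => s < a i).card ≤ k) :
    trimmedSum k a ≤ trimmedSum (k + 1) a + s := by
  obtain ⟨J, hJ, h⟩ := exists_trimmedSum_eq (k + 1) a
  rw [h]
  by_cases hc : ∃ i ∈ J, a i ≤ s
  · obtain ⟨i, hi, his⟩ := hc
    have h1 : (J.erase i).card ≤ k := by rw [Finset.card_erase_of_mem hi]; omega
    refine (trimmedSum_le h1).trans ?_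
    rw [Finset.compl_erase, Finset.sum_insert (by simpa using hi)]
    linarith
  · push Not at hc
    have h1 : J.card ≤ k := (Finset.card_le_card fun i hi => by simpa using hc i hi).trans hk
    linarith [trimmedSum_le (a := a) h1]

theorem trimmedSum_le_add_sum {k l : ℕ} (hkl : k ≤ l) {s : ℕ → ℝ} (hs : ∀ j, 0 ≤ s j)
    (h : ∀ j, k ≤ j → j < l → (Finset.univ.filter fun i => s j < a i).card ≤ j) :
    trimmedSum k a ≤ trimmedSum l a + ∑ j ∈ Finset.Ico k l, s j := by
  induction l, hkl using Nat.le_induction with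
  | base => simp
  | succ l hkl ih =>
    have h1 := ih fun j hj hjl => h j hj (by omega)
    have h2 := trimmedSum_le_succ_add (hs l) (h l hkl (by omega))
    rw [Finset.sum_Ico_succ_top hkl]
    linarith

theorem continuous_trimmedSum {X : Type*} [TopologicalSpace X] (k : ℕ) {f : Fin n → X → ℝ}
    (hf : ∀ i, Continuous (f i)) : Continuous fun x => trimmedSum k fun i => f i x := by
  unfold trimmedSum
  refine Continuous.finset_inf'_apply _ fun J _ => ?_
  exact continuous_finsetSum _ fun i _ => hf i

end trimmedSum

end

/-! ### Deviation of sums of a single bounded function. -/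

section ScalarEvents

variable {d n : ℕ} (μ : Measure (EuclideanSpace ℝ (Fin d))) [IsProbabilityMeasure μ]

/-- PAC-Bayes with no dependence on the parameter, at `v = 0`; the factor `2` comes from `h + h ^ 2
≤ 2 h`. -/
theorem measure_scalar_upper {h : EuclideanSpace ℝ (Fin d) → ℝ} (hm : Measurable h)
    (h0 : ∀ y, 0 ≤ h y) (h1 : ∀ y, h y ≤ 1) (t : ℝ) :
    (Measure.pi fun _ : Fin n => μ) {x | 2 * n * ∫ y, h y ∂μ + t ≤ ∑ i, h (x i)} ≤
      ENNReal.ofReal (Real.exp (-t)) := by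
  refine (measure_mono ?_).trans (pacBayes μ n (fun x _ => h x) (hm.comp measurable_fst)
    (fun x _ => by rw [abs_of_nonneg (h0 x)]; exact h1 x) one_pos t)
  intro x hx
  refine ⟨0, ?_⟩
  simp only [integral_const, probReal_univ, one_smul, norm_zero]
  have hi : Integrable h μ := integrable_of_abs_le hm fun y => by
    rw [abs_of_nonneg (h0 y)]; exact h1 y
  have hi2 : Integrable (fun y => h y ^ 2) μ := integrable_of_abs_le (K := 1) (hm.pow_const 2) fun y => by
    rw [abs_of_nonneg (sq_nonneg _)]; nlinarith [h0 y, h1 y]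
  have : ∫ y, (h y + h y ^ 2) ∂μ ≤ 2 * ∫ y, h y ∂μ := by
    rw [← integral_const_mul]
    exact integral_mono (hi.add hi2) (hi.const_mul 2) fun y => by
      simp only; nlinarith [h0 y, h1 y]
  have h2 : (n : ℝ) * ∫ y, (h y + h y ^ 2) ∂μ ≤ n * (2 * ∫ y, h y ∂μ) := by gcongr
  simp only [Set.mem_ofPred_eq] at hx
  linarith

/-- Apply the same to `-h / 2`: halving gives `-h / 2 + h ^ 2 / 4 ≤ -h / 4`, so a negative mean
survives the quadratic term. -/
theorem measure_scalar_lower {h : EuclideanSpace ℝ (Fin d) → ℝ} (hm : Measurable h)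
    (h0 : ∀ y, 0 ≤ h y) (h1 : ∀ y, h y ≤ 1) (t : ℝ) :
    (Measure.pi fun _ : Fin n => μ) {x | ∑ i, h (x i) ≤ n * (∫ y, h y ∂μ) / 2 - 2 * t} ≤
      ENNReal.ofReal (Real.exp (-t)) := by
  refine (measure_mono ?_).trans (pacBayes μ n (fun x _ => -(h x / 2))
    ((hm.comp measurable_fst).div_const 2).neg
    (fun x _ => by rw [abs_neg, abs_of_nonneg (by linarith [h0 x])]; linarith [h1 x]) one_pos t)
  intro x hx
  refine ⟨0, ?_⟩
  simp only [integral_const, probReal_univ, one_smul, norm_zero]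
  have hi : Integrable h μ := integrable_of_abs_le hm fun y => by
    rw [abs_of_nonneg (h0 y)]; exact h1 y
  have hi2 : Integrable (fun y => (-(h y / 2)) ^ 2) μ :=
    integrable_of_abs_le (K := 1) ((hm.div_const 2).neg.pow_const 2) fun y => by
      rw [abs_of_nonneg (sq_nonneg _)]; nlinarith [h0 y, h1 y]
  have : ∫ y, (-(h y / 2) + (-(h y / 2)) ^ 2) ∂μ ≤ -(1 / 4) * ∫ y, h y ∂μ := by
    rw [← integral_const_mul]
    exact integral_mono ((hi.div_const 2).neg.add hi2) (hi.const_mul _) fun y => by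
      simp only; nlinarith [h0 y, h1 y]
  have h2 : (n : ℝ) * ∫ y, (-(h y / 2) + (-(h y / 2)) ^ 2) ∂μ ≤ n * (-(1 / 4) * ∫ y, h y ∂μ) := by
    gcongr
  simp only [Set.mem_ofPred_eq] at hx
  rw [Finset.sum_neg_distrib, ← Finset.sum_div]
  linarith

end ScalarEvents

/-! ### Uniform upper bounds over directions. -/

section DirectionalEvents

variable {d n : ℕ} (μ : Measure (EuclideanSpace ℝ (Fin d))) [IsProbabilityMeasure μ]

/-- Smoothing only over `g ∈ G` keeps at least a quarter of each summand, since `G` is symmetric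
with mass at least `1 / 2`. The set `Θ` discards atypical smoothed directions, so the population
bound `D` is only needed where `θ` behaves well. -/
theorem measure_directional_upper {h : ℝ → ℝ} (hm : Monotone h) (h0 : ∀ y, 0 ≤ h y)
    (h1 : ∀ y, h y ≤ 1) {G Θ : Set (EuclideanSpace ℝ (Fin d))} (hG : MeasurableSet G)
    (hΘ : MeasurableSet Θ) (hGs : ∀ g ∈ G, -g ∈ G)
    (hGm : 1 / 2 ≤ (stdGaussian (EuclideanSpace ℝ (Fin d))).real G) {β : ℝ} (hβ : 0 < β)
    (hGΘ : ∀ v : EuclideanSpace ℝ (Fin d), ‖v‖ ≤ 1 → ∀ g ∈ G, v + (√β)⁻¹ • g ∈ Θ) {D : ℝ}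
    (hD : ∀ v : EuclideanSpace ℝ (Fin d), ‖v‖ ≤ 1 →
      ∫ g, ∫ y, Θ.indicator (fun θ => h ((inner ℝ y θ) ^ 2)) (v + (√β)⁻¹ • g) ∂μ
        ∂(stdGaussian (EuclideanSpace ℝ (Fin d))) ≤ D) (t : ℝ) :
    (Measure.pi fun _ : Fin n => μ) {x | ∃ v : EuclideanSpace ℝ (Fin d), ‖v‖ ≤ 1 ∧
      8 * n * D + 2 * β + 4 * t ≤ ∑ i, h ((inner ℝ (x i) v) ^ 2)} ≤
      ENNReal.ofReal (Real.exp (-t)) := by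
  set c := (√β)⁻¹ with hc
  set γ := stdGaussian (EuclideanSpace ℝ (Fin d)) with hγ
  set f : EuclideanSpace ℝ (Fin d) → EuclideanSpace ℝ (Fin d) → ℝ :=
    fun y => Θ.indicator (fun θ => h ((inner ℝ y θ) ^ 2)) with hf
  have hfm : Measurable (Function.uncurry f) := by
    have e : Function.uncurry f = (Prod.snd ⁻¹' Θ).indicator
        (fun p : EuclideanSpace ℝ (Fin d) × EuclideanSpace ℝ (Fin d) =>
          h ((inner ℝ p.1 p.2) ^ 2)) := by
      ext ⟨y, θ⟩
      by_cases hθ : θ ∈ Θ <;> simp [hf, hθ]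
    rw [e]
    exact Measurable.indicator (hm.measurable.comp (by fun_prop)) (measurable_snd hΘ)
  have hf0 : ∀ y θ, 0 ≤ f y θ := fun y θ => Set.indicator_nonneg (fun _ _ => h0 _) _
  have hf1 : ∀ y θ, f y θ ≤ 1 := fun y θ =>
    Set.indicator_le' (fun _ _ => h1 _) (fun _ _ => zero_le_one) θ
  have hfa : ∀ y θ, |f y θ| ≤ 1 := fun y θ => by rw [abs_of_nonneg (hf0 y θ)]; exact hf1 y θ
  have hf2 : ∀ y θ, |f y θ + f y θ ^ 2| ≤ 2 := fun y θ => by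
    rw [abs_of_nonneg (add_nonneg (hf0 y θ) (sq_nonneg _))]
    nlinarith [hf0 y θ, hf1 y θ]
  refine (measure_mono ?_).trans (pacBayes μ n f hfm hfa hβ t)
  rintro x ⟨v, hv, hx⟩
  refine ⟨v, ?_⟩
  have hfθ : ∀ θ, Measurable fun y => f y θ := fun θ =>
    hfm.comp (measurable_id.prodMk measurable_const)
  have hfy : ∀ y, Measurable fun θ => f y θ := fun y =>
    hfm.comp (measurable_const.prodMk measurable_id)
  have hshift : Measurable fun g : EuclideanSpace ℝ (Fin d) => v + c • g := by fun_prop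
  have hpop : ∫ g, ∫ y, (f y (v + c • g) + f y (v + c • g) ^ 2) ∂μ ∂γ ≤ 2 * D := by
    refine le_trans ?_ (mul_le_mul_of_nonneg_left (hD v hv) zero_le_two)
    rw [← integral_const_mul]
    have hjoint : Measurable fun p : EuclideanSpace ℝ (Fin d) × EuclideanSpace ℝ (Fin d) =>
        f p.2 (v + c • p.1) := by
      have : Measurable fun p : EuclideanSpace ℝ (Fin d) × EuclideanSpace ℝ (Fin d) =>
        (p.2, v + c • p.1) := by fun_prop
      exact hfm.comp this
    refine integral_mono ?_ ?_ fun g => ?_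
    · refine (integrable_of_abs_le (μ := γ.prod μ) (K := 2) (hjoint.add (hjoint.pow_const 2))
        fun p => hf2 _ _).integral_prod_left
    · exact ((integrable_of_abs_le (μ := γ.prod μ) hjoint
        fun p => hfa _ _).integral_prod_left).const_mul 2
    · simp only
      rw [← integral_const_mul]
      refine integral_mono ?_ ?_ fun y => ?_
      · refine integrable_of_abs_le (K := 2) ((hfθ _).add ((hfθ _).pow_const 2)) fun y => hf2 _ _
      · exact (integrable_of_abs_le (hfθ _) fun y => hfa _ _).const_mul 2
      · simp only
        nlinarith [hf0 y (v + c • g), hf1 y (v + c • g)]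
  have hlow : ∀ i, h ((inner ℝ (x i) v) ^ 2) / 4 ≤ ∫ g, f (x i) (v + c • g) ∂γ := fun i => by
    calc h ((inner ℝ (x i) v) ^ 2) / 4 ≤ γ.real G / 2 * h ((inner ℝ (x i) v) ^ 2) := by
          nlinarith [h0 ((inner ℝ (x i) v) ^ 2)]
      _ ≤ _ := smoothing_lower_bound hm h0 h1 hG hGs (x i) v c
      _ ≤ _ := by
          refine integral_mono (integrable_of_abs_le (K := 1) (Measurable.indicator
            (hm.measurable.comp (by fun_prop)) hG) fun g => ?_)
            (integrable_of_abs_le ((hfy _).comp hshift) fun g => hfa _ _) fun g => ?_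
          · rw [abs_of_nonneg (Set.indicator_nonneg (fun _ _ => h0 _) _)]
            exact Set.indicator_le' (fun _ _ => h1 _) (fun _ _ => zero_le_one) g
          · by_cases hg : g ∈ G
            · simp only [Set.indicator_of_mem hg, hf, Set.indicator_of_mem (hGΘ v hv g hg)]
              exact le_rfl
            · rw [Set.indicator_of_notMem hg]; exact hf0 _ _
  have hsum : (∑ i, h ((inner ℝ (x i) v) ^ 2)) / 4 ≤ ∑ i, ∫ g, f (x i) (v + c • g) ∂γ := by
    rw [Finset.sum_div]; exact Finset.sum_le_sum fun i _ => hlow i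
  have h2 : (n : ℝ) * ∫ g, ∫ y, (f y (v + c • g) + f y (v + c • g) ^ 2) ∂μ ∂γ ≤ n * (2 * D) := by
    gcongr
  have h3 : β * ‖v‖ ^ 2 ≤ β := by
    have : ‖v‖ ^ 2 ≤ 1 := pow_le_one₀ (norm_nonneg _) hv
    nlinarith
  linarith

/-- The indicator of `(B, ∞)`. -/
noncomputable def tailInd (B y : ℝ) : ℝ := if B < y then 1 else 0

theorem tailInd_monotone (B : ℝ) : Monotone (tailInd B) := fun a b hab => by
  unfold tailInd
  by_cases ha : B < a
  · rw [if_pos ha, if_pos (ha.trans_le hab)]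
  · rw [if_neg ha]; split_ifs <;> norm_num

theorem tailInd_nonneg (B y : ℝ) : 0 ≤ tailInd B y := by unfold tailInd; split_ifs <;> norm_num

theorem tailInd_le_one (B y : ℝ) : tailInd B y ≤ 1 := by unfold tailInd; split_ifs <;> norm_num

theorem sum_tailInd (B : ℝ) (a : Fin n → ℝ) :
    ∑ i, tailInd B (a i) = ((Finset.univ.filter fun i => B < a i).card : ℝ) := by
  simp [tailInd]

/-- One of `4 a ^ 2`, `4 b ^ 2` must exceed `B`. The truncation is kept on the `b` term only: there
`b` will be the Gaussian noise, governed by `‖y‖`, whose contribution is controlled through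
truncated moments. -/
theorem tailInd_add_sq_le {B : ℝ} (hB : 0 < B) (a b : ℝ) :
    tailInd B ((a + b) ^ 2) ≤ 16 * a ^ 4 / B ^ 2 + min (16 * b ^ 4 / B ^ 2) 1 := by
  unfold tailInd
  split_ifs with h
  · by_cases hb : 1 ≤ 16 * b ^ 4 / B ^ 2
    · rw [min_eq_right hb]
      have : 0 ≤ 16 * a ^ 4 / B ^ 2 := by positivity
      linarith
    · push Not at hb
      rw [min_eq_left hb.le]
      have h1 : 16 * b ^ 4 < B ^ 2 := by rwa [div_lt_one (by positivity)] at hb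
      have h2 : 4 * b ^ 2 < B := by
        nlinarith [sq_nonneg b]
      have h3 : B < 4 * a ^ 2 := by nlinarith [sq_nonneg (a - b)]
      have h4 : 1 ≤ 16 * a ^ 4 / B ^ 2 := by
        rw [le_div_iff₀ (by positivity)]; nlinarith
      have : 0 ≤ 16 * b ^ 4 / B ^ 2 := by positivity
      linarith
  · have : 0 ≤ min (16 * b ^ 4 / B ^ 2) 1 := le_min (by positivity) zero_le_one
    positivity

theorem integrable_inner_pow_four {μ : Measure (EuclideanSpace ℝ (Fin d))}
    (h4 : Integrable (fun x => ‖x‖ ^ 4) μ) (v : EuclideanSpace ℝ (Fin d)) :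
    Integrable (fun x => (inner ℝ x v : ℝ) ^ 4) μ := by
  refine (h4.mul_const (‖v‖ ^ 4)).mono' (by fun_prop) (.of_forall fun x => ?_)
  rw [norm_pow, ← mul_pow]
  gcongr
  exact norm_inner_le_norm x v

/-- Uniformly over directions, few sample points exceed a high level. -/
theorem measure_directional_count (h4 : Integrable (fun x => ‖x‖ ^ 4) μ) {M : ℝ}
    (hM : ∀ v : EuclideanSpace ℝ (Fin d), ‖v‖ ≤ 1 → ∫ x, (inner ℝ x v : ℝ) ^ 4 ∂μ ≤ M ^ 2)
    {β B : ℝ} (hβ : 0 < β) (hB : 0 < B) (t : ℝ) :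
    (Measure.pi fun _ : Fin n => μ) {x | ∃ v : EuclideanSpace ℝ (Fin d), ‖v‖ ≤ 1 ∧
      8 * n * (16 * M ^ 2 / B ^ 2 + ∫ y, min (1280 * ‖y‖ ^ 4 / (β * B) ^ 2) 1 ∂μ) + 2 * β + 4 * t ≤
        ((Finset.univ.filter fun i => B < (inner ℝ (x i) v : ℝ) ^ 2).card : ℝ)} ≤
      ENNReal.ofReal (Real.exp (-t)) := by
  refine (measure_mono ?_).trans (measure_directional_upper (n := n) μ (tailInd_monotone B)
    (tailInd_nonneg B) (tailInd_le_one B) (G := Set.univ) (Θ := Set.univ) .univ .univ (by simp)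
    (by simp; norm_num) hβ (by simp)
    (D := 16 * M ^ 2 / B ^ 2 + ∫ y, min (1280 * ‖y‖ ^ 4 / (β * B) ^ 2) 1 ∂μ) ?_ t)
  · rintro x ⟨v, hv, hx⟩
    exact ⟨v, hv, by rwa [sum_tailInd]⟩
  · intro v hv
    simp only [Set.indicator_univ]
    set c := (√β)⁻¹ with hc
    set γ := stdGaussian (EuclideanSpace ℝ (Fin d)) with hγ
    have hc4 : c ^ 4 = 1 / β ^ 2 := by
      rw [hc, inv_pow, show (4 : ℕ) = 2 * 2 from rfl, pow_mul, Real.sq_sqrt hβ.le, one_div]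
    have hjoint : Measurable fun p : EuclideanSpace ℝ (Fin d) × EuclideanSpace ℝ (Fin d) =>
        tailInd B ((inner ℝ p.2 (v + c • p.1)) ^ 2) :=
      (tailInd_monotone B).measurable.comp (by fun_prop)
    have hji : Integrable (fun p : EuclideanSpace ℝ (Fin d) × EuclideanSpace ℝ (Fin d) =>
        tailInd B ((inner ℝ p.2 (v + c • p.1)) ^ 2)) (γ.prod μ) :=
      integrable_of_abs_le (K := 1) hjoint fun p => by
        rw [abs_of_nonneg (tailInd_nonneg _ _)]; exact tailInd_le_one _ _
    rw [integral_integral_swap (f := fun g y => tailInd B ((inner ℝ y (v + c • g)) ^ 2)) hji]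
    have hmin : Integrable (fun y : EuclideanSpace ℝ (Fin d) =>
        min (1280 * ‖y‖ ^ 4 / (β * B) ^ 2) 1) μ :=
      integrable_of_abs_le (K := 1) (by fun_prop) fun y => by
        rw [abs_of_nonneg (le_min (by positivity) zero_le_one)]; exact min_le_right _ _
    have hin := integrable_inner_pow_four h4 v
    have hin' : Integrable (fun y => 16 * (inner ℝ y v : ℝ) ^ 4 / B ^ 2) μ :=
      (hin.const_mul 16).div_const _
    calc ∫ y, ∫ g, tailInd B ((inner ℝ y (v + c • g)) ^ 2) ∂γ ∂μ
        ≤ ∫ y, (16 * (inner ℝ y v : ℝ) ^ 4 / B ^ 2 + min (1280 * ‖y‖ ^ 4 / (β * B) ^ 2) 1) ∂μ := by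
          refine integral_mono hji.integral_prod_right (hin'.add hmin) fun y => ?_
          have hg4 := integrable_pow_inner_stdGaussian y 4
          have hZ : Integrable (fun g => 16 * (c * inner ℝ y g : ℝ) ^ 4 / B ^ 2) γ := by
            simp_rw [mul_pow]
            exact ((hg4.const_mul _).const_mul _).div_const _
          have hZm : Integrable (fun g => min (16 * (c * inner ℝ y g : ℝ) ^ 4 / B ^ 2) 1) γ :=
            integrable_of_abs_le (K := 1) (by fun_prop) fun y => by
              rw [abs_of_nonneg (le_min (by positivity) zero_le_one)]; exact min_le_right _ _
          calc ∫ g, tailInd B ((inner ℝ y (v + c • g)) ^ 2) ∂γ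
              ≤ ∫ g, (16 * (inner ℝ y v : ℝ) ^ 4 / B ^ 2 +
                  min (16 * (c * inner ℝ y g : ℝ) ^ 4 / B ^ 2) 1) ∂γ := by
                refine integral_mono (integrable_of_abs_le (K := 1)
                  ((tailInd_monotone B).measurable.comp (by fun_prop)) fun p => by
                    rw [abs_of_nonneg (tailInd_nonneg _ _)]; exact tailInd_le_one _ _)
                  ((integrable_const _).add hZm) fun g => ?_
                simp only
                rw [inner_add_right, inner_smul_right]
                exact tailInd_add_sq_le hB _ _
            _ = 16 * (inner ℝ y v : ℝ) ^ 4 / B ^ 2 +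
                  ∫ g, min (16 * (c * inner ℝ y g : ℝ) ^ 4 / B ^ 2) 1 ∂γ := by
                rw [integral_add (integrable_const _) hZm]; simp
            _ ≤ _ := by
                gcongr
                refine le_min ?_ ?_
                · calc _ ≤ ∫ g, 16 * (c * inner ℝ y g : ℝ) ^ 4 / B ^ 2 ∂γ :=
                        integral_mono hZm hZ fun g => min_le_left _ _
                    _ = 16 * c ^ 4 / B ^ 2 * ∫ g, (inner ℝ y g : ℝ) ^ 4 ∂γ := by
                        rw [← integral_const_mul]
                        congr 1; ext g; ring
                    _ ≤ 16 * c ^ 4 / B ^ 2 * (80 * ‖y‖ ^ 4) := by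
                        gcongr
                        exact integral_inner_four_stdGaussian_le y
                    _ = _ := by rw [hc4]; field_simp; ring
                · calc _ ≤ ∫ _, (1 : ℝ) ∂γ :=
                        integral_mono hZm (integrable_const _) fun g => min_le_right _ _
                    _ = 1 := by simp
      _ = 16 * (∫ y, (inner ℝ y v : ℝ) ^ 4 ∂μ) / B ^ 2 +
            ∫ y, min (1280 * ‖y‖ ^ 4 / (β * B) ^ 2) 1 ∂μ := by
          rw [integral_add hin' hmin, integral_div, integral_const_mul]
      _ ≤ _ := by
          gcongr
          exact hM v hv

end DirectionalEvents

/-! ### Truncated quadratic forms. -/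

section QuadraticEvents

variable {d n : ℕ} (μ : Measure (EuclideanSpace ℝ (Fin d))) [IsProbabilityMeasure μ]

theorem integrable_inner_sq {μ : Measure (EuclideanSpace ℝ (Fin d))}
    (h2 : Integrable (fun x => ‖x‖ ^ 2) μ) (v : EuclideanSpace ℝ (Fin d)) :
    Integrable (fun x => (inner ℝ x v : ℝ) ^ 2) μ := by
  refine (h2.mul_const (‖v‖ ^ 2)).mono' (by fun_prop) (.of_forall fun x => ?_)
  rw [norm_pow, ← mul_pow]
  gcongr
  exact norm_inner_le_norm x v

/-- Smoothing by directions of controlled variance. -/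
theorem measure_directional_upper_of_variance (h2 : Integrable (fun x => ‖x‖ ^ 2) μ) {σ T m : ℝ}
    (hσ : ∀ v : EuclideanSpace ℝ (Fin d), ∫ x, (inner ℝ x v : ℝ) ^ 2 ∂μ ≤ σ * ‖v‖ ^ 2)
    (hT : ∫ x, ‖x‖ ^ 2 ∂μ = T) (hT0 : 0 < T) (hm0 : 0 < m) (hmT : T ≤ m * σ)
    {h : ℝ → ℝ} (hm : Monotone h) (h0 : ∀ y, 0 ≤ h y) (h1 : ∀ y, h y ≤ 1) {D : ℝ} (hD0 : 0 ≤ D)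
    (hD : ∀ θ : EuclideanSpace ℝ (Fin d), ∫ x, (inner ℝ x θ : ℝ) ^ 2 ∂μ ≤ 6 * σ →
      ∫ y, h ((inner ℝ y θ) ^ 2) ∂μ ≤ D) (t : ℝ) :
    (Measure.pi fun _ : Fin n => μ) {x | ∃ v : EuclideanSpace ℝ (Fin d), ‖v‖ ≤ 1 ∧
      8 * n * D + 2 * m + 4 * t ≤ ∑ i, h ((inner ℝ (x i) v) ^ 2)} ≤
      ENNReal.ofReal (Real.exp (-t)) := by
  set γ := stdGaussian (EuclideanSpace ℝ (Fin d)) with hγ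
  set q : EuclideanSpace ℝ (Fin d) → ℝ := fun θ => ∫ x, (inner ℝ x θ : ℝ) ^ 2 ∂μ with hq
  have hqm : Measurable q := by
    have : StronglyMeasurable (fun p : EuclideanSpace ℝ (Fin d) × EuclideanSpace ℝ (Fin d) =>
        (inner ℝ p.2 p.1 : ℝ) ^ 2) := Measurable.stronglyMeasurable (by fun_prop)
    exact this.integral_prod_right'.measurable
  have hq0 : ∀ θ, 0 ≤ q θ := fun θ => integral_nonneg fun x => sq_nonneg _
  have hqi : Integrable (fun p : EuclideanSpace ℝ (Fin d) × EuclideanSpace ℝ (Fin d) =>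
      (inner ℝ p.1 p.2 : ℝ) ^ 2) (μ.prod γ) := by
    refine (integrable_prod_iff (by fun_prop)).2 ⟨.of_forall fun y =>
      integrable_pow_inner_stdGaussian y 2, ?_⟩
    refine h2.congr (.of_forall fun y => ?_)
    simp only [norm_pow, Real.norm_eq_abs, sq_abs]
    exact (integral_inner_sq_stdGaussian y).symm
  have hqmean : ∫ g, q g ∂γ = T := by
    have := integral_integral_swap (f := fun y g => (inner ℝ y g : ℝ) ^ 2) hqi
    rw [← hT, show ∫ g, q g ∂γ = _ from this.symm]
    exact integral_congr_ae (.of_forall fun y => integral_inner_sq_stdGaussian y)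
  have hqint : Integrable q γ := hqi.integral_prod_right
  have hqneg : ∀ g, q (-g) = q g := fun g => by simp [hq, inner_neg_right]
  have hadd : ∀ (v g : EuclideanSpace ℝ (Fin d)) (c : ℝ), q (v + c • g) ≤ 2 * q v + 2 * c ^ 2 * q g := by
    intro v g c
    have i1 := integrable_inner_sq h2 v
    have i2 := integrable_inner_sq h2 g
    simp only [hq]
    rw [← integral_const_mul, ← integral_const_mul, ← integral_add (i1.const_mul _) (i2.const_mul _)]
    refine integral_mono (integrable_inner_sq h2 _) ((i1.const_mul _).add (i2.const_mul _)) fun x => ?_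
    simp only [inner_add_right, inner_smul_right]
    nlinarith [sq_nonneg ((inner ℝ x v : ℝ) - c * inner ℝ x g)]
  -- Under the Gaussian, `q` has mean `T`, so by Markov `q ≤ 2 T` with probability at least `1 / 2`.
  -- The smoothed direction then has variance at most `2 σ + 2 (2 T) / m ≤ 6 σ`.
  refine measure_directional_upper (n := n) μ hm h0 h1 (G := {g | q g ≤ 2 * T}) (Θ := {θ | q θ ≤ 6 * σ})
    (measurableSet_le hqm measurable_const) (measurableSet_le hqm measurable_const)
    (fun g hg => by rw [Set.mem_ofPred_eq, hqneg]; exact hg) ?_ hm0 ?_ ?_ t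
  · have hmk := mul_meas_ge_le_integral_of_nonneg (μ := γ) (f := q) (.of_forall hq0) hqint (2 * T)
    rw [hqmean] at hmk
    have h3 : γ.real {g | 2 * T ≤ q g} ≤ 1 / 2 := by
      by_contra hcon
      push Not at hcon
      nlinarith
    have h4 : γ.real {g | q g ≤ 2 * T}ᶜ ≤ γ.real {g | 2 * T ≤ q g} :=
      measureReal_mono fun g hg => by
        simp only [Set.mem_compl_iff, Set.mem_ofPred_eq, not_le] at hg
        exact hg.le
    have h5 := probReal_compl_eq_one_sub (μ := γ) (measurableSet_le hqm (measurable_const (a := 2 * T)))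
    linarith
  · intro v hv g hg
    simp only [Set.mem_ofPred_eq] at hg ⊢
    have hc2 : ((√m)⁻¹) ^ 2 = 1 / m := by rw [inv_pow, Real.sq_sqrt hm0.le, one_div]
    have := hadd v g (√m)⁻¹
    rw [hc2] at this
    have hσ0 : 0 ≤ σ := by
      by_contra hn
      push Not at hn
      nlinarith
    have hv2 : ‖v‖ ^ 2 ≤ 1 := pow_le_one₀ (norm_nonneg _) hv
    have h6 : q v ≤ σ := (hσ v).trans (by nlinarith)
    have h7 : 1 / m * q g ≤ 2 * σ := by
      rw [one_div, inv_mul_le_iff₀ hm0]; linarith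
    linarith
  · intro v hv
    calc ∫ g, ∫ y, {θ | q θ ≤ 6 * σ}.indicator (fun θ => h ((inner ℝ y θ) ^ 2)) (v + (√m)⁻¹ • g) ∂μ ∂γ
        ≤ ∫ _, D ∂γ := by
          refine integral_mono_of_nonneg (.of_forall fun g => integral_nonneg fun y =>
            Set.indicator_nonneg (fun _ _ => h0 _) _) (integrable_const _) (.of_forall fun g => ?_)
          by_cases hg : q (v + (√m)⁻¹ • g) ≤ 6 * σ
          · have : v + (√m)⁻¹ • g ∈ {θ | q θ ≤ 6 * σ} := hg
            simp only [Set.indicator_of_mem this]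
            exact hD _ hg
          · have : v + (√m)⁻¹ • g ∉ {θ | q θ ≤ 6 * σ} := hg
            simp only [Set.indicator_of_notMem this]
            simpa using hD0
      _ = D := by simp

/-- The square, truncated to `[0, s]`, normalised and squared. -/
noncomputable def truncSq (s z : ℝ) : ℝ := (max 0 (min z s) / s) ^ 2

theorem truncSq_monotone {s : ℝ} (hs : 0 < s) : Monotone (truncSq s) := fun a b hab => by
  unfold truncSq
  have : max 0 (min a s) ≤ max 0 (min b s) := max_le_max le_rfl (min_le_min hab le_rfl)
  gcongr

theorem truncSq_eq {s z : ℝ} (hs : 0 < s) (hz : 0 ≤ z) : truncSq s z = min z s ^ 2 / s ^ 2 := by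
  rw [truncSq, max_eq_right (le_min hz hs.le), div_pow]

theorem truncSq_nonneg (s z : ℝ) : 0 ≤ truncSq s z := sq_nonneg _

theorem truncSq_le_one {s : ℝ} (hs : 0 < s) (z : ℝ) : truncSq s z ≤ 1 := by
  have h1 : max 0 (min z s) ≤ s := max_le hs.le (min_le_right _ _)
  have h2 : (0 : ℝ) ≤ max 0 (min z s) := le_max_left _ _
  exact pow_le_one₀ (div_nonneg h2 hs.le) (div_le_one_of_le₀ h1 hs.le)

/-- The integrand behind the two-sided bound for truncated quadratic forms. -/
noncomputable def smoothedLoss (ε s m : ℝ) (y θ : EuclideanSpace ℝ (Fin d)) : ℝ :=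
  ε * (min ((inner ℝ y θ) ^ 2) s - min (‖y‖ ^ 2 / m) s) +
    640 / s * (2 * min ((inner ℝ y θ) ^ 2) s ^ 2 + min (‖y‖ ^ 2 / m) s ^ 2)

theorem abs_smoothedLoss_le {ε s m : ℝ} (hε : ε = 1 ∨ ε = -1) (hs : 0 < s) (hm : 0 < m)
    (y θ : EuclideanSpace ℝ (Fin d)) :
    |smoothedLoss ε s m y θ| ≤ 1281 * (min ((inner ℝ y θ) ^ 2) s + min (‖y‖ ^ 2 / m) s) := by
  unfold smoothedLoss
  have a0 : 0 ≤ min ((inner ℝ y θ : ℝ) ^ 2) s := le_min (sq_nonneg _) hs.le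
  have b0 : 0 ≤ min (‖y‖ ^ 2 / m) s := le_min (by positivity) hs.le
  have a1 : min ((inner ℝ y θ : ℝ) ^ 2) s ≤ s := min_le_right _ _
  have b1 : min (‖y‖ ^ 2 / m) s ≤ s := min_le_right _ _
  generalize min ((inner ℝ y θ : ℝ) ^ 2) s = A at *
  generalize min (‖y‖ ^ 2 / m) s = B at *
  have e1 : 640 / s * (2 * A ^ 2 + B ^ 2) ≤ 1280 * A + 640 * B := by
    rw [div_mul_eq_mul_div, div_le_iff₀ hs]; nlinarith
  have e0 : 0 ≤ 640 / s * (2 * A ^ 2 + B ^ 2) := by positivity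
  rcases hε with rfl | rfl <;> rw [abs_le] <;> constructor <;> linarith

theorem measurable_smoothedLoss (ε s m : ℝ) :
    Measurable (Function.uncurry (smoothedLoss (d := d) ε s m)) := by
  unfold smoothedLoss Function.uncurry; fun_prop

/-- These are the inputs of the PAC-Bayes bound: the averaged loss dominates the truncated form
itself, while its first two moments are controlled by untruncated quantities. Subtracting `‖y‖ ^ 2 /
m`, the variance of the noise, removes the bias of smoothing; the quadratic correction pays for the
error caused by truncation. -/
theorem integral_smoothedLoss_bounds {ε s m : ℝ} (hε : ε = 1 ∨ ε = -1) (hs : 0 < s) (hm : 0 < m)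
    (y v : EuclideanSpace ℝ (Fin d)) :
    ε * min ((inner ℝ y v) ^ 2) s ≤ ∫ g, smoothedLoss ε s m y (v + (√m)⁻¹ • g)
        ∂(stdGaussian (EuclideanSpace ℝ (Fin d))) ∧
    ∫ g, smoothedLoss ε s m y (v + (√m)⁻¹ • g) ∂(stdGaussian (EuclideanSpace ℝ (Fin d))) ≤
      ε * (inner ℝ y v) ^ 2 + 1000000 / s * ((inner ℝ y v) ^ 4 + (‖y‖ ^ 2 / m) ^ 2) ∧
    ∫ g, smoothedLoss ε s m y (v + (√m)⁻¹ • g) ^ 2 ∂(stdGaussian (EuclideanSpace ℝ (Fin d))) ≤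
      10000000000 * ((inner ℝ y v) ^ 4 + (‖y‖ ^ 2 / m) ^ 2) := by
  set γ := stdGaussian (EuclideanSpace ℝ (Fin d)) with hγ
  set c := (√m)⁻¹ with hc
  set a : ℝ := inner ℝ y v with ha
  set τ := ‖y‖ ^ 2 / m with hτ
  have hτ0 : 0 ≤ τ := by positivity
  have hin : ∀ g, inner ℝ y (v + c • g) = a + c * inner ℝ y g := fun g => by
    rw [inner_add_right, inner_smul_right]
  have hc2 : c ^ 2 = 1 / m := by rw [hc, inv_pow, Real.sq_sqrt hm.le, one_div]
  have hpow : ∀ k : ℕ, Integrable (fun g => (c * inner ℝ y g : ℝ) ^ k) γ := fun k => by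
    simp_rw [mul_pow]; exact (integrable_pow_inner_stdGaussian y k).const_mul _
  have hsec : ∫ g, (c * inner ℝ y g : ℝ) ^ 2 ∂γ = τ := by
    simp_rw [mul_pow]
    rw [integral_const_mul, integral_inner_sq_stdGaussian, hc2]; ring
  have hfour : ∫ g, (c * inner ℝ y g : ℝ) ^ 4 ∂γ ≤ 80 * τ ^ 2 := by
    simp_rw [mul_pow]
    rw [integral_const_mul, show c ^ 4 = (c ^ 2) ^ 2 by ring, hc2]
    calc (1 / m) ^ 2 * ∫ g, (inner ℝ y g : ℝ) ^ 4 ∂γ ≤ (1 / m) ^ 2 * (80 * ‖y‖ ^ 4) := by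
          gcongr; exact integral_inner_four_stdGaussian_le y
      _ = 80 * τ ^ 2 := by rw [hτ]; ring
  have key := abs_integral_min_sq_sub_le (γ := γ) (h := fun g => c * inner ℝ y g) (by fun_prop) hpow
    (by rw [integral_const_mul, integral_inner_stdGaussian, mul_zero]) hsec hfour a hs
  set φ : EuclideanSpace ℝ (Fin d) → ℝ := fun g => min ((a + c * inner ℝ y g) ^ 2) s with hφ
  have hφ0 : ∀ g, 0 ≤ φ g := fun g => le_min (sq_nonneg _) hs.le
  have hφs : ∀ g, φ g ≤ s := fun g => min_le_right _ _
  have hφm : Measurable φ := by fun_prop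
  have hφi : Integrable φ γ := integrable_of_abs_le hφm fun g => by
    rw [abs_of_nonneg (hφ0 g)]; exact hφs g
  have hφi2 : Integrable (fun g => φ g ^ 2) γ :=
    integrable_of_abs_le (K := s ^ 2) (hφm.pow_const 2) fun g => by
      rw [abs_of_nonneg (sq_nonneg _)]; exact pow_le_pow_left₀ (hφ0 g) (hφs g) 2
  have hF : ∀ g, smoothedLoss ε s m y (v + c • g) =
      ε * (φ g - min τ s) + 640 / s * (2 * φ g ^ 2 + min τ s ^ 2) := fun g => by
    rw [smoothedLoss, hin]
  have hint : ∫ g, smoothedLoss ε s m y (v + c • g) ∂γ =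
      ε * (∫ g, φ g ∂γ - min τ s) + 640 / s * (2 * ∫ g, φ g ^ 2 ∂γ + min τ s ^ 2) := by
    simp_rw [hF]
    rw [integral_add, integral_const_mul, integral_const_mul, integral_sub hφi (integrable_const _),
      integral_add (hφi2.const_mul 2) (integrable_const _), integral_const_mul]
    · simp
    · exact (hφi.sub (integrable_const _)).const_mul _
    · exact ((hφi2.const_mul 2).add (integrable_const _)).const_mul _
  -- The smoothing error involves the truncated square at `v`, whereas the loss may only contain
  -- smoothed quantities. Symmetric smoothing trades one for the other; this is the origin of the
  -- factor `2` in the correction of the loss.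
  have hsqlow : min (a ^ 2) s ^ 2 ≤ 2 * ∫ g, φ g ^ 2 ∂γ := by
    have := smoothing_lower_bound (truncSq_monotone hs) (truncSq_nonneg s) (truncSq_le_one hs)
      (G := Set.univ) .univ (by simp) y v c
    simp only [probReal_univ, Set.indicator_univ, hin] at this
    rw [truncSq_eq hs (sq_nonneg _)] at this
    simp_rw [truncSq_eq hs (sq_nonneg _)] at this
    rw [integral_div, ← ha, ← mul_div_assoc, div_le_div_iff_of_pos_right (by positivity)] at this
    linarith
  have hsqup : ∫ g, φ g ^ 2 ∂γ ≤ 8 * (a ^ 4 + 80 * τ ^ 2) := by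
    calc ∫ g, φ g ^ 2 ∂γ ≤ ∫ g, 8 * (a ^ 4 + (c * inner ℝ y g : ℝ) ^ 4) ∂γ := by
          refine integral_mono hφi2 (((integrable_const _).add (hpow 4)).const_mul _) fun g => ?_
          refine le_trans ?_ (add_pow_four_le a _)
          calc φ g ^ 2 ≤ ((a + c * inner ℝ y g) ^ 2) ^ 2 :=
                pow_le_pow_left₀ (hφ0 g) (min_le_left _ _) 2
            _ = _ := by ring
      _ = 8 * (a ^ 4 + ∫ g, (c * inner ℝ y g : ℝ) ^ 4 ∂γ) := by
          rw [integral_const_mul, integral_add (integrable_const _) (hpow 4)]; simp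
      _ ≤ _ := by gcongr
  have hA0 : 0 ≤ min (a ^ 2) s := le_min (sq_nonneg _) hs.le
  have hT0 : 0 ≤ min τ s := le_min hτ0 hs.le
  have hA2 : min (a ^ 2) s ^ 2 ≤ a ^ 4 :=
    (pow_le_pow_left₀ hA0 (min_le_left _ _) 2).trans_eq (by ring)
  have hT2 : min τ s ^ 2 ≤ τ ^ 2 := pow_le_pow_left₀ hT0 (min_le_left _ _) 2
  have hAlow : a ^ 2 - a ^ 4 / s ≤ min (a ^ 2) s := by
    refine le_min (by simp only [sub_le_self_iff]; positivity) ?_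
    rw [sub_le_iff_le_add, ← sub_le_iff_le_add', le_div_iff₀ hs]
    nlinarith [sq_nonneg (a ^ 2 - s)]
  have hk := abs_le.1 key
  have hs' : 0 < 640 / s := by positivity
  have f1 : 640 / s * min (a ^ 2) s ^ 2 ≤ 640 / s * (2 * ∫ g, φ g ^ 2 ∂γ) := by gcongr
  have f2 : 640 / s * (min (a ^ 2) s ^ 2 + min τ s ^ 2) ≤ 640 / s * (a ^ 4 + τ ^ 2) := by gcongr
  have f3 : 640 / s * (2 * ∫ g, φ g ^ 2 ∂γ + min τ s ^ 2) ≤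
      640 / s * (2 * (8 * (a ^ 4 + 80 * τ ^ 2)) + τ ^ 2) := by gcongr
  have f4 : 640 / s * (a ^ 4 + τ ^ 2) + 640 / s * (2 * (8 * (a ^ 4 + 80 * τ ^ 2)) + τ ^ 2) + a ^ 4 / s
      ≤ 1000000 / s * (a ^ 4 + τ ^ 2) := by
    rw [div_mul_eq_mul_div, div_mul_eq_mul_div, div_mul_eq_mul_div, ← add_div, ← add_div]
    refine div_le_div_of_nonneg_right ?_ hs.le
    nlinarith [sq_nonneg (a ^ 2), sq_nonneg τ]
  have f5 : 0 ≤ a ^ 4 / s := by positivity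
  refine ⟨?_, ?_, ?_⟩
  · rw [hint]
    rcases hε with rfl | rfl <;> linarith
  · rw [hint]
    have f6 : min (a ^ 2) s ≤ a ^ 2 := min_le_left _ _
    rcases hε with rfl | rfl <;> linarith
  · calc ∫ g, smoothedLoss ε s m y (v + c • g) ^ 2 ∂γ
        ≤ ∫ g, 1281 ^ 2 * 2 * (φ g ^ 2 + min τ s ^ 2) ∂γ := by
          refine integral_mono_of_nonneg (.of_forall fun g => sq_nonneg _)
            ((hφi2.add (integrable_const _)).const_mul _) (.of_forall fun g => ?_)
          have h1 := abs_smoothedLoss_le hε hs hm y (v + c • g)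
          rw [hin] at h1
          simp only
          rw [← sq_abs]
          calc |smoothedLoss ε s m y (v + c • g)| ^ 2
              ≤ (1281 * (φ g + min τ s)) ^ 2 := pow_le_pow_left₀ (abs_nonneg _) h1 2
            _ ≤ _ := by nlinarith [sq_nonneg (φ g - min τ s)]
      _ = 1281 ^ 2 * 2 * (∫ g, φ g ^ 2 ∂γ + min τ s ^ 2) := by
          rw [integral_const_mul, integral_add hφi2 (integrable_const _)]; simp
      _ ≤ 1281 ^ 2 * 2 * (8 * (a ^ 4 + 80 * τ ^ 2) + τ ^ 2) := by gcongr
      _ ≤ _ := by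
          have h1 : 0 ≤ a ^ 4 := by positivity
          have h2 := sq_nonneg τ
          linarith

theorem integrable_sq_of_four {μ : Measure (EuclideanSpace ℝ (Fin d))} [IsFiniteMeasure μ]
    (h4 : Integrable (fun x => ‖x‖ ^ 4) μ) : Integrable (fun x => ‖x‖ ^ 2) μ := by
  refine ((integrable_const (1 : ℝ)).add h4).mono' (by fun_prop) (.of_forall fun x => ?_)
  rw [Real.norm_of_nonneg (by positivity)]
  simp only [Pi.add_apply]
  nlinarith [sq_nonneg (‖x‖ ^ 2 - 1)]

theorem abs_smoothedLoss_le_const {ε s m : ℝ} (hε : ε = 1 ∨ ε = -1) (hs : 0 < s) (hm : 0 < m)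
    (y θ : EuclideanSpace ℝ (Fin d)) : |smoothedLoss ε s m y θ| ≤ 3000 * s := by
  refine (abs_smoothedLoss_le hε hs hm y θ).trans ?_
  have a1 : min ((inner ℝ y θ : ℝ) ^ 2) s ≤ s := min_le_right _ _
  have b1 : min (‖y‖ ^ 2 / m) s ≤ s := min_le_right _ _
  linarith

attribute [irreducible] smoothedLoss

theorem normalized_bound_aux {s K I1 I2 Q c : ℝ} (hs : 0 < s) (hK : 10000000 ≤ K) (hQ : 0 ≤ Q)
    (h1 : I1 ≤ c + 1000000 / s * Q) (h2 : I2 ≤ 10000000000 * Q) :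
    I1 / (3000 * s) + I2 / (3000 * s) ^ 2 ≤ (c + K / s * Q) / (3000 * s) := by
  rw [le_div_iff₀ (by positivity), add_mul, div_mul_cancel₀ _ (by positivity)]
  have e : I2 / (3000 * s) ^ 2 * (3000 * s) = I2 / 3000 / s := by field_simp
  have e1 : I2 / 3000 / s ≤ 4000000 * Q / s := by
    apply div_le_div_of_nonneg_right _ hs.le
    linarith
  have e2 : 1000000 / s * Q + 4000000 * Q / s ≤ K / s * Q := by
    rw [div_mul_eq_mul_div, div_mul_eq_mul_div, ← add_div]
    apply div_le_div_of_nonneg_right _ hs.le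
    nlinarith
  rw [e]; linarith

theorem integral_normalized_smoothedLoss_le {ε s m : ℝ} (hε : ε = 1 ∨ ε = -1) (hs : 0 < s)
    (hm : 0 < m) {K : ℝ} (hK : 10000000 ≤ K) (y v : EuclideanSpace ℝ (Fin d)) :
    ∫ g, (smoothedLoss ε s m y (v + (√m)⁻¹ • g) / (3000 * s) +
        (smoothedLoss ε s m y (v + (√m)⁻¹ • g) / (3000 * s)) ^ 2)
        ∂(stdGaussian (EuclideanSpace ℝ (Fin d))) ≤
      (ε * (inner ℝ y v) ^ 2 + K / s * ((inner ℝ y v) ^ 4 + (‖y‖ ^ 2 / m) ^ 2)) /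
        (3000 * s) := by
  obtain ⟨-, b2, b3⟩ := integral_smoothedLoss_bounds hε hs hm y v
  have hFy : Measurable fun g => smoothedLoss ε s m y (v + (√m)⁻¹ • g) := by
    have : Measurable fun g : EuclideanSpace ℝ (Fin d) => (y, v + (√m)⁻¹ • g) := by fun_prop
    exact (measurable_smoothedLoss ε s m).comp this
  have hFb : ∀ g, |smoothedLoss ε s m y (v + (√m)⁻¹ • g)| ≤ 3000 * s := fun g =>
    abs_smoothedLoss_le_const hε hs hm _ _
  set F : EuclideanSpace ℝ (Fin d) → ℝ := fun g => smoothedLoss ε s m y (v + (√m)⁻¹ • g) with hF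
  have j1 : Integrable F (stdGaussian (EuclideanSpace ℝ (Fin d))) := integrable_of_abs_le hFy hFb
  have j2 : Integrable (fun g => F g ^ 2) (stdGaussian (EuclideanSpace ℝ (Fin d))) :=
    integrable_of_abs_le (K := (3000 * s) ^ 2) (hFy.pow_const 2) fun g => by
      rw [abs_pow]; exact pow_le_pow_left₀ (abs_nonneg _) (hFb _) 2
  have e : ∀ g, F g / (3000 * s) + (F g / (3000 * s)) ^ 2 =
      F g / (3000 * s) + F g ^ 2 / (3000 * s) ^ 2 := fun g => by rw [div_pow]
  change ∫ g, (F g / (3000 * s) + (F g / (3000 * s)) ^ 2) ∂_ ≤ _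
  simp_rw [e]
  rw [integral_add (j1.div_const _) (j2.div_const _), integral_div, integral_div]
  exact normalized_bound_aux hs hK (by positivity) b2 b3

/-- Uniform deviation of truncated quadratic forms, on either side. -/
theorem measure_truncated_quadratic (h4 : Integrable (fun x => ‖x‖ ^ 4) μ) {M m s : ℝ}
    (hM : ∀ v : EuclideanSpace ℝ (Fin d), ‖v‖ ≤ 1 → ∫ x, (inner ℝ x v : ℝ) ^ 4 ∂μ ≤ M ^ 2)
    (hm : 0 < m) (hMm : ∫ x, ‖x‖ ^ 4 ∂μ ≤ M ^ 2 * m ^ 2) (hs : 0 < s) {ε : ℝ}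
    (hε : ε = 1 ∨ ε = -1) {K : ℝ} (hK : 10000000 ≤ K) (t : ℝ) :
    (Measure.pi fun _ : Fin n => μ) {x | ∃ v : EuclideanSpace ℝ (Fin d), ‖v‖ ≤ 1 ∧
      n * (ε * ∫ y, (inner ℝ y v : ℝ) ^ 2 ∂μ) + 2 * K * n * M ^ 2 / s + 3000 * s * (m / 2 + t) ≤
        ε * ∑ i, min ((inner ℝ (x i) v : ℝ) ^ 2) s} ≤ ENNReal.ofReal (Real.exp (-t)) := by
  set γ := stdGaussian (EuclideanSpace ℝ (Fin d)) with hγ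
  set c := (√m)⁻¹ with hc
  have h2 : Integrable (fun x => ‖x‖ ^ 2) μ := integrable_sq_of_four h4
  set F := smoothedLoss (d := d) ε s m with hF
  have hFb : ∀ y θ, |F y θ| ≤ 3000 * s := abs_smoothedLoss_le_const hε hs hm
  have hFm : Measurable (Function.uncurry F) := measurable_smoothedLoss ε s m
  have hfm : Measurable (Function.uncurry fun y θ => F y θ / (3000 * s)) := hFm.div_const _
  -- Division by `3000 * s` brings the loss into `[-1, 1]`. The inverse variance of the smoothing is
  -- `m`, for which `E‖x‖ ^ 4 / m ^ 2 ≤ M ^ 2` makes the noise no worse than a marginal.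
  refine (measure_mono ?_).trans (pacBayes μ n (fun y θ => F y θ / (3000 * s)) hfm
    (fun y θ => by
      rw [abs_div, abs_of_pos (show 0 < 3000 * s by positivity)]
      exact div_le_one_of_le₀ (hFb y θ) (by positivity)) hm t)
  rintro x ⟨v, hv, hx⟩
  refine ⟨v, ?_⟩
  have hsum : (ε * ∑ i, min ((inner ℝ (x i) v : ℝ) ^ 2) s) / (3000 * s) ≤
      ∑ i, ∫ g, F (x i) (v + c • g) / (3000 * s) ∂γ := by
    simp_rw [integral_div]
    rw [← Finset.sum_div, Finset.mul_sum]
    refine div_le_div_of_nonneg_right (Finset.sum_le_sum fun i _ => ?_) (by positivity)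
    exact (integral_smoothedLoss_bounds hε hs hm (x i) v).1
  have hjoint : Measurable fun p : EuclideanSpace ℝ (Fin d) × EuclideanSpace ℝ (Fin d) =>
      F p.2 (v + c • p.1) := by
    have : Measurable fun p : EuclideanSpace ℝ (Fin d) × EuclideanSpace ℝ (Fin d) =>
      (p.2, v + c • p.1) := by fun_prop
    exact hFm.comp this
  have hFy : ∀ y, Measurable fun g => F y (v + c • g) := fun y =>
    hjoint.comp (measurable_id.prodMk measurable_const)
  have hjb : ∀ p : EuclideanSpace ℝ (Fin d) × EuclideanSpace ℝ (Fin d),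
      |F p.2 (v + c • p.1) / (3000 * s) + (F p.2 (v + c • p.1) / (3000 * s)) ^ 2| ≤ 2 := fun p => by
    have h1 : |F p.2 (v + c • p.1) / (3000 * s)| ≤ 1 := by
      rw [abs_div, abs_of_pos (show 0 < 3000 * s by positivity)]
      exact div_le_one_of_le₀ (hFb _ _) (by positivity)
    have h2 := abs_le.1 h1
    rw [abs_le]; constructor <;> nlinarith
  have hji : Integrable (fun p : EuclideanSpace ℝ (Fin d) × EuclideanSpace ℝ (Fin d) =>
      F p.2 (v + c • p.1) / (3000 * s) + (F p.2 (v + c • p.1) / (3000 * s)) ^ 2) (γ.prod μ) :=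
    integrable_of_abs_le
    ((hjoint.div_const (3000 * s)).add ((hjoint.div_const (3000 * s)).pow_const 2)) hjb
  have i2 := integrable_inner_sq h2 v
  have i4 := integrable_inner_pow_four h4 v
  have h4' : Integrable (fun y => (‖y‖ ^ 2 / m) ^ 2) μ := by
    refine (h4.div_const (m ^ 2)).congr (.of_forall fun y => ?_)
    simp only; rw [div_pow]; ring
  have i5 : Integrable (fun y => (inner ℝ y v : ℝ) ^ 4 + (‖y‖ ^ 2 / m) ^ 2) μ := i4.add h4'
  have hpop : ∫ g, ∫ y, (F y (v + c • g) / (3000 * s) + (F y (v + c • g) / (3000 * s)) ^ 2) ∂μ ∂γ ≤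
      (ε * ∫ y, (inner ℝ y v : ℝ) ^ 2 ∂μ + 2 * K * M ^ 2 / s) / (3000 * s) := by
    rw [integral_integral_swap (f := fun g y =>
      F y (v + c • g) / (3000 * s) + (F y (v + c • g) / (3000 * s)) ^ 2) hji]
    calc ∫ y, ∫ g, (F y (v + c • g) / (3000 * s) + (F y (v + c • g) / (3000 * s)) ^ 2) ∂γ ∂μ
        ≤ ∫ y, (ε * (inner ℝ y v) ^ 2 + K / s * ((inner ℝ y v) ^ 4 + (‖y‖ ^ 2 / m) ^ 2)) /
            (3000 * s) ∂μ := by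
          refine integral_mono hji.integral_prod_right
            (((i2.const_mul _).add (i5.const_mul _)).div_const _) fun y => ?_
          exact integral_normalized_smoothedLoss_le hε hs hm hK y v
      _ = (ε * ∫ y, (inner ℝ y v : ℝ) ^ 2 ∂μ + K / s *
            (∫ y, (inner ℝ y v : ℝ) ^ 4 ∂μ + (∫ y, ‖y‖ ^ 4 ∂μ) / m ^ 2)) / (3000 * s) := by
          rw [integral_div, integral_add (i2.const_mul _) (i5.const_mul _),
            integral_const_mul, integral_const_mul, integral_add i4 h4', ← integral_div]
          congr 6
          ext y; rw [div_pow]; ring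
      _ ≤ _ := by
          have h5 : (∫ y, ‖y‖ ^ 4 ∂μ) / m ^ 2 ≤ M ^ 2 := by
            rw [div_le_iff₀ (by positivity)]; exact hMm
          have h6 : K / s * (∫ y, (inner ℝ y v : ℝ) ^ 4 ∂μ + (∫ y, ‖y‖ ^ 4 ∂μ) / m ^ 2) ≤
              K / s * (M ^ 2 + M ^ 2) := by
            gcongr
            exact hM v hv
          refine div_le_div_of_nonneg_right ?_ (by positivity)
          have : K / s * (M ^ 2 + M ^ 2) = 2 * K * M ^ 2 / s := by ring
          linarith
  have hn : (n : ℝ) * ∫ g, ∫ y, (F y (v + c • g) / (3000 * s) + (F y (v + c • g) / (3000 * s)) ^ 2)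
      ∂μ ∂γ ≤ n * ((ε * ∫ y, (inner ℝ y v : ℝ) ^ 2 ∂μ + 2 * K * M ^ 2 / s) / (3000 * s)) := by
    gcongr
  have h3 : m * ‖v‖ ^ 2 ≤ m := by
    have : ‖v‖ ^ 2 ≤ 1 := pow_le_one₀ (norm_nonneg _) hv
    nlinarith
  have hfin : n * ((ε * ∫ y, (inner ℝ y v : ℝ) ^ 2 ∂μ + 2 * K * M ^ 2 / s) / (3000 * s)) +
      m / 2 + t ≤ (ε * ∑ i, min ((inner ℝ (x i) v : ℝ) ^ 2) s) / (3000 * s) := by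
    rw [le_div_iff₀ (by positivity)]
    refine le_trans (le_of_eq ?_) hx
    field_simp
    ring
  linarith

end QuadraticEvents

set_option linter.unusedSectionVars false

/-! ### Covariance, operator norm and moment constants of the law. -/

section Population

variable {d : ℕ} {μ : Measure (EuclideanSpace ℝ (Fin d))} [IsProbabilityMeasure μ]

theorem integrable_norm_rpow_of_le {p q : ℝ} (hq : 0 ≤ q) (hqp : q ≤ p)
    (hp : Integrable (fun x => ‖x‖ ^ p) μ) : Integrable (fun x => ‖x‖ ^ q) μ := by
  refine ((integrable_const (1 : ℝ)).add hp).mono'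
    ((measurable_norm.pow_const q).aestronglyMeasurable) (.of_forall fun x => ?_)
  rw [Real.norm_of_nonneg (by positivity)]
  simp only [Pi.add_apply]
  rcases le_total ‖x‖ 1 with h | h
  · have h1 := Real.rpow_le_one (norm_nonneg x) h hq
    have h2 : 0 ≤ ‖x‖ ^ p := by positivity
    linarith
  · have := Real.rpow_le_rpow_of_exponent_le h hqp
    linarith

theorem integrable_norm_pow_four {p : ℝ} (hp4 : 4 ≤ p) (hp : Integrable (fun x => ‖x‖ ^ p) μ) :
    Integrable (fun x => ‖x‖ ^ 4) μ := by
  refine (integrable_norm_rpow_of_le (by norm_num) hp4 hp).congr (.of_forall fun x => ?_)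
  simp only
  rw [← Real.rpow_natCast]; norm_num

theorem integral_coord_eq_zero (h2 : Integrable (fun x => ‖x‖ ^ 2) μ) (h0 : ∫ x, x ∂μ = 0)
    (i : Fin d) : ∫ x, x i ∂μ = 0 := by
  have hid : Integrable (fun x : EuclideanSpace ℝ (Fin d) => x) μ := by
    refine ((integrable_const (1 : ℝ)).add h2).mono' (by fun_prop) (.of_forall fun x => ?_)
    simp only [Pi.add_apply]
    nlinarith [sq_nonneg (‖x‖ - 1), norm_nonneg x]
  have := (EuclideanSpace.proj (𝕜 := ℝ) i).integral_comp_comm hid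
  rw [h0, map_zero] at this
  exact this

theorem integrable_coord_mul (h2 : Integrable (fun x => ‖x‖ ^ 2) μ) (i j : Fin d) :
    Integrable (fun x : EuclideanSpace ℝ (Fin d) => x i * x j) μ := by
  refine h2.mono' (by fun_prop) (.of_forall fun x => ?_)
  rw [norm_mul, sq]
  exact mul_le_mul (PiLp.norm_apply_le x i) (PiLp.norm_apply_le x j) (norm_nonneg _) (norm_nonneg _)

theorem covMatrix_apply (h2 : Integrable (fun x => ‖x‖ ^ 2) μ) (h0 : ∫ x, x ∂μ = 0) (i j : Fin d) :
    RobustCov.covMatrix μ i j = ∫ x, x i * x j ∂μ := by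
  rw [RobustCov.covMatrix, Matrix.of_apply, covariance]
  simp [integral_coord_eq_zero h2 h0]

theorem quadForm_eq_sum (A : Matrix (Fin d) (Fin d) ℝ) (v : EuclideanSpace ℝ (Fin d)) :
    RobustCov.quadForm A v = ∑ i, ∑ j, v i * A i j * v j := by
  rw [RobustCov.quadForm, PiLp.inner_apply]
  refine Finset.sum_congr rfl fun i _ => ?_
  simp [Matrix.mulVec, dotProduct, Finset.sum_mul]
  exact Finset.sum_congr rfl fun j _ => by ring

theorem quadForm_covMatrix (h2 : Integrable (fun x => ‖x‖ ^ 2) μ) (h0 : ∫ x, x ∂μ = 0)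
    (v : EuclideanSpace ℝ (Fin d)) :
    RobustCov.quadForm (RobustCov.covMatrix μ) v = ∫ x, (inner ℝ x v : ℝ) ^ 2 ∂μ := by
  rw [quadForm_eq_sum]
  have e : ∀ x : EuclideanSpace ℝ (Fin d), (inner ℝ x v : ℝ) ^ 2 =
      ∑ i, ∑ j, v i * v j * (x i * x j) := fun x => by
    rw [PiLp.inner_apply, sq, Finset.sum_mul_sum]
    refine Finset.sum_congr rfl fun i _ => Finset.sum_congr rfl fun j _ => ?_
    simp; ring
  simp_rw [e]
  rw [integral_finsetSum _ fun i _ => integrable_finsetSum _ fun j _ =>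
    (integrable_coord_mul h2 i j).const_mul _]
  refine Finset.sum_congr rfl fun i _ => ?_
  rw [integral_finsetSum _ fun j _ => (integrable_coord_mul h2 i j).const_mul _]
  refine Finset.sum_congr rfl fun j _ => ?_
  rw [integral_const_mul, covMatrix_apply h2 h0]; ring

theorem trace_covMatrix (h2 : Integrable (fun x => ‖x‖ ^ 2) μ) (h0 : ∫ x, x ∂μ = 0) :
    (RobustCov.covMatrix μ).trace = ∫ x, ‖x‖ ^ 2 ∂μ := by
  simp_rw [EuclideanSpace.real_norm_sq_eq]
  rw [integral_finsetSum _ fun i _ => by simpa [sq] using integrable_coord_mul h2 i i, Matrix.trace]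
  refine Finset.sum_congr rfl fun i _ => ?_
  rw [Matrix.diag_apply, covMatrix_apply h2 h0]
  simp [sq]

theorem covMatrix_isHermitian : (RobustCov.covMatrix μ).IsHermitian := by
  ext i j
  simp [RobustCov.covMatrix, covariance_comm]

theorem covMatrix_posSemidef (h2 : Integrable (fun x => ‖x‖ ^ 2) μ) (h0 : ∫ x, x ∂μ = 0) :
    (RobustCov.covMatrix μ).PosSemidef := by
  refine Matrix.PosSemidef.of_dotProduct_mulVec_nonneg covMatrix_isHermitian fun v => ?_
  have := quadForm_covMatrix h2 h0 (WithLp.toLp 2 v)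
  have h3 : (0 : ℝ) ≤ ∫ x, (inner ℝ x (WithLp.toLp 2 v) : ℝ) ^ 2 ∂μ :=
    integral_nonneg fun x => sq_nonneg _
  rw [← this, quadForm_eq_sum] at h3
  refine h3.trans_eq ?_
  simp only [Matrix.mulVec, dotProduct, Finset.mul_sum, star_trivial]
  exact Finset.sum_congr rfl fun i _ => Finset.sum_congr rfl fun j _ => by ring

theorem abs_quadForm_le (A : Matrix (Fin d) (Fin d) ℝ) (v : EuclideanSpace ℝ (Fin d)) :
    |RobustCov.quadForm A v| ≤ RobustCov.opNorm A * ‖v‖ ^ 2 := by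
  refine (abs_real_inner_le_norm _ _).trans ?_
  have := (Matrix.toEuclideanCLM (n := Fin d) (𝕜 := ℝ) A).le_opNorm v
  rw [RobustCov.opNorm]
  nlinarith [norm_nonneg v]

/-- Polarisation at `x` and the multiple `y` of its image with `‖y‖ = ‖x‖`; the parallelogram law
then gives the constant exactly. -/
theorem opNorm_le_of_quadForm {A : Matrix (Fin d) (Fin d) ℝ} (hA : A.IsHermitian) {c : ℝ} (hc : 0 ≤ c)
    (h : ∀ v : EuclideanSpace ℝ (Fin d), ‖v‖ = 1 → |RobustCov.quadForm A v| ≤ c) :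
    RobustCov.opNorm A ≤ c := by
  set L := Matrix.toEuclideanCLM (n := Fin d) (𝕜 := ℝ) A with hL
  have hq : ∀ v : EuclideanSpace ℝ (Fin d), |RobustCov.quadForm A v| ≤ c * ‖v‖ ^ 2 := fun v => by
    rcases eq_or_ne v 0 with rfl | hv
    · simp [RobustCov.quadForm]
    · have hn : 0 < ‖v‖ := norm_pos_iff.2 hv
      have h1 := h ((‖v‖)⁻¹ • v) (by rw [norm_smul, norm_inv, norm_norm, inv_mul_cancel₀ hn.ne'])
      rw [RobustCov.quadForm, map_smul, inner_smul_left, inner_smul_right] at h1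
      simp only [conj_trivial] at h1
      rw [← mul_assoc, abs_mul, abs_of_nonneg (by positivity), ← sq, inv_pow,
        inv_mul_le_iff₀ (by positivity)] at h1
      rw [RobustCov.quadForm]; linarith
  have hsym : ∀ x y : EuclideanSpace ℝ (Fin d), inner ℝ (L x) y = inner ℝ x (L y) := fun x y => by
    have : A.toEuclideanLin.IsSymmetric := Matrix.isSymmetric_toEuclideanLin_iff.2 hA
    exact this x y
  refine L.opNorm_le_bound hc fun x => ?_
  rcases eq_or_ne (L x) 0 with h0 | h0
  · rw [h0, norm_zero]; positivity
  rcases eq_or_ne x 0 with rfl | hx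
  · simp
  have hxn : 0 < ‖x‖ := norm_pos_iff.2 hx
  have hLn : 0 < ‖L x‖ := norm_pos_iff.2 h0
  set y : EuclideanSpace ℝ (Fin d) := (‖x‖ / ‖L x‖) • L x with hy
  have hyn : ‖y‖ = ‖x‖ := by
    rw [hy, norm_smul, norm_div, norm_norm, norm_norm, div_mul_cancel₀ _ hLn.ne']
  have e1 : inner ℝ y (L x) = ‖x‖ * ‖L x‖ := by
    rw [hy, inner_smul_left, real_inner_self_eq_norm_sq]
    simp only [conj_trivial]
    field_simp
  have e2 : 4 * inner ℝ y (L x) = RobustCov.quadForm A (x + y) - RobustCov.quadForm A (x - y) := by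
    simp only [RobustCov.quadForm, ← hL, map_add, map_sub, inner_add_left, inner_add_right,
      inner_sub_left, inner_sub_right]
    have : inner ℝ x (L y) = inner ℝ y (L x) := by rw [← hsym, real_inner_comm]
    rw [this]; ring
  have p := parallelogram_law_with_norm ℝ x y
  have b1 := (abs_le.1 (hq (x + y))).2
  have b2 := (abs_le.1 (hq (x - y))).1
  rw [e1] at e2
  have e3 : ‖x + y‖ ^ 2 + ‖x - y‖ ^ 2 = 4 * ‖x‖ ^ 2 := by
    rw [hyn] at p; nlinarith
  have : ‖x‖ * ‖L x‖ ≤ ‖x‖ * (c * ‖x‖) := by nlinarith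
  exact le_of_mul_le_mul_left this hxn

theorem opNorm_pos {A : Matrix (Fin d) (Fin d) ℝ} (hA : A ≠ 0) : 0 < RobustCov.opNorm A := by
  rw [RobustCov.opNorm, norm_pos_iff]
  simpa using hA

/-- Directions may be replaced by bounded ones without changing the marginals. -/
theorem exists_bounded_representative (h2 : Integrable (fun x => ‖x‖ ^ 2) μ) (h0 : ∫ x, x ∂μ = 0) :
    ∃ R : ℝ, 0 ≤ R ∧ ∀ v : EuclideanSpace ℝ (Fin d), RobustCov.quadForm (RobustCov.covMatrix μ) v = 1 →
      ∃ w : EuclideanSpace ℝ (Fin d), ‖w‖ ≤ R ∧ ∀ᵐ x ∂μ, (inner ℝ x v : ℝ) = inner ℝ x w := by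
  set q := fun v => RobustCov.quadForm (RobustCov.covMatrix μ) v with hq
  have hqc : Continuous q := by
    simp only [hq, RobustCov.quadForm]; fun_prop
  have hqe : ∀ v, q v = ∫ x, (inner ℝ x v : ℝ) ^ 2 ∂μ := quadForm_covMatrix h2 h0
  -- The directions along which the law is degenerate. The variance is positive definite on the
  -- orthogonal complement, so by compactness of its unit sphere it is bounded below there.
  let N : Submodule ℝ (EuclideanSpace ℝ (Fin d)) :=
    { carrier := {v | ∀ᵐ x ∂μ, (inner ℝ x v : ℝ) = 0}
      add_mem' := fun {a b} ha hb => by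
        simp only [Set.mem_ofPred_eq] at *
        filter_upwards [ha, hb] with x h1 h2
        rw [inner_add_right, h1, h2, add_zero]
      zero_mem' := by simp
      smul_mem' := fun c a ha => by
        simp only [Set.mem_ofPred_eq] at *
        filter_upwards [ha] with x h1
        rw [inner_smul_right, h1, mul_zero] }
  have hN : ∀ v, q v = 0 → v ∈ N := fun v hv => by
    rw [hqe, integral_eq_zero_iff_of_nonneg (fun x => sq_nonneg _) (integrable_inner_sq h2 v)] at hv
    change ∀ᵐ x ∂μ, (inner ℝ x v : ℝ) = 0
    filter_upwards [hv] with x hx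
    simpa using hx
  have hrep : ∀ v, q v = 1 → ∃ w ∈ Nᗮ, q w = 1 ∧ ∀ᵐ x ∂μ, (inner ℝ x v : ℝ) = inner ℝ x w := fun v hv => by
    obtain ⟨a, ha, b, hb, hab⟩ := N.exists_add_mem_mem_orthogonal v
    have hae : ∀ᵐ x ∂μ, (inner ℝ x v : ℝ) = inner ℝ x b := by
      have ha' : ∀ᵐ x ∂μ, (inner ℝ x a : ℝ) = 0 := ha
      filter_upwards [ha'] with x hx
      rw [hab, inner_add_right, hx, zero_add]
    refine ⟨b, hb, ?_, hae⟩
    rw [← hv, hqe, hqe]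
    exact integral_congr_ae (by filter_upwards [hae] with x hx; rw [hx])
  set S : Set (EuclideanSpace ℝ (Fin d)) := Metric.sphere 0 1 ∩ (Nᗮ : Set _) with hS
  have hSc : IsCompact S := (isCompact_sphere 0 1).inter_right (Submodule.isClosed_orthogonal N)
  rcases S.eq_empty_or_nonempty with hemp | hne
  -- Here all directions are degenerate and none has unit variance.
  · refine ⟨0, le_rfl, fun v hv => ?_⟩
    obtain ⟨w, hw, hw1, -⟩ := hrep v hv
    exfalso
    have hw0 : w ≠ 0 := by rintro rfl; simp [hq, RobustCov.quadForm] at hw1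
    have : (‖w‖)⁻¹ • w ∈ S := ⟨by
      simp [norm_smul, inv_mul_cancel₀ (norm_ne_zero_iff.2 hw0)], Nᗮ.smul_mem _ hw⟩
    rw [hemp] at this; exact this
  · obtain ⟨u, hu, hmin⟩ := hSc.exists_isMinOn hne hqc.continuousOn
    have hu1 : ‖u‖ = 1 := by simpa using hu.1
    have hqu : 0 < q u := by
      refine lt_of_le_of_ne ?_ fun h => ?_
      · rw [hqe]; exact integral_nonneg fun x => sq_nonneg _
      · have h1 : u ∈ N := hN u h.symm
        have h2 : u = 0 := by
          have := Submodule.inner_right_of_mem_orthogonal h1 hu.2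
          exact inner_self_eq_zero.1 this
        simp [h2] at hu1
    refine ⟨√(1 / q u), Real.sqrt_nonneg _, fun v hv => ?_⟩
    obtain ⟨w, hw, hw1, hae⟩ := hrep v hv
    refine ⟨w, ?_, hae⟩
    have hw0 : w ≠ 0 := by rintro rfl; simp [hq, RobustCov.quadForm] at hw1
    have hn : 0 < ‖w‖ := norm_pos_iff.2 hw0
    have hmem : (‖w‖)⁻¹ • w ∈ S := ⟨by
      simp [norm_smul, inv_mul_cancel₀ hn.ne'], Nᗮ.smul_mem _ hw⟩
    have h3 : q u ≤ q ((‖w‖)⁻¹ • w) := hmin hmem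
    have h4 : q ((‖w‖)⁻¹ • w) = (‖w‖ ^ 2)⁻¹ * q w := by
      simp only [hq, RobustCov.quadForm, map_smul, inner_smul_left, inner_smul_right, conj_trivial]
      rw [← mul_assoc, ← sq, inv_pow]
    rw [h4, hw1, mul_one] at h3
    apply Real.le_sqrt_of_sq_le
    rw [le_div_iff₀ hqu]
    calc ‖w‖ ^ 2 * q u ≤ ‖w‖ ^ 2 * (‖w‖ ^ 2)⁻¹ := by gcongr
      _ = 1 := mul_inv_cancel₀ (by positivity)

theorem integrable_abs_inner_rpow {q : ℝ} (hq0 : 0 ≤ q) (hq : Integrable (fun x => ‖x‖ ^ q) μ)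
    (v : EuclideanSpace ℝ (Fin d)) : Integrable (fun x => |(inner ℝ x v : ℝ)| ^ q) μ := by
  refine (hq.mul_const (‖v‖ ^ q)).mono' ?_ (.of_forall fun x => ?_)
  · exact (Measurable.pow_const (by fun_prop) q).aestronglyMeasurable
  · rw [Real.norm_of_nonneg (by positivity), ← Real.mul_rpow (norm_nonneg _) (norm_nonneg _)]
    exact Real.rpow_le_rpow (abs_nonneg _) (abs_real_inner_le_norm _ _) hq0

/-- For singular covariance the directions of unit variance are unbounded, but bounded
representatives have the same marginals. Without boundedness the real supremum would take its
default value `0`. -/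
theorem bddAbove_kappa_set {q : ℝ} (hq0 : 0 < q) (h2 : Integrable (fun x => ‖x‖ ^ 2) μ)
    (h0 : ∫ x, x ∂μ = 0) (hq : Integrable (fun x => ‖x‖ ^ q) μ) :
    BddAbove {s : ℝ | ∃ v : EuclideanSpace ℝ (Fin d),
      RobustCov.quadForm (RobustCov.covMatrix μ) v = 1 ∧
      s = (∫ x, |inner ℝ x v| ^ q ∂μ) ^ (1 / q)} := by
  obtain ⟨R, hR, hrep⟩ := exists_bounded_representative h2 h0
  refine ⟨((∫ x, ‖x‖ ^ q ∂μ) * R ^ q) ^ (1 / q), ?_⟩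
  rintro s ⟨v, hv, rfl⟩
  obtain ⟨w, hw, hae⟩ := hrep v hv
  refine Real.rpow_le_rpow (integral_nonneg fun x => by positivity) ?_ (by positivity)
  have e : ∫ x, |inner ℝ x v| ^ q ∂μ = ∫ x, |(inner ℝ x w : ℝ)| ^ q ∂μ :=
    integral_congr_ae (by filter_upwards [hae] with x hx; rw [hx])
  rw [e, ← integral_mul_const]
  refine integral_mono (integrable_abs_inner_rpow hq0.le hq w) (hq.mul_const _) fun x => ?_
  simp only
  rw [← Real.mul_rpow (norm_nonneg _) hR]
  refine Real.rpow_le_rpow (abs_nonneg _) ((abs_real_inner_le_norm _ _).trans ?_) hq0.le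
  gcongr

/-- Normalise `v` to unit variance and use homogeneity. At zero variance the marginal vanishes
almost surely and both sides are zero. -/
theorem integral_abs_inner_rpow_le {q : ℝ} (hq0 : 0 < q) (h2 : Integrable (fun x => ‖x‖ ^ 2) μ)
    (h0 : ∫ x, x ∂μ = 0) (hq : Integrable (fun x => ‖x‖ ^ q) μ) (v : EuclideanSpace ℝ (Fin d)) :
    ∫ x, |(inner ℝ x v : ℝ)| ^ q ∂μ ≤
      RobustCov.kappa μ q ^ q * (∫ x, (inner ℝ x v : ℝ) ^ 2 ∂μ) ^ (q / 2) := by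
  set Q := ∫ x, (inner ℝ x v : ℝ) ^ 2 ∂μ with hQ
  have hQ0 : 0 ≤ Q := integral_nonneg fun x => sq_nonneg _
  rcases hQ0.eq_or_lt with hz | hpos
  · rw [← hz, Real.zero_rpow (by positivity), mul_zero]
    rw [hQ, eq_comm, integral_eq_zero_iff_of_nonneg (fun x => sq_nonneg _) (integrable_inner_sq h2 v)] at hz
    refine le_of_eq (integral_eq_zero_of_ae ?_)
    filter_upwards [hz] with x hx
    have : (inner ℝ x v : ℝ) = 0 := by simpa using hx
    simp [this, Real.zero_rpow hq0.ne']
  · have hs : 0 < √Q := Real.sqrt_pos.2 hpos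
    set w := (√Q)⁻¹ • v with hw
    have hw1 : RobustCov.quadForm (RobustCov.covMatrix μ) w = 1 := by
      rw [quadForm_covMatrix h2 h0]
      simp_rw [hw, inner_smul_right, mul_pow]
      rw [integral_const_mul, ← hQ, inv_pow, Real.sq_sqrt hQ0, inv_mul_cancel₀ hpos.ne']
    have hle : (∫ x, |inner ℝ x w| ^ q ∂μ) ^ (1 / q) ≤ RobustCov.kappa μ q :=
      le_csSup (bddAbove_kappa_set hq0 h2 h0 hq) ⟨w, hw1, rfl⟩
    have hI0 : 0 ≤ ∫ x, |(inner ℝ x w : ℝ)| ^ q ∂μ := integral_nonneg fun x => by positivity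
    have hle2 : ∫ x, |inner ℝ x w| ^ q ∂μ ≤ RobustCov.kappa μ q ^ q := by
      have := Real.rpow_le_rpow (by positivity) hle hq0.le
      rwa [← Real.rpow_mul hI0, one_div, inv_mul_cancel₀ hq0.ne', Real.rpow_one] at this
    have e : ∀ x : EuclideanSpace ℝ (Fin d), |(inner ℝ x v : ℝ)| ^ q =
        Q ^ (q / 2) * |(inner ℝ x w : ℝ)| ^ q := fun x => by
      rw [hw, inner_smul_right, abs_mul, abs_of_pos (inv_pos.2 hs),
        Real.mul_rpow (by positivity) (abs_nonneg _), ← mul_assoc]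
      have : Q ^ (q / 2) * (√Q)⁻¹ ^ q = 1 := by
        rw [Real.inv_rpow hs.le, Real.sqrt_eq_rpow, ← Real.rpow_mul hQ0,
          show 1 / 2 * q = q / 2 by ring, mul_inv_cancel₀ (by positivity)]
      rw [this, one_mul]
    simp_rw [e]
    rw [integral_const_mul, mul_comm]
    gcongr

/-- Bernoulli's inequality `(1 + z) ^ (q / 2) ≥ 1 + q z / 2` at `z = ⟨x, w⟩ ^ 2 - 1`, which has mean
zero in a direction of unit variance. -/
theorem one_le_kappa {q : ℝ} (hq2 : 2 ≤ q) (h2 : Integrable (fun x => ‖x‖ ^ 2) μ)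
    (h0 : ∫ x, x ∂μ = 0) (hq : Integrable (fun x => ‖x‖ ^ q) μ)
    (hex : ∃ v : EuclideanSpace ℝ (Fin d), 0 < ∫ x, (inner ℝ x v : ℝ) ^ 2 ∂μ) :
    1 ≤ RobustCov.kappa μ q := by
  obtain ⟨v, hv⟩ := hex
  set Q := ∫ x, (inner ℝ x v : ℝ) ^ 2 ∂μ with hQ
  have hs : 0 < √Q := Real.sqrt_pos.2 hv
  set w := (√Q)⁻¹ • v with hw
  have hw1 : ∫ x, (inner ℝ x w : ℝ) ^ 2 ∂μ = 1 := by
    simp_rw [hw, inner_smul_right, mul_pow]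
    rw [integral_const_mul, ← hQ, inv_pow, Real.sq_sqrt hv.le, inv_mul_cancel₀ hv.ne']
  have hle : (∫ x, |inner ℝ x w| ^ q ∂μ) ^ (1 / q) ≤ RobustCov.kappa μ q :=
    le_csSup (bddAbove_kappa_set (by linarith) h2 h0 hq) ⟨w, by rw [quadForm_covMatrix h2 h0, hw1], rfl⟩
  refine le_trans ?_ hle
  apply Real.one_le_rpow _ (by positivity)
  have i2 := integrable_inner_sq h2 w
  calc (1 : ℝ) = ∫ x, (1 + q / 2 * ((inner ℝ x w : ℝ) ^ 2 - 1)) ∂μ := by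
        have i3 : Integrable (fun x => (inner ℝ x w : ℝ) ^ 2 - 1) μ := i2.sub (integrable_const _)
        rw [integral_add (integrable_const _) (i3.const_mul _), integral_const_mul,
          integral_sub i2 (integrable_const _), hw1]
        simp
    _ ≤ _ := by
        refine integral_mono ((integrable_const _).add ((i2.sub (integrable_const _)).const_mul _))
          (integrable_abs_inner_rpow (by linarith) hq w) fun x => ?_
        have := one_add_mul_self_le_rpow_one_add (s := (inner ℝ x w : ℝ) ^ 2 - 1)
          (by nlinarith [sq_nonneg (inner ℝ x w : ℝ)]) (show 1 ≤ q / 2 by linarith)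
        refine this.trans (le_of_eq ?_)
        rw [add_sub_cancel, ← sq_abs, ← Real.rpow_natCast, ← Real.rpow_mul (abs_nonneg _)]
        congr 1; push_cast; ring

theorem integral_inner_four_le (h4 : Integrable (fun x => ‖x‖ ^ 4) μ) (h0 : ∫ x, x ∂μ = 0)
    (v : EuclideanSpace ℝ (Fin d)) :
    ∫ x, (inner ℝ x v : ℝ) ^ 4 ∂μ ≤
      RobustCov.kappa μ 4 ^ 4 * (∫ x, (inner ℝ x v : ℝ) ^ 2 ∂μ) ^ 2 := by
  have h4' : Integrable (fun x => ‖x‖ ^ (4 : ℝ)) μ := by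
    refine h4.congr (.of_forall fun x => ?_)
    simp only; rw [← Real.rpow_natCast]; norm_num
  have := integral_abs_inner_rpow_le (by norm_num) (integrable_sq_of_four h4) h0 h4' v
  rw [show (4 : ℝ) / 2 = ((2 : ℕ) : ℝ) by norm_num, Real.rpow_natCast] at this
  have e : ∀ y : ℝ, y ^ (4 : ℝ) = y ^ 4 := fun y => by
    rw [show (4 : ℝ) = ((4 : ℕ) : ℝ) by norm_num, Real.rpow_natCast]
  rw [e] at this
  refine le_trans (le_of_eq ?_) this
  congr 1; ext x; rw [e, show |(inner ℝ x v : ℝ)| ^ 4 = (inner ℝ x v : ℝ) ^ 4 from by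
    rw [show 4 = 2 * 2 from rfl, pow_mul, sq_abs, ← pow_mul]]

/-- Expand `‖x‖ ^ 4` in coordinates. Each mixed moment is at most `κ_4 ^ 4` times the product of the
two variances, by the arithmetic-geometric inequality with weights that equalise the two
coordinates; then resum. -/
theorem integral_norm_four_le (h4 : Integrable (fun x => ‖x‖ ^ 4) μ) (h0 : ∫ x, x ∂μ = 0) :
    ∫ x, ‖x‖ ^ 4 ∂μ ≤ RobustCov.kappa μ 4 ^ 4 * (∫ x, ‖x‖ ^ 2 ∂μ) ^ 2 := by
  have h2 := integrable_sq_of_four h4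
  set S : Fin d → ℝ := fun i => ∫ x : EuclideanSpace ℝ (Fin d), x i ^ 2 ∂μ with hS
  have hS0 : ∀ i, 0 ≤ S i := fun i => integral_nonneg fun x => sq_nonneg _
  have hco : ∀ (x : EuclideanSpace ℝ (Fin d)) (i : Fin d),
      (inner ℝ x (EuclideanSpace.single i (1 : ℝ)) : ℝ) = x i := fun x i => by
    simp [EuclideanSpace.inner_single_right]
  have hc4 : ∀ i, ∫ x : EuclideanSpace ℝ (Fin d), x i ^ 4 ∂μ ≤ RobustCov.kappa μ 4 ^ 4 * S i ^ 2 := fun i => by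
    have := integral_inner_four_le h4 h0 (EuclideanSpace.single i (1 : ℝ))
    simpa only [hco] using this
  have i4 : ∀ i, Integrable (fun x : EuclideanSpace ℝ (Fin d) => x i ^ 4) μ := fun i => by
    have := integrable_inner_pow_four h4 (EuclideanSpace.single i (1 : ℝ))
    simpa only [hco] using this
  have i22 : ∀ i j, Integrable (fun x : EuclideanSpace ℝ (Fin d) => x i ^ 2 * x j ^ 2) μ := fun i j => by
    refine ((i4 i).add (i4 j)).mono' (by fun_prop) (.of_forall fun x => ?_)
    rw [Real.norm_of_nonneg (by positivity)]
    simp only [Pi.add_apply]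
    nlinarith [sq_nonneg (x i ^ 2 - x j ^ 2), sq_nonneg (x i ^ 2), sq_nonneg (x j ^ 2)]
  set K := RobustCov.kappa μ 4 ^ 4 with hK
  have hmix : ∀ i j, ∫ x : EuclideanSpace ℝ (Fin d), x i ^ 2 * x j ^ 2 ∂μ ≤ K * (S i * S j) := fun i j => by
    have hzero : ∀ i j, S i = 0 → ∫ x : EuclideanSpace ℝ (Fin d), x i ^ 2 * x j ^ 2 ∂μ = 0 := by
      intro i j hi
      rw [hS, integral_eq_zero_iff_of_nonneg (fun x => sq_nonneg _)
        (by simpa only [hco] using integrable_inner_sq h2 (EuclideanSpace.single i (1 : ℝ)))] at hi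
      refine integral_eq_zero_of_ae ?_
      filter_upwards [hi] with x hx
      have : x i = 0 := by simpa using hx
      simp [this]
    rcases (hS0 i).eq_or_lt with hi | hi
    · rw [hzero i j hi.symm, ← hi]; simp
    rcases (hS0 j).eq_or_lt with hj | hj
    · have e : ∫ x : EuclideanSpace ℝ (Fin d), x i ^ 2 * x j ^ 2 ∂μ =
          ∫ x : EuclideanSpace ℝ (Fin d), x j ^ 2 * x i ^ 2 ∂μ := by
        congr 1; ext x; ring
      rw [e, hzero j i hj.symm, ← hj]; simp
    · calc ∫ x : EuclideanSpace ℝ (Fin d), x i ^ 2 * x j ^ 2 ∂μ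
          ≤ ∫ x : EuclideanSpace ℝ (Fin d), (S j / (2 * S i) * x i ^ 4 + S i / (2 * S j) * x j ^ 4) ∂μ := by
            refine integral_mono (i22 i j) (((i4 i).const_mul _).add ((i4 j).const_mul _)) fun x => ?_
            simp only
            rw [div_mul_eq_mul_div, div_mul_eq_mul_div, div_add_div _ _ (by positivity) (by positivity),
              le_div_iff₀ (by positivity)]
            nlinarith [sq_nonneg (S j * x i ^ 2 - S i * x j ^ 2)]
        _ = S j / (2 * S i) * ∫ x : EuclideanSpace ℝ (Fin d), x i ^ 4 ∂μ +
              S i / (2 * S j) * ∫ x : EuclideanSpace ℝ (Fin d), x j ^ 4 ∂μ := by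
            rw [integral_add ((i4 i).const_mul _) ((i4 j).const_mul _), integral_const_mul,
              integral_const_mul]
        _ ≤ S j / (2 * S i) * (K * S i ^ 2) + S i / (2 * S j) * (K * S j ^ 2) := by
            gcongr
            · exact hc4 i
            · exact hc4 j
        _ = K * (S i * S j) := by field_simp; ring
  have e4 : ∀ x : EuclideanSpace ℝ (Fin d), ‖x‖ ^ 4 = ∑ i, ∑ j, x i ^ 2 * x j ^ 2 := fun x => by
    rw [show 4 = 2 * 2 from rfl, pow_mul, EuclideanSpace.real_norm_sq_eq, sq, Finset.sum_mul_sum]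
  have e2 : ∫ x, ‖x‖ ^ 2 ∂μ = ∑ i, S i := by
    simp_rw [EuclideanSpace.real_norm_sq_eq]
    rw [integral_finsetSum]
    intro i _
    simpa only [hco] using integrable_inner_sq h2 (EuclideanSpace.single i (1 : ℝ))
  simp_rw [e4]
  rw [e2, sq, Finset.sum_mul_sum, Finset.mul_sum,
    integral_finsetSum _ fun i _ => integrable_finsetSum _ fun j _ => i22 i j]
  refine Finset.sum_le_sum fun i _ => ?_
  rw [integral_finsetSum _ fun j _ => i22 i j, Finset.mul_sum]
  exact Finset.sum_le_sum fun j _ => hmix i j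

end Population

/-! ### Two telescoping estimates for sums of powers. -/

section Sums

theorem sqrt_succ_sub_sqrt {l : ℕ} (hl : 1 ≤ l) :
    √((l + 1 : ℕ) : ℝ) ≤ 3 / 2 * √(l : ℝ) ∧ 1 ≤ 5 / 2 * √(l : ℝ) * (√((l + 1 : ℕ) : ℝ) - √(l : ℝ)) := by
  have hl1 : (1 : ℝ) ≤ l := by exact_mod_cast hl
  have h1 : 0 < √(l : ℝ) := Real.sqrt_pos.2 (by linarith)
  have h2 : √(l : ℝ) ^ 2 = l := Real.sq_sqrt (by linarith)
  have h3 : 0 < √((l + 1 : ℕ) : ℝ) := Real.sqrt_pos.2 (by positivity)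
  have h4 : √((l + 1 : ℕ) : ℝ) ^ 2 = l + 1 := by
    rw [Real.sq_sqrt (by positivity)]; push_cast; ring
  set a := √(l : ℝ)
  set b := √((l + 1 : ℕ) : ℝ)
  have h5 : b ≤ 3 / 2 * a := abs_le_of_sq_le_sq' (by nlinarith) (by positivity) |>.2
  have h6 : a ≤ b := abs_le_of_sq_le_sq' (by nlinarith) h3.le |>.2
  exact ⟨h5, by nlinarith⟩

theorem sum_Ico_inv_sqrt_le (k l : ℕ) (hk : 1 ≤ k) (hkl : k ≤ l) :
    ∑ j ∈ Finset.Ico k l, 1 / √(j : ℝ) ≤ 4 * √(l : ℝ) := by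
  induction l, hkl using Nat.le_induction with
  | base => simp
  | succ l hkl ih =>
    rw [Finset.sum_Ico_succ_top hkl]
    have hl1 : 1 ≤ l := hk.trans hkl
    have hl : (0 : ℝ) < √(l : ℝ) := Real.sqrt_pos.2 (by exact_mod_cast hl1)
    have h := (sqrt_succ_sub_sqrt hl1).2
    have h1 : 1 / √(l : ℝ) ≤ 4 * √((l + 1 : ℕ) : ℝ) - 4 * √(l : ℝ) := by
      rw [div_le_iff₀ hl]; linarith
    linarith

theorem sum_Ico_inv_mul_sqrt_le (k l : ℕ) (hk : 1 ≤ k) (hkl : k ≤ l) :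
    ∑ j ∈ Finset.Ico k l, 1 / ((j : ℝ) * √(j : ℝ)) ≤ 4 / √(k : ℝ) - 4 / √(l : ℝ) := by
  induction l, hkl using Nat.le_induction with
  | base => simp
  | succ l hkl ih =>
    rw [Finset.sum_Ico_succ_top hkl]
    have hl1 : 1 ≤ l := hk.trans hkl
    have hl : (0 : ℝ) < √(l : ℝ) := Real.sqrt_pos.2 (by exact_mod_cast hl1)
    have hl' : (0 : ℝ) < √((l + 1 : ℕ) : ℝ) := Real.sqrt_pos.2 (by positivity)
    obtain ⟨h2, h3⟩ := sqrt_succ_sub_sqrt hl1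
    have h4 : √(l : ℝ) ^ 2 = l := Real.sq_sqrt (Nat.cast_nonneg l)
    have h1 : 1 / ((l : ℝ) * √(l : ℝ)) ≤ 4 / √(l : ℝ) - 4 / √((l + 1 : ℕ) : ℝ) := by
      rw [div_sub_div _ _ hl.ne' hl'.ne', div_le_div_iff₀ (by positivity) (by positivity)]
      set a := √(l : ℝ)
      set b := √((l + 1 : ℕ) : ℝ)
      rw [← h4]
      have h5 : 3 / 2 * a ≤ 4 * a ^ 2 * (b - a) := by nlinarith
      nlinarith [mul_nonneg hl.le (sub_nonneg.2 (h2.trans h5))]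
    linarith

end Sums

/-! ### The data-driven trimming level. -/

noncomputable section

variable {d n : ℕ}

/-- The squared coordinates of a sample in the direction `v`. -/
def dirSq (y : Fin n → EuclideanSpace ℝ (Fin d)) (v : EuclideanSpace ℝ (Fin d)) (i : Fin n) : ℝ :=
  (inner ℝ (y i) v) ^ 2

/-- The size of the norms of a sample, after the removal of the `j` largest. -/
def normScale (j : ℕ) (y : Fin n → EuclideanSpace ℝ (Fin d)) : ℝ :=
  √(trimmedSum j fun i => ‖y i‖ ^ 4)

/-- The level above which directional outliers are attributed to the signal. -/
def stopThreshold (j k : ℕ) (y : Fin n → EuclideanSpace ℝ (Fin d)) : ℝ :=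
  -- One more than `1200 * 23`: the norm part of `envelope`, with `W ≤ 23 * normScale j y`, must
  -- stay strictly below the threshold.
  27601 * normScale j y / (k * √(k : ℝ))

/-- At level `k`, directional outliers exceed what the norms of the sample explain. -/
def StopsAt (j k : ℕ) (y : Fin n → EuclideanSpace ℝ (Fin d)) : Prop :=
  ∃ v : EuclideanSpace ℝ (Fin d), ‖v‖ = 1 ∧
    k < (Finset.univ.filter fun i => stopThreshold j k y < dirSq y v i).card

open Classical in
/-- The data-driven trimming level. -/
def stopLevel (j : ℕ) (y : Fin n → EuclideanSpace ℝ (Fin d)) : ℕ :=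
  Nat.find (p := fun k => 128 * j ≤ k ∧ (n ≤ k ∨ StopsAt j k y)) ⟨max (128 * j) n, by simp⟩

theorem stopLevel_spec (j : ℕ) (y : Fin n → EuclideanSpace ℝ (Fin d)) :
    128 * j ≤ stopLevel j y ∧ (n ≤ stopLevel j y ∨ StopsAt j (stopLevel j y) y) := by
  classical
  exact Nat.find_spec (p := fun k => 128 * j ≤ k ∧ (n ≤ k ∨ StopsAt j k y)) ⟨max (128 * j) n, by simp⟩

theorem not_stopsAt_of_lt {j k : ℕ} {y : Fin n → EuclideanSpace ℝ (Fin d)} (hk : 128 * j ≤ k)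
    (h : k < stopLevel j y) : ¬ StopsAt j k y := fun hs => by
  classical
  exact Nat.find_min (p := fun k => 128 * j ≤ k ∧ (n ≤ k ∨ StopsAt j k y)) ⟨max (128 * j) n, by simp⟩ h
    ⟨hk, Or.inr hs⟩

theorem dirSq_nonneg (y : Fin n → EuclideanSpace ℝ (Fin d)) (v : EuclideanSpace ℝ (Fin d)) (i : Fin n) :
    0 ≤ dirSq y v i := sq_nonneg _

theorem normScale_nonneg (j : ℕ) (y : Fin n → EuclideanSpace ℝ (Fin d)) : 0 ≤ normScale j y :=
  Real.sqrt_nonneg _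

theorem stopThreshold_nonneg (j k : ℕ) (y : Fin n → EuclideanSpace ℝ (Fin d)) :
    0 ≤ stopThreshold j k y := by
  have := normScale_nonneg j y
  unfold stopThreshold; positivity

/-- At every level passed over, at most that many points exceed the threshold, so one further
removal gains at most the threshold. The thresholds decay like `i ^ (-3/2)`, hence sum to their
scale over `√k`. -/
theorem trimmedSum_le_stopLevel_add {j k : ℕ} {y : Fin n → EuclideanSpace ℝ (Fin d)} (hk : 128 * j ≤ k)
    (hk1 : 1 ≤ k) (h : k ≤ stopLevel j y) {v : EuclideanSpace ℝ (Fin d)} (hv : ‖v‖ = 1) :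
    trimmedSum k (dirSq y v) ≤
      trimmedSum (stopLevel j y) (dirSq y v) + 110404 * normScale j y / √(k : ℝ) := by
  have h1 := trimmedSum_le_add_sum (a := dirSq y v) h (s := fun i => stopThreshold j i y)
    (fun i => stopThreshold_nonneg j i y) fun i hi hil => by
      have := not_stopsAt_of_lt (hk.trans hi) hil
      unfold StopsAt at this
      push Not at this
      exact this v hv
  refine h1.trans (add_le_add le_rfl ?_)
  have h2 := sum_Ico_inv_mul_sqrt_le k _ hk1 h
  have h3 : ∑ i ∈ Finset.Ico k (stopLevel j y), stopThreshold j i y =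
      27601 * normScale j y * ∑ i ∈ Finset.Ico k (stopLevel j y), 1 / ((i : ℝ) * √(i : ℝ)) := by
    rw [Finset.mul_sum]
    exact Finset.sum_congr rfl fun i _ => by rw [stopThreshold]; ring
  rw [h3]
  have h4 : 0 ≤ 4 / √(stopLevel j y : ℝ) := by positivity
  have h5 := normScale_nonneg j y
  calc 27601 * normScale j y * ∑ i ∈ Finset.Ico k (stopLevel j y), 1 / ((i : ℝ) * √(i : ℝ))
      ≤ 27601 * normScale j y * (4 / √(k : ℝ)) := by gcongr; linarith
    _ = _ := by ring

/-- The level that few points of the sample exceed in any direction. -/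
def envelope (n : ℕ) (M W : ℝ) (k : ℕ) : ℝ := 32 * M * √(n / k : ℝ) + 1200 * W / (k * √(k : ℝ))

/-- If the level stops early at `l`, the direction responsible has more than `l` points above the
threshold but at most `l` above the envelope. So the threshold lies below the envelope, which forces
`W` to be at most of order `√n * M * l`. From `l` on, the envelope is thus of order `M √(n / i)`,
and summing to `k` gives `M √(n k)`. If the level stops because it reached `n`, everything can be
removed and the trimmed sum is at most zero. -/
theorem trimmedSum_stopLevel_le_add {j k : ℕ} {y : Fin n → EuclideanSpace ℝ (Fin d)} {M W : ℝ}
    (hM : 0 ≤ M) (hW : 0 ≤ W) (hj : 1 ≤ j)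
    (hWq : W ≤ √n * M * (128 * j : ℕ) ∨ W ≤ 23 * normScale j y)
    (h : stopLevel j y ≤ k)
    (hcount : ∀ i, 128 * j ≤ i → i < k → ∀ v : EuclideanSpace ℝ (Fin d), ‖v‖ = 1 →
      (Finset.univ.filter fun l => envelope n M W i < dirSq y v l).card ≤ i)
    {v : EuclideanSpace ℝ (Fin d)} (hv : ‖v‖ = 1) :
    trimmedSum (stopLevel j y) (dirSq y v) ≤ trimmedSum k (dirSq y v) + 3600000 * M * √(n * k : ℝ) := by
  have hpos : 0 ≤ 3600000 * M * √(n * k : ℝ) := by positivity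
  obtain ⟨hs1, hs2⟩ := stopLevel_spec j y
  set l := stopLevel j y with hl
  have hl1 : 1 ≤ l := by omega
  have hl0 : (0 : ℝ) < l := by exact_mod_cast hl1
  rcases hs2 with hn | hst
  · have h1 : trimmedSum l (dirSq y v) ≤ 0 := by
      refine (trimmedSum_le (J := Finset.univ) (by simpa using hn)).trans ?_
      simp
    have h2 := trimmedSum_nonneg k (dirSq_nonneg y v)
    linarith
  · rcases h.eq_or_lt with heq | hlt
    · rw [← heq] at hpos ⊢; linarith
    obtain ⟨u, hu, hcu⟩ := hst
    have hsq : 0 < √(l : ℝ) := Real.sqrt_pos.2 hl0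
    have hsq2 : √(l : ℝ) ^ 2 = l := Real.sq_sqrt hl0.le
    have hq0 := normScale_nonneg j y
    have hWl : W ≤ 736 * (√n * M * l) := by
      have hnM : 0 ≤ √(n : ℝ) * M := by positivity
      have hcast : ((128 * j : ℕ) : ℝ) ≤ l := by exact_mod_cast hs1
      rcases hWq with hWq | hWq
      · have : √(n : ℝ) * M * (128 * j : ℕ) ≤ √n * M * l := by gcongr
        nlinarith [mul_nonneg hnM hl0.le]
      · have hthr : stopThreshold j l y < envelope n M W l := by
          by_contra hcon
          push Not at hcon
          have := hcount l hs1 hlt u hu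
          have h3 : (Finset.univ.filter fun i => stopThreshold j l y < dirSq y u i).card ≤
              (Finset.univ.filter fun i => envelope n M W l < dirSq y u i).card :=
            Finset.card_le_card fun i hi => by
              simp only [Finset.mem_filter, Finset.mem_univ, true_and] at hi ⊢
              exact hcon.trans_lt hi
          omega
        -- After multiplication by `l ^ (3/2)` and use of `W ≤ 23 * normScale j y`, exactly one copy
        -- of `normScale j y` survives on the left, so it is below `32 √n M l`; and `23 * 32 = 736`.
        rw [stopThreshold, envelope, Real.sqrt_div (Nat.cast_nonneg n), div_lt_iff₀ (by positivity),
          add_mul, div_mul_cancel₀ _ (by positivity)] at hthr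
        have e : 32 * M * (√(n : ℝ) / √(l : ℝ)) * (l * √(l : ℝ)) = 32 * (√n * M * l) := by
          field_simp
        rw [e] at hthr
        linarith
    have henv : ∀ i, l ≤ i → envelope n M W i ≤ 900000 * M * √n * (1 / √(i : ℝ)) := fun i hi => by
      have hi0 : (0 : ℝ) < i := by exact_mod_cast (by omega : 0 < i)
      have hisq : 0 < √(i : ℝ) := Real.sqrt_pos.2 hi0
      have hli : (l : ℝ) ≤ i := by exact_mod_cast hi
      have h5 : W ≤ 736 * (√n * M * i) := hWl.trans (by gcongr)
      have h6 : 1200 * W / (i * √(i : ℝ)) ≤ 883200 * M * √n * (1 / √(i : ℝ)) := by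
        rw [div_le_iff₀ (by positivity)]
        have : 883200 * M * √n * (1 / √(i : ℝ)) * (i * √(i : ℝ)) = 883200 * (√n * M * i) := by
          field_simp
        linarith
      rw [envelope, Real.sqrt_div (Nat.cast_nonneg n)]
      have h7 : 32 * M * (√(n : ℝ) / √(i : ℝ)) = 32 * (M * √n * (1 / √(i : ℝ))) := by ring
      have h8 : 0 ≤ M * √n * (1 / √(i : ℝ)) := by positivity
      linarith
    have hsum := trimmedSum_le_add_sum (a := dirSq y v) h
      (s := fun i => 900000 * M * √n * (1 / √(i : ℝ))) (fun i => by positivity) fun i hi hik => by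
        refine le_trans (Finset.card_le_card fun m hm => ?_) (hcount i (hs1.trans hi) hik v hv)
        simp only [Finset.mem_filter, Finset.mem_univ, true_and] at hm ⊢
        exact (henv i hi).trans_lt hm
    refine hsum.trans (add_le_add le_rfl ?_)
    rw [← Finset.mul_sum]
    have h9 := sum_Ico_inv_sqrt_le l k hl1 h
    calc 900000 * M * √n * ∑ i ∈ Finset.Ico l k, 1 / √(i : ℝ)
        ≤ 900000 * M * √n * (4 * √(k : ℝ)) := by gcongr
      _ = _ := by rw [Real.sqrt_mul (Nat.cast_nonneg n)]; ring

/-! ### Deterministic effect of the contamination. -/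

section Contamination

theorem abs_sum_sub_sum_le {x y : Fin n → EuclideanSpace ℝ (Fin d)} {N : ℝ}
    (hN : (({i | y i ≠ x i} : Set (Fin n)).ncard : ℝ) ≤ N) {h : EuclideanSpace ℝ (Fin d) → ℝ} {c : ℝ}
    (hc : 0 ≤ c) (h0 : ∀ z, 0 ≤ h z) (h1 : ∀ z, h z ≤ c) :
    |∑ i, h (y i) - ∑ i, h (x i)| ≤ c * N := by
  classical
  rw [← Finset.sum_sub_distrib]
  refine (Finset.abs_sum_le_sum_abs _ _).trans ?_
  have e : ∀ i, |h (y i) - h (x i)| ≤ if y i ≠ x i then c else 0 := fun i => by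
    split_ifs with hi
    · rw [abs_le]; constructor <;> linarith [h0 (y i), h0 (x i), h1 (y i), h1 (x i)]
    · push Not at hi; simp [hi]
  refine (Finset.sum_le_sum fun i _ => e i).trans ?_
  rw [← Finset.sum_filter, Finset.sum_const, nsmul_eq_mul, mul_comm]
  have : ({i | y i ≠ x i} : Set (Fin n)).ncard = (Finset.univ.filter fun i => y i ≠ x i).card := by
    rw [Set.ncard_eq_toFinset_card']; simp
  rw [this] at hN
  gcongr

theorem card_filter_le_add {x y : Fin n → EuclideanSpace ℝ (Fin d)} {N : ℝ}
    (hN : (({i | y i ≠ x i} : Set (Fin n)).ncard : ℝ) ≤ N) (v : EuclideanSpace ℝ (Fin d)) (b : ℝ) :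
    ((Finset.univ.filter fun i => b < dirSq y v i).card : ℝ) ≤
      ((Finset.univ.filter fun i => b < dirSq x v i).card : ℝ) + N := by
  have := abs_sum_sub_sum_le hN zero_le_one (h := fun z => tailInd b ((inner ℝ z v) ^ 2))
    (fun z => tailInd_nonneg _ _) (fun z => tailInd_le_one _ _)
  have e : ∀ z : Fin n → EuclideanSpace ℝ (Fin d), ∑ i, tailInd b ((inner ℝ (z i) v) ^ 2) =
    ((Finset.univ.filter fun i => b < dirSq z v i).card : ℝ) := fun z => sum_tailInd b (dirSq z v)
  rw [e, e] at this
  have h2 := (abs_le.1 this).2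
  linarith

theorem normScale_le {x y : Fin n → EuclideanSpace ℝ (Fin d)} {N R : ℝ} {j : ℕ}
    (hN : (({i | y i ≠ x i} : Set (Fin n)).ncard : ℝ) ≤ N) (hR : 0 < R) (hNj : 2 * N ≤ j)
    (h : ∑ i, min (‖x i‖ ^ 4 / R) 1 ≤ j / 2) : normScale j y ≤ √(R * j) := by
  have h1 := (abs_le.1 (abs_sum_sub_sum_le hN zero_le_one (h := fun z => min (‖z‖ ^ 4 / R) 1)
    (fun z => le_min (by positivity) zero_le_one) (fun z => min_le_right _ _))).2
  have h2 : ∑ i, min (‖y i‖ ^ 4 / R) 1 ≤ j := by linarith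
  refine Real.sqrt_le_sqrt ((trimmedSum_le_sum_min (fun i => by positivity) hR.le (b := R) ?_).trans ?_)
  · have : ((Finset.univ.filter fun i => R < ‖y i‖ ^ 4).card : ℝ) ≤ j := by
      refine le_trans ?_ h2
      rw [← sum_tailInd]
      refine Finset.sum_le_sum fun i _ => ?_
      unfold tailInd
      split_ifs with hi
      · exact le_min ((one_le_div hR).2 hi.le) le_rfl
      · exact le_min (by positivity) zero_le_one
    exact_mod_cast this
  · calc ∑ i, min (‖y i‖ ^ 4) R = R * ∑ i, min (‖y i‖ ^ 4 / R) 1 := by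
          rw [Finset.mul_sum]
          refine Finset.sum_congr rfl fun i _ => ?_
          rw [mul_min_of_nonneg _ _ hR.le, mul_div_cancel₀ _ hR.ne', mul_one]
      _ ≤ R * j := by gcongr

/-- Corruption removes at most `N` and trimming at most `j` from the sum truncated at `1`, so at
least `c` terms' worth of size `w` remains. -/
theorem le_normScale {x y : Fin n → EuclideanSpace ℝ (Fin d)} {N w c : ℝ} {j : ℕ}
    (hN : (({i | y i ≠ x i} : Set (Fin n)).ncard : ℝ) ≤ N) (hw : 0 < w)
    (h : c + N + j ≤ ∑ i, min (‖x i‖ ^ 4 / w) 1) : √(w * c) ≤ normScale j y := by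
  have h1 := (abs_le.1 (abs_sum_sub_sum_le hN zero_le_one (h := fun z => min (‖z‖ ^ 4 / w) 1)
    (fun z => le_min (by positivity) zero_le_one) (fun z => min_le_right _ _))).1
  refine Real.sqrt_le_sqrt (le_trans ?_ (sum_min_sub_le_trimmedSum j (fun i => ‖y i‖ ^ 4) hw.le))
  have e : ∑ i, min (‖y i‖ ^ 4) w = w * ∑ i, min (‖y i‖ ^ 4 / w) 1 := by
    rw [Finset.mul_sum]
    refine Finset.sum_congr rfl fun i _ => ?_
    rw [mul_min_of_nonneg _ _ hw.le, mul_div_cancel₀ _ hw.ne', mul_one]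
  rw [e]
  nlinarith

/-- A trimmed sum of a contaminated sample, compared with truncated sums of the clean one. -/
theorem abs_trimmedSum_sub_le {x y : Fin n → EuclideanSpace ℝ (Fin d)} {N b s q E W : ℝ} {k : ℕ}
    {v : EuclideanSpace ℝ (Fin d)}
    (hN : (({i | y i ≠ x i} : Set (Fin n)).ncard : ℝ) ≤ N) (hb : 0 ≤ b) (hbs : b ≤ s) (hNk : N ≤ k)
    (hcount : ((Finset.univ.filter fun i => b < dirSq x v i).card : ℝ) + N ≤ k)
    (hE : |∑ i, min (dirSq x v i) s - q| ≤ E)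
    (hW : ∑ i, (min (dirSq x v i) s - min (dirSq x v i) b) ≤ W) (hW0 : 0 ≤ W) :
    |trimmedSum k (dirSq y v) - q| ≤ E + W + 2 * k * b := by
  have hcy : (Finset.univ.filter fun i => b < dirSq y v i).card ≤ k := by
    have := (card_filter_le_add hN v b).trans hcount
    exact_mod_cast this
  have h1 := abs_le.1 (abs_sum_sub_sum_le hN hb (h := fun z => min ((inner ℝ z v) ^ 2) b)
    (fun z => le_min (sq_nonneg _) hb) (fun z => min_le_right _ _))
  have h2 := trimmedSum_le_sum_min (dirSq_nonneg y v) hb hcy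
  have h3 := sum_min_sub_le_trimmedSum k (dirSq y v) hb
  have h4 : ∑ i, min (dirSq x v i) b ≤ ∑ i, min (dirSq x v i) s :=
    Finset.sum_le_sum fun i _ => min_le_min le_rfl hbs
  rw [Finset.sum_sub_distrib] at hW
  have hE' := abs_le.1 hE
  have h5 : b * N ≤ k * b := by rw [mul_comm]; gcongr
  simp only [dirSq] at *
  have h6 : 0 ≤ (k : ℝ) * b := by positivity
  rw [abs_le]; constructor <;> linarith

end Contamination

end

/-! ### Norms of the sample, and the envelope of its directional order statistics. -/

section Events

variable {d n : ℕ} (μ : Measure (EuclideanSpace ℝ (Fin d))) [IsProbabilityMeasure μ]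

theorem integrable_min_norm_pow {w : ℝ} (hw : 0 ≤ w) :
    Integrable (fun x : EuclideanSpace ℝ (Fin d) => min (‖x‖ ^ 4 / w) 1) μ :=
  integrable_of_abs_le (K := 1) (by fun_prop) fun x => by
    rw [abs_of_nonneg (le_min (by positivity) zero_le_one)]; exact min_le_right _ _

theorem integral_min_norm_pow_le (h4 : Integrable (fun x => ‖x‖ ^ 4) μ) {w : ℝ} (hw : 0 ≤ w) :
    ∫ x, min (‖x‖ ^ 4 / w) 1 ∂μ ≤ (∫ x, ‖x‖ ^ 4 ∂μ) / w := by
  rw [← integral_div]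
  exact integral_mono (integrable_min_norm_pow μ hw) (h4.div_const w) fun x => min_le_left _ _

theorem measure_normScale_gt_le (h4 : Integrable (fun x => ‖x‖ ^ 4) μ) {Q N t : ℝ} {j : ℕ} (hn : 0 < n)
    (hQ : 0 < Q) (hQ4 : ∫ x, ‖x‖ ^ 4 ∂μ ≤ Q ^ 2) (hj : 1 ≤ j) (ht : 4 * t ≤ j) (hN : 2 * N ≤ j) :
    (Measure.pi fun _ : Fin n => μ) {x | ∃ y : Fin n → EuclideanSpace ℝ (Fin d),
      (({i | y i ≠ x i} : Set (Fin n)).ncard : ℝ) ≤ N ∧ 3 * √n * Q < normScale j y} ≤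
      ENNReal.ofReal (Real.exp (-t)) := by
  have hn' : (0 : ℝ) < n := by exact_mod_cast hn
  have hj' : (0 : ℝ) < j := by exact_mod_cast hj
  -- At this level twice the expected truncated sum is at most `j / 4`. The confidence term adds `j
  -- / 4` and the corruption `j / 2`, so at most `j` corrupted points exceed it; and `√8 ≤ 3`.
  set R := 8 * n * Q ^ 2 / j with hR
  have hR0 : 0 < R := by positivity
  refine (measure_mono ?_).trans (measure_scalar_upper (n := n) μ (h := fun x => min (‖x‖ ^ 4 / R) 1)
    (by fun_prop) (fun x => le_min (by positivity) zero_le_one) (fun x => min_le_right _ _) t)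
  rintro x ⟨y, hy, hlt⟩
  simp only [Set.mem_ofPred_eq]
  by_contra hcon
  push Not at hcon
  have h1 := (integral_min_norm_pow_le μ h4 hR0.le).trans (div_le_div_of_nonneg_right hQ4 hR0.le)
  have h2 : 2 * n * (Q ^ 2 / R) = j / 4 := by rw [hR]; field_simp; norm_num
  have h3 : 2 * n * ∫ x, min (‖x‖ ^ 4 / R) 1 ∂μ ≤ j / 4 := by rw [← h2]; gcongr
  have h4 := normScale_le hy hR0 hN (by linarith)
  have h5 : R * j = 8 * (n * Q ^ 2) := by rw [hR]; field_simp
  have h6 : √(R * j) ≤ 3 * √n * Q := by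
    rw [h5]
    refine Real.sqrt_le_iff.2 ⟨by positivity, ?_⟩
    rw [mul_pow, mul_pow, Real.sq_sqrt hn'.le]
    nlinarith [mul_pos hn' (pow_pos hQ 2)]
  linarith

/-- A scale of the norms at which the population tail is matched with the sample. -/
theorem exists_normScale_ge (h4 : Integrable (fun x => ‖x‖ ^ 4) μ) {M N t : ℝ} {j : ℕ} (hn : 0 < n)
    (hM : 0 < M) (hj : 1 ≤ j) (hNt : 2 * N + 4 * t ≤ j) :
    ∃ w : ℝ, 0 < w ∧ ∫ x, min (‖x‖ ^ 4 / w) 1 ∂μ ≤ (128 * j : ℕ) / (32 * n) ∧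
    (Measure.pi fun _ : Fin n => μ) {x | ∃ y : Fin n → EuclideanSpace ℝ (Fin d),
      (({i | y i ≠ x i} : Set (Fin n)).ncard : ℝ) ≤ N ∧
      ¬ (√(w * (128 * j : ℕ)) ≤ √n * M * (128 * j : ℕ) ∨ √(w * (128 * j : ℕ)) ≤ 23 * normScale j y)} ≤
      ENNReal.ofReal (Real.exp (-t)) := by
  classical
  have hn' : (0 : ℝ) < n := by exact_mod_cast hn
  have hj' : (0 : ℝ) < j := by exact_mod_cast hj
  set k : ℝ := ((128 * j : ℕ) : ℝ) with hk
  have hkj : k = 128 * j := by rw [hk]; push_cast; ring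
  have hk0 : 0 < k := by rw [hkj]; positivity
  set thr := n * M ^ 2 * k with hthr
  have hthr0 : 0 < thr := by positivity
  -- Take the first dyadic multiple of `thr` whose truncated tail is small. If it is `thr` itself,
  -- the first alternative holds deterministically; otherwise the preceding multiple has a large
  -- tail, which the sample must show.
  have hex : ∃ i : ℕ, ∫ x, min (‖x‖ ^ 4 / (thr * 2 ^ i)) 1 ∂μ ≤ k / (32 * n) := by
    obtain ⟨i, hi⟩ := pow_unbounded_of_one_lt ((∫ x, ‖x‖ ^ 4 ∂μ) / thr / (k / (32 * n))) one_lt_two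
    refine ⟨i, (integral_min_norm_pow_le μ h4 (by positivity)).trans ?_⟩
    rw [div_lt_iff₀ (by positivity)] at hi
    rw [← div_div, div_le_iff₀ (by positivity)]
    linarith
  have h1 := Nat.find_spec hex
  rcases Nat.eq_zero_or_pos (Nat.find hex) with h0 | hpos
  · rw [h0, pow_zero, mul_one] at h1
    refine ⟨thr, hthr0, h1, ?_⟩
    have : √(thr * k) ≤ √n * M * k := by
      refine Real.sqrt_le_iff.2 ⟨by positivity, ?_⟩
      rw [mul_pow, mul_pow, Real.sq_sqrt hn'.le, hthr]
      exact le_of_eq (by ring)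
    simp [this]
  · have h2 := Nat.find_min hex (Nat.sub_lt hpos one_pos)
    push Not at h2
    set w := thr * 2 ^ (Nat.find hex - 1) with hw
    have hw0 : 0 < w := by positivity
    have hw2 : thr * 2 ^ Nat.find hex = 2 * w := by
      rw [hw]
      conv_lhs => rw [← Nat.sub_add_cancel hpos, pow_succ]
      ring
    rw [hw2] at h1
    refine ⟨2 * w, by positivity, h1, ?_⟩
    refine (measure_mono ?_).trans (measure_scalar_lower (n := n) μ (h := fun x => min (‖x‖ ^ 4 / w) 1)
      (by fun_prop) (fun x => le_min (by positivity) zero_le_one) (fun x => min_le_right _ _) t)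
    rintro x ⟨y, hy, hlt⟩
    simp only [Set.mem_ofPred_eq]
    by_contra hcon
    push Not at hcon hlt
    have h3 : n * (∫ x, min (‖x‖ ^ 4 / w) 1 ∂μ) / 2 ≥ 2 * j := by
      rw [div_lt_iff₀ (by positivity)] at h2
      linarith
    -- The truncated sum exceeds `2 j - 2 t`, and `N + 2 t ≤ j / 2` leaves `j / 2` after corruption
    -- and trimming. The ratio `√(2 * 128) / √(1 / 2) = √512` accounts for the constant `23`.
    have h4 := le_normScale (j := j) hy hw0 (c := (j : ℝ) / 2) (by linarith)
    have h5 : √(2 * w * k) ≤ 23 * √(w * (j / 2)) := by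
      refine Real.sqrt_le_iff.2 ⟨by positivity, ?_⟩
      rw [mul_pow, Real.sq_sqrt (by positivity), hkj]
      nlinarith [mul_pos hw0 hj']
    linarith [hlt.2]

/-- The two parts of `envelope` match the two ways a smoothed coordinate can be large: the first
bounds the marginal tail through the fourth moment, the second bounds the noise through the
truncated tail of the norms at scale `w`. -/
theorem measure_envelope_count (h4 : Integrable (fun x => ‖x‖ ^ 4) μ) {M N w : ℝ} {j k : ℕ} (hn : 0 < n)
    (hM : 0 < M) (hM4 : ∀ v : EuclideanSpace ℝ (Fin d), ‖v‖ ≤ 1 → ∫ x, (inner ℝ x v : ℝ) ^ 4 ∂μ ≤ M ^ 2)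
    (hw : 0 < w) (hwN : ∫ x, min (‖x‖ ^ 4 / w) 1 ∂μ ≤ (128 * j : ℕ) / (32 * n)) (hj : 1 ≤ j)
    (hjk : 128 * j ≤ k) (hN : 2 * N ≤ j) :
    (Measure.pi fun _ : Fin n => μ) {x | ∃ y : Fin n → EuclideanSpace ℝ (Fin d),
      (({i | y i ≠ x i} : Set (Fin n)).ncard : ℝ) ≤ N ∧ ∃ v : EuclideanSpace ℝ (Fin d), ‖v‖ = 1 ∧
      k < (Finset.univ.filter fun l => envelope n M (√(w * (128 * j : ℕ))) k < dirSq y v l).card} ≤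
      ENNReal.ofReal (Real.exp (-(k / 32))) := by
  have hn' : (0 : ℝ) < n := by exact_mod_cast hn
  have hj' : (1 : ℝ) ≤ j := by exact_mod_cast hj
  have hjk' : ((128 * j : ℕ) : ℝ) ≤ k := by exact_mod_cast hjk
  set k0 : ℝ := ((128 * j : ℕ) : ℝ) with hk0
  have hk0j : k0 = 128 * j := by rw [hk0]; push_cast; ring
  have hk00 : 0 < k0 := by rw [hk0j]; linarith
  have hk : (0 : ℝ) < k := hk00.trans_le hjk'
  have hsk : 0 < √(k : ℝ) := Real.sqrt_pos.2 hk
  have hsk2 : √(k : ℝ) ^ 2 = k := Real.sq_sqrt hk.le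
  set B := envelope n M (√(w * k0)) k with hB
  have hB1 : 32 * M * √(n / k : ℝ) ≤ B := by
    rw [hB, envelope]
    have : 0 ≤ 1200 * √(w * k0) / (k * √(k : ℝ)) := by positivity
    linarith
  have hB2 : 1200 * √(w * k0) / (k * √(k : ℝ)) ≤ B := by
    rw [hB, envelope]
    have : 0 ≤ 32 * M * √(n / k : ℝ) := by positivity
    linarith
  have hB0 : 0 < B := lt_of_lt_of_le (by positivity) hB1
  have hBa : 1024 * M ^ 2 * n ≤ B ^ 2 * k := by
    have := pow_le_pow_left₀ (by positivity) hB1 2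
    rw [mul_pow, mul_pow, Real.sq_sqrt (by positivity), ← mul_div_assoc, div_le_iff₀ hk] at this
    linarith
  have hBb : 1440000 * (w * k0) ≤ B ^ 2 * k ^ 3 := by
    have := pow_le_pow_left₀ (by positivity) hB2 2
    rw [div_pow, mul_pow, mul_pow, Real.sq_sqrt (by positivity), hsk2, div_le_iff₀ (by positivity)] at this
    linarith
  -- Both `β` and the confidence parameter are `k / 32`, so the clean count stays below `3 k / 8 + k
  -- / 16 + k / 8 = 9 k / 16`, which leaves room for the corruptions. The failure probabilities form
  -- a geometric series in `k`.
  refine (measure_mono ?_).trans (measure_directional_count (n := n) μ h4 hM4 (β := k / 32)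
    (by positivity) hB0 (k / 32))
  rintro x ⟨y, hy, v, hv, hlt⟩
  refine ⟨v, hv.le, ?_⟩
  have h1 := card_filter_le_add hy v B
  have h2 : (k : ℝ) < ((Finset.univ.filter fun i => B < dirSq y v i).card : ℝ) := by exact_mod_cast hlt
  have h3 : 16 * M ^ 2 / B ^ 2 ≤ k / (64 * n) := by
    rw [div_le_div_iff₀ (by positivity) (by positivity)]; linarith
  have h4 : ∫ z : EuclideanSpace ℝ (Fin d), min (1280 * ‖z‖ ^ 4 / ((k : ℝ) / 32 * B) ^ 2) 1 ∂μ ≤ (k : ℝ) / (32 * n) := by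
    have e : ∫ z : EuclideanSpace ℝ (Fin d), min (1280 * ‖z‖ ^ 4 / ((k : ℝ) / 32 * B) ^ 2) 1 ∂μ ≤
        ∫ z : EuclideanSpace ℝ (Fin d), (k : ℝ) / k0 * min (‖z‖ ^ 4 / w) 1 ∂μ := by
      refine integral_mono (integrable_of_abs_le (K := 1) (by fun_prop) fun z => ?_)
        ((integrable_min_norm_pow μ hw.le).const_mul _) fun z => ?_
      · rw [abs_of_nonneg (le_min (by positivity) zero_le_one)]; exact min_le_right _ _
      · simp only
        rw [mul_min_of_nonneg _ _ (by positivity), mul_one]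
        -- Since `k ≥ k0`, the factor `k / k0` may stand in front of the truncation: this transfers
        -- the choice of `w` at the starting level to all later levels.
        refine min_le_min ?_ ((one_le_div hk00).2 hjk')
        rw [div_mul_div_comm, div_le_div_iff₀ (by positivity) (by positivity)]
        have h6 : 1280 * (k0 * w) ≤ k * (k / 32 * B) ^ 2 := by nlinarith [mul_pos hw hk00]
        calc 1280 * ‖z‖ ^ 4 * (k0 * w) = 1280 * (k0 * w) * ‖z‖ ^ 4 := by ring
          _ ≤ k * (k / 32 * B) ^ 2 * ‖z‖ ^ 4 := by gcongr
          _ = _ := by ring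
    refine e.trans ?_
    rw [integral_const_mul]
    calc k / k0 * ∫ z, min (‖z‖ ^ 4 / w) 1 ∂μ ≤ k / k0 * (k0 / (32 * n)) := by gcongr
      _ = _ := by field_simp
  have h5 : 8 * n * (16 * M ^ 2 / B ^ 2 + ∫ z : EuclideanSpace ℝ (Fin d), min (1280 * ‖z‖ ^ 4 / ((k : ℝ) / 32 * B) ^ 2) 1 ∂μ) ≤
      8 * n * (k / (64 * n) + k / (32 * n)) := by gcongr
  have h6 : 8 * (n : ℝ) * (k / (64 * n) + k / (32 * n)) = 3 / 8 * (k : ℝ) := by field_simp; norm_num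
  have h7 : (Finset.univ.filter fun i => B < dirSq x v i).card =
    (Finset.univ.filter fun i => B < (inner ℝ (x i) v : ℝ) ^ 2).card := rfl
  rw [← h7]
  have h8 := h5.trans_eq h6
  linarith

theorem sum_Ico_exp_le (a b : ℕ) (hab : a ≤ b) :
    ∑ k ∈ Finset.Ico a b, Real.exp (-((k : ℝ) / 32)) ≤
      33 * (Real.exp (-((a : ℝ) / 32)) - Real.exp (-((b : ℝ) / 32))) := by
  induction b, hab using Nat.le_induction with
  | base => simp
  | succ b hab ih =>
    rw [Finset.sum_Ico_succ_top hab]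
    have e : Real.exp (-(((b + 1 : ℕ) : ℝ) / 32)) * Real.exp (1 / 32) = Real.exp (-((b : ℝ) / 32)) := by
      rw [← Real.exp_add]; congr 1; push_cast; ring
    have h1 := Real.add_one_le_exp (1 / 32 : ℝ)
    have h2 := Real.exp_pos (-(((b + 1 : ℕ) : ℝ) / 32))
    nlinarith

theorem measure_envelope_count_all (h4 : Integrable (fun x => ‖x‖ ^ 4) μ) {M N w : ℝ} {j : ℕ} (hn : 0 < n)
    (hM : 0 < M) (hM4 : ∀ v : EuclideanSpace ℝ (Fin d), ‖v‖ ≤ 1 → ∫ x, (inner ℝ x v : ℝ) ^ 4 ∂μ ≤ M ^ 2)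
    (hw : 0 < w) (hwN : ∫ x, min (‖x‖ ^ 4 / w) 1 ∂μ ≤ (128 * j : ℕ) / (32 * n)) (hj : 1 ≤ j)
    (hN : 2 * N ≤ j) (K : ℕ) :
    (Measure.pi fun _ : Fin n => μ) {x | ∃ y : Fin n → EuclideanSpace ℝ (Fin d),
      (({i | y i ≠ x i} : Set (Fin n)).ncard : ℝ) ≤ N ∧ ¬ ∀ k, 128 * j ≤ k → k < K →
        ∀ v : EuclideanSpace ℝ (Fin d), ‖v‖ = 1 →
        (Finset.univ.filter fun l => envelope n M (√(w * (128 * j : ℕ))) k < dirSq y v l).card ≤ k} ≤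
      ENNReal.ofReal (33 * Real.exp (-(4 * j))) := by
  rcases le_total (128 * j) K with hK | hK
  · refine (measure_mono (t := ⋃ k ∈ Finset.Ico (128 * j) K,
      {x | ∃ y : Fin n → EuclideanSpace ℝ (Fin d),
      (({i | y i ≠ x i} : Set (Fin n)).ncard : ℝ) ≤ N ∧ ∃ v : EuclideanSpace ℝ (Fin d), ‖v‖ = 1 ∧
      k < (Finset.univ.filter fun l => envelope n M (√(w * (128 * j : ℕ))) k < dirSq y v l).card}) ?_).trans
      ((measure_biUnion_finset_le _ _).trans ?_)
    · rintro x ⟨y, hy, hx⟩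
      push Not at hx
      obtain ⟨k, hk1, hk2, v, hv, hlt⟩ := hx
      simp only [Set.mem_iUnion]
      exact ⟨k, Finset.mem_Ico.2 ⟨hk1, hk2⟩, y, hy, v, hv, hlt⟩
    · refine (Finset.sum_le_sum fun k hk => measure_envelope_count μ h4 hn hM hM4 hw hwN hj
        (Finset.mem_Ico.1 hk).1 hN).trans ?_
      rw [← ENNReal.ofReal_sum_of_nonneg fun k _ => (Real.exp_pos _).le]
      refine ENNReal.ofReal_le_ofReal ((sum_Ico_exp_le _ _ hK).trans ?_)
      have e : -(((128 * j : ℕ) : ℝ) / 32) = -(4 * j) := by push_cast; ring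
      rw [e]
      have := Real.exp_pos (-((K : ℝ) / 32))
      linarith
  · refine (measure_mono_null ?_ measure_empty).le.trans zero_le
    rintro x ⟨y, hy, hx⟩
    exact hx fun k hk1 hk2 => by omega

end Events

/-! ### The trimmed form at a fixed trimming level. -/

section Directions

variable {d n : ℕ} (μ : Measure (EuclideanSpace ℝ (Fin d))) [IsProbabilityMeasure μ]

theorem measure_truncated_sum_deviation (h4 : Integrable (fun x => ‖x‖ ^ 4) μ) {M m t : ℝ} (hn : 0 < n)
    (hM : 0 < M) (hM4 : ∀ v : EuclideanSpace ℝ (Fin d), ‖v‖ ≤ 1 → ∫ x, (inner ℝ x v : ℝ) ^ 4 ∂μ ≤ M ^ 2)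
    (hm : 0 < m) (hMm : ∫ x, ‖x‖ ^ 4 ∂μ ≤ M ^ 2 * m ^ 2) (ht : t ≤ 6 * m) :
    (Measure.pi fun _ : Fin n => μ) {x | ∃ v : EuclideanSpace ℝ (Fin d), ‖v‖ ≤ 1 ∧
      30000000 * M * √(m * n) < |∑ i, min (dirSq x v i) (M * √(n / m)) - n * ∫ z, (inner ℝ z v : ℝ) ^ 2 ∂μ|} ≤
      2 * ENNReal.ofReal (Real.exp (-t)) := by
  have hn' : (0 : ℝ) < n := by exact_mod_cast hn
  -- This truncation balances the bias `n M ^ 2 / s` against the entropy cost `s m`; both equal `M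
  -- √(m n)`.
  set s := M * √(n / m) with hs
  have hs0 : 0 < s := by positivity
  set a := M * √(m * n) with ha
  have ha0 : 0 < a := by positivity
  have e1 : s * m = a := by
    rw [hs, ha, mul_assoc]
    congr 1
    rw [← Real.sqrt_sq hm.le, ← Real.sqrt_mul (by positivity)]
    congr 1
    rw [Real.sqrt_sq hm.le]
    field_simp
  have e2 : n * M ^ 2 / s = a := by
    have e0 : s ^ 2 * m = n * M ^ 2 := by
      rw [hs, mul_pow, Real.sq_sqrt (by positivity)]; field_simp
    rw [div_eq_iff hs0.ne', ← e1]
    linarith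
  have key : ∀ ε : ℝ, ε = 1 ∨ ε = -1 → (Measure.pi fun _ : Fin n => μ) {x | ∃ v : EuclideanSpace ℝ (Fin d),
      ‖v‖ ≤ 1 ∧ 30000000 * a < ε * (∑ i, min (dirSq x v i) s - n * ∫ z, (inner ℝ z v : ℝ) ^ 2 ∂μ)} ≤
      ENNReal.ofReal (Real.exp (-t)) := fun ε hε => by
    refine (measure_mono ?_).trans (measure_truncated_quadratic (n := n) μ h4 hM4 hm hMm hs0 hε
      (K := 10000000) le_rfl t)
    rintro x ⟨v, hv, h⟩
    refine ⟨v, hv, ?_⟩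
    have h1 : 2 * 10000000 * n * M ^ 2 / s = 2 * 10000000 * a := by rw [← e2]; ring
    rw [h1]
    have h2 : 3000 * s * (m / 2 + t) ≤ 3000 * s * (m / 2 + 6 * m) := by gcongr
    have h3 : 3000 * s * (m / 2 + 6 * m) = 19500 * a := by rw [← e1]; ring
    have h4 : ∑ i, min (dirSq x v i) s = ∑ i, min ((inner ℝ (x i) v : ℝ) ^ 2) s := rfl
    rw [h4] at h
    linarith
  have h1 := key 1 (Or.inl rfl)
  have h2 := key (-1) (Or.inr rfl)
  rw [two_mul]
  refine (measure_mono ?_).trans ((measure_union_le _ _).trans (add_le_add h1 h2))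
  rintro x ⟨v, hv, h⟩
  rw [mul_assoc] at h
  rcases lt_abs.1 h with h | h
  · exact Or.inl ⟨v, hv, by linarith⟩
  · exact Or.inr ⟨v, hv, by linarith⟩

theorem tailInd_sq_le {B q a : ℝ} (hB : 0 < B) (hq : 2 ≤ q) :
    tailInd B (a ^ 2) ≤ |a| ^ q / B ^ (q / 2) := by
  unfold tailInd
  split_ifs with h
  · rw [one_le_div (by positivity)]
    calc B ^ (q / 2) ≤ (a ^ 2) ^ (q / 2) := Real.rpow_le_rpow hB.le h.le (by linarith)
      _ = |a| ^ q := by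
        rw [← sq_abs, ← Real.rpow_natCast, ← Real.rpow_mul (abs_nonneg a)]
        congr 1
        push_cast; ring
  · positivity

theorem sub_le_of_rpow {B q a : ℝ} (hB : 0 < B) (hq : 2 ≤ q) :
    a ^ 2 - min (a ^ 2) B ≤ B * (|a| ^ q / B ^ (q / 2)) := by
  rcases le_total (a ^ 2) B with h | h
  · rw [min_eq_left h, sub_self]; positivity
  · rw [min_eq_right h]
    have e : |a| ^ q = (a ^ 2) ^ (q / 2) := by
      rw [← sq_abs, ← Real.rpow_natCast, ← Real.rpow_mul (abs_nonneg a)]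
      congr 1
      push_cast; ring
    rw [e, ← Real.div_rpow (sq_nonneg a) hB.le]
    have h1 : 1 ≤ a ^ 2 / B := (one_le_div hB).2 h
    have h2 : a ^ 2 / B ≤ (a ^ 2 / B) ^ (q / 2) := by
      conv_lhs => rw [← Real.rpow_one (a ^ 2 / B)]
      exact Real.rpow_le_rpow_of_exponent_le h1 (by linarith)
    calc a ^ 2 - B ≤ B * (a ^ 2 / B) := by rw [mul_div_cancel₀ _ hB.ne']; linarith
      _ ≤ _ := by gcongr

/-- Uniform control of a trimmed quadratic form at a fixed trimming level. -/
theorem measure_trimmedSum_deviation (h4 : Integrable (fun x => ‖x‖ ^ 4) μ) {σ T M m t N B q : ℝ} {k : ℕ}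
    (hn : 0 < n) (hM : 0 < M)
    (hσ : ∀ v : EuclideanSpace ℝ (Fin d), ∫ x, (inner ℝ x v : ℝ) ^ 2 ∂μ ≤ σ * ‖v‖ ^ 2)
    (hT : ∫ x, ‖x‖ ^ 2 ∂μ = T) (hT0 : 0 < T) (hmT : T ≤ m * σ)
    (hM4 : ∀ v : EuclideanSpace ℝ (Fin d), ‖v‖ ≤ 1 → ∫ x, (inner ℝ x v : ℝ) ^ 4 ∂μ ≤ M ^ 2)
    (hM4' : ∀ v : EuclideanSpace ℝ (Fin d), ∫ x, (inner ℝ x v : ℝ) ^ 2 ∂μ ≤ 6 * σ →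
      ∫ x, (inner ℝ x v : ℝ) ^ 4 ∂μ ≤ 36 * M ^ 2)
    (hm : 0 < m) (hMm : ∫ x, ‖x‖ ^ 4 ∂μ ≤ M ^ 2 * m ^ 2) (ht : t ≤ 6 * m) (hB : 0 < B) (hq : 2 ≤ q)
    (hqi : ∀ v : EuclideanSpace ℝ (Fin d), Integrable (fun x => |(inner ℝ x v : ℝ)| ^ q) μ)
    (hqB : ∀ v : EuclideanSpace ℝ (Fin d), ∫ x, (inner ℝ x v : ℝ) ^ 2 ∂μ ≤ 6 * σ →
      ∫ x, |(inner ℝ x v : ℝ)| ^ q ∂μ ≤ B ^ (q / 2) * (k / (64 * n)))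
    (hmk : 1264 * m ≤ k) (hN : 2 * N ≤ k) :
    (Measure.pi fun _ : Fin n => μ) {x | ∃ y : Fin n → EuclideanSpace ℝ (Fin d),
      (({i | y i ≠ x i} : Set (Fin n)).ncard : ℝ) ≤ N ∧ ∃ v : EuclideanSpace ℝ (Fin d), ‖v‖ = 1 ∧
      30000026 * M * √(m * n) + 3 * k * B <
        |trimmedSum k (dirSq y v) - n * ∫ z, (inner ℝ z v : ℝ) ^ 2 ∂μ|} ≤
      4 * ENNReal.ofReal (Real.exp (-t)) := by
  have hn' : (0 : ℝ) < n := by exact_mod_cast hn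
  have hk0 : (0 : ℝ) < k := lt_of_lt_of_le (by positivity) hmk
  have h2 := integrable_sq_of_four h4
  set s := M * √(n / m) with hs
  have hs0 : 0 < s := by positivity
  have hs2 : s ^ 2 * m = M ^ 2 * n := by
    rw [hs, mul_pow, Real.sq_sqrt (by positivity)]; field_simp
  have hsm : s * m = M * √(m * n) := by
    rw [hs, mul_assoc]
    congr 1
    rw [← Real.sqrt_sq hm.le, ← Real.sqrt_mul (by positivity)]
    congr 1
    rw [Real.sqrt_sq hm.le]
    field_simp
  -- Points above `b` are few enough to be removed, and the mass between `b` and `s` is bounded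
  -- separately, after normalisation to a function `h` with values in `[0, 1]`. If `s < B`, that
  -- mass is zero and the fourth moment controls the count.
  set b := min B s with hb
  have hb0 : 0 < b := lt_min hB hs0
  set h : ℝ → ℝ := fun a => (min a s - min a b) / s with hh
  have hbs : b ≤ s := min_le_right _ _
  have hhm : Monotone h := fun a a' haa => by
    refine div_le_div_of_nonneg_right ?_ hs0.le
    rcases le_total a b with h1 | h1
    · rw [min_eq_left h1, min_eq_left (h1.trans hbs), sub_self]
      exact sub_nonneg.2 (min_le_min le_rfl hbs)
    · rw [min_eq_right h1, min_eq_right (h1.trans haa)]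
      exact sub_le_sub_right (min_le_min haa le_rfl) _
  have hh0 : ∀ a, 0 ≤ h a := fun a => div_nonneg (sub_nonneg.2 (min_le_min le_rfl hbs)) hs0.le
  have hh1 : ∀ a, h a ≤ 1 := fun a => by
    rw [hh]
    simp only
    rw [div_le_one hs0]
    rcases le_total a b with h1 | h1
    · rw [min_eq_left h1, min_eq_left (h1.trans hbs), sub_self]; exact hs0.le
    · rw [min_eq_right h1]; linarith [min_le_right a s]
  have hhmeas : Measurable h := by
    rw [hh]; fun_prop
  have hD1 : ∀ θ : EuclideanSpace ℝ (Fin d), ∫ x, (inner ℝ x θ : ℝ) ^ 2 ∂μ ≤ 6 * σ →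
      ∫ y, tailInd b ((inner ℝ y θ) ^ 2) ∂μ ≤ k / (64 * n) + 36 * m / n := fun θ hθ => by
    have hint : Integrable (fun y => tailInd b ((inner ℝ y θ : ℝ) ^ 2)) μ :=
      integrable_of_abs_le (K := 1) ((tailInd_monotone b).measurable.comp (by fun_prop)) fun y => by
        rw [abs_of_nonneg (tailInd_nonneg _ _)]; exact tailInd_le_one _ _
    have p1 : 0 ≤ k / (64 * n : ℝ) := by positivity
    have p2 : 0 ≤ 36 * m / (n : ℝ) := by positivity
    rcases le_total B s with hBs | hBs
    · rw [hb, min_eq_left hBs] at hint ⊢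
      have e := integral_mono hint ((hqi θ).div_const (B ^ (q / 2))) fun y => tailInd_sq_le hB hq
      rw [integral_div] at e
      have e2 := hqB θ hθ
      rw [mul_comm, ← div_le_iff₀ (by positivity)] at e2
      linarith
    · rw [hb, min_eq_right hBs] at hint ⊢
      have e := integral_mono hint ((integrable_inner_pow_four h4 θ).div_const (s ^ 2)) fun y => by
        simp only [tailInd]
        split_ifs with hy
        · rw [one_le_div (by positivity)]
          nlinarith
        · positivity
      rw [integral_div] at e
      have e2 : (∫ x, (inner ℝ x θ : ℝ) ^ 4 ∂μ) / s ^ 2 ≤ 36 * m / n := by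
        rw [div_le_div_iff₀ (by positivity) hn']
        have := hM4' θ hθ
        calc _ ≤ 36 * M ^ 2 * n := by gcongr
          _ = _ := by linarith
      linarith
  have hD2 : ∀ θ : EuclideanSpace ℝ (Fin d), ∫ x, (inner ℝ x θ : ℝ) ^ 2 ∂μ ≤ 6 * σ →
      ∫ y, h ((inner ℝ y θ) ^ 2) ∂μ ≤ B / s * (k / (64 * n)) := fun θ hθ => by
    have hint : Integrable (fun y => h ((inner ℝ y θ : ℝ) ^ 2)) μ :=
      integrable_of_abs_le (K := 1) (hhmeas.comp (by fun_prop)) fun y => by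
        rw [abs_of_nonneg (hh0 _)]; exact hh1 _
    have hp : ∀ y : EuclideanSpace ℝ (Fin d), h ((inner ℝ y θ : ℝ) ^ 2) ≤
        B / s * (|(inner ℝ y θ : ℝ)| ^ q / B ^ (q / 2)) := fun y => by
      rw [hh, div_mul_eq_mul_div]
      refine div_le_div_of_nonneg_right ?_ hs0.le
      rcases le_total B s with hBs | hBs
      · rw [hb, min_eq_left hBs]
        exact (sub_le_sub_right (min_le_left _ _) _).trans (sub_le_of_rpow hB hq)
      · rw [hb, min_eq_right hBs, sub_self]; positivity
    have e := integral_mono hint (((hqi θ).div_const (B ^ (q / 2))).const_mul (B / s)) hp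
    rw [integral_const_mul, integral_div (B ^ (q / 2)) fun y => |(inner ℝ y θ : ℝ)| ^ q] at e
    have e2 := hqB θ hθ
    rw [mul_comm, ← div_le_iff₀ (by positivity)] at e2
    exact e.trans (mul_le_mul_of_nonneg_left e2 (by positivity))
  have E1 := measure_truncated_sum_deviation (n := n) μ h4 hn hM hM4 hm hMm ht
  have E2 := measure_directional_upper_of_variance (n := n) μ h2 hσ hT hT0 hm hmT (tailInd_monotone b)
    (tailInd_nonneg b) (tailInd_le_one b) (by positivity) hD1 t
  have E3 := measure_directional_upper_of_variance (n := n) μ h2 hσ hT hT0 hm hmT hhm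
    hh0 hh1 (by positivity) hD2 t
  have e4 : (4 : ENNReal) * ENNReal.ofReal (Real.exp (-t)) = 2 * ENNReal.ofReal (Real.exp (-t)) +
      (ENNReal.ofReal (Real.exp (-t)) + ENNReal.ofReal (Real.exp (-t))) := by ring
  rw [e4]
  refine (measure_mono ?_).trans ((measure_union_le _ _).trans (add_le_add E1
    ((measure_union_le _ _).trans (add_le_add E2 E3))))
  rintro x ⟨y, hy, v, hv, hlt⟩
  by_contra hcon
  simp only [Set.mem_union, Set.mem_ofPred_eq, not_or, not_exists, not_and, not_lt, not_le] at hcon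
  obtain ⟨c1, c2, c3⟩ := hcon
  have d1 := c1 v hv.le
  have d2 := c2 v hv.le
  have d3 := c3 v hv.le
  rw [sum_tailInd] at d2
  have f1 : 8 * (n : ℝ) * (k / (64 * n) + 36 * m / n) = k / 8 + 288 * m := by field_simp; ring
  rw [f1] at d2
  have f2 : 8 * (n : ℝ) * (B / s * (k / (64 * n))) = B * k / 8 / s := by field_simp; norm_num
  rw [f2] at d3
  have g1 : ∑ i, (min (dirSq x v i) s - min (dirSq x v i) b) = s * ∑ i, h ((inner ℝ (x i) v : ℝ) ^ 2) := by
    rw [Finset.mul_sum]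
    refine Finset.sum_congr rfl fun i _ => ?_
    simp only [hh, dirSq]
    rw [mul_div_cancel₀ _ hs0.ne']
  have g2 : ∑ i, (min (dirSq x v i) s - min (dirSq x v i) b) ≤ B * k / 8 + 26 * (M * √(m * n)) := by
    rw [g1, ← hsm]
    calc s * ∑ i, h ((inner ℝ (x i) v : ℝ) ^ 2) ≤ s * (B * k / 8 / s + 2 * m + 4 * (6 * m)) := by
          gcongr; linarith
      _ = _ := by field_simp; ring
  -- The count above `b` is at most `k / 8 + 288 m + 2 m + 4 t`, with `4 t ≤ 24 m` and `314 m ≤ k /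
  -- 4`; the corruptions take at most another `k / 2`.
  have g3 := abs_trimmedSum_sub_le (k := k) (v := v) hy hb0.le hbs (by linarith) (by
    have : ((Finset.univ.filter fun i => b < dirSq x v i).card : ℝ) =
      ((Finset.univ.filter fun i => b < (inner ℝ (x i) v : ℝ) ^ 2).card : ℝ) := rfl
    rw [this]; linarith) d1 g2 (by positivity)
  have g4 : 2 * (k : ℝ) * b ≤ 2 * k * B := by gcongr; exact min_le_left _ _
  have g5 : 0 < B * k := by positivity
  linarith

end Directions

/-! ### The trimmed form at the data-driven level. -/

section Deviation

variable {d n : ℕ} (μ : Measure (EuclideanSpace ℝ (Fin d))) [IsProbabilityMeasure μ]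

/-- Uniform control of the trimmed quadratic form at the data-driven trimming level. -/
theorem measure_stopLevel_deviation (h4 : Integrable (fun x => ‖x‖ ^ 4) μ)
    {σ T M m r t N B q : ℝ} {j k : ℕ} (hn : 0 < n) (hM : 0 < M)
    (hσ : ∀ v : EuclideanSpace ℝ (Fin d), ∫ x, (inner ℝ x v : ℝ) ^ 2 ∂μ ≤ σ * ‖v‖ ^ 2)
    (hT : ∫ x, ‖x‖ ^ 2 ∂μ = T) (hT0 : 0 < T) (hmT : T ≤ m * σ)
    (hM4 : ∀ v : EuclideanSpace ℝ (Fin d), ‖v‖ ≤ 1 → ∫ x, (inner ℝ x v : ℝ) ^ 4 ∂μ ≤ M ^ 2)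
    (hM4' : ∀ v : EuclideanSpace ℝ (Fin d), ∫ x, (inner ℝ x v : ℝ) ^ 2 ∂μ ≤ 6 * σ →
      ∫ x, (inner ℝ x v : ℝ) ^ 4 ∂μ ≤ 36 * M ^ 2)
    (hr : 0 < r) (hrm : r ≤ m) (hr4 : ∫ x, ‖x‖ ^ 4 ∂μ ≤ (M * r) ^ 2) (ht0 : 0 ≤ t) (ht : t ≤ 6 * m)
    (hB : 0 < B) (hq : 2 ≤ q)
    (hqi : ∀ v : EuclideanSpace ℝ (Fin d), Integrable (fun x => |(inner ℝ x v : ℝ)| ^ q) μ)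
    (hqB : ∀ v : EuclideanSpace ℝ (Fin d), ∫ x, (inner ℝ x v : ℝ) ^ 2 ∂μ ≤ 6 * σ →
      ∫ x, |(inner ℝ x v : ℝ)| ^ q ∂μ ≤ B ^ (q / 2) * (k / (64 * n)))
    (hN0 : 0 ≤ N) (hj : 1 ≤ j) (hNt : 2 * N + 4 * t ≤ j) (hjk : 128 * j ≤ k)
    (hmk : 1264 * m ≤ k) (hrk : 2528 * r ≤ k) (hk : k = 128 * j ∨ (k : ℝ) ≤ 2529 * r) :
    (Measure.pi fun _ : Fin n => μ) {x | ∃ y : Fin n → EuclideanSpace ℝ (Fin d),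
      (({i | y i ≠ x i} : Set (Fin n)).ncard : ℝ) ≤ N ∧ ∃ v : EuclideanSpace ℝ (Fin d), ‖v‖ = 1 ∧
      300000000 * M * √(m * n) + 3 * k * B <
        |trimmedSum (stopLevel j y) (dirSq y v) - n * ∫ z, (inner ℝ z v : ℝ) ^ 2 ∂μ|} ≤
      ENNReal.ofReal (39 * Real.exp (-t)) := by
  have hn' : (0 : ℝ) < n := by exact_mod_cast hn
  have hj' : (1 : ℝ) ≤ j := by exact_mod_cast hj
  have hjk' : (128 : ℝ) * j ≤ k := by exact_mod_cast hjk
  have hm : 0 < m := hr.trans_le hrm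
  have hMm : ∫ x, ‖x‖ ^ 4 ∂μ ≤ M ^ 2 * m ^ 2 := by
    rw [← mul_pow]; exact hr4.trans (by gcongr)
  have E1 := measure_normScale_gt_le (n := n) (N := N) (t := t) (j := j) μ h4 hn (mul_pos hM hr) hr4 hj
    (by linarith) (by linarith)
  obtain ⟨w, hw, hwN, E2⟩ := exists_normScale_ge (n := n) μ h4 hn hM hj hNt
  have E3 := measure_envelope_count_all μ h4 hn hM hM4 hw hwN hj (N := N) (by linarith) k
  have E4 := measure_trimmedSum_deviation (n := n) (N := N) (k := k) μ h4 hn hM hσ hT hT0 hmT hM4 hM4' hm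
    hMm ht hB hq hqi hqB hmk (by linarith)
  have e : ENNReal.ofReal (Real.exp (-t)) + (ENNReal.ofReal (Real.exp (-t)) +
      (ENNReal.ofReal (33 * Real.exp (-(4 * j))) + 4 * ENNReal.ofReal (Real.exp (-t)))) ≤
      ENNReal.ofReal (39 * Real.exp (-t)) := by
    have h1 : (4 : ENNReal) * ENNReal.ofReal (Real.exp (-t)) = ENNReal.ofReal (4 * Real.exp (-t)) := by
      rw [ENNReal.ofReal_mul (by norm_num)]; simp
    rw [h1, ← ENNReal.ofReal_add (by positivity) (by positivity),
      ← ENNReal.ofReal_add (by positivity) (by positivity),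
      ← ENNReal.ofReal_add (by positivity) (by positivity)]
    refine ENNReal.ofReal_le_ofReal ?_
    have h2 : Real.exp (-(4 * j)) ≤ Real.exp (-t) := Real.exp_le_exp.2 (by linarith)
    linarith
  refine le_trans ((measure_mono ?_).trans ((measure_union_le _ _).trans (add_le_add E1
    ((measure_union_le _ _).trans (add_le_add E2 ((measure_union_le _ _).trans (add_le_add E3 E4))))))) e
  rintro x ⟨y, hy, v, hv, hlt⟩
  by_contra hcon
  simp only [Set.mem_union, Set.mem_ofPred_eq, not_or, not_exists, not_and] at hcon
  obtain ⟨c1, c2, c3, c4⟩ := hcon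
  have d1 := not_lt.1 (c1 y hy)
  have d2 := or_iff_not_imp_left.2 fun hne => not_not.1 (c2 y hy hne)
  have d3 := not_not.1 (c3 y hy)
  have d4 := not_lt.1 (c4 y hy v hv)
  have hmn : √(r * n) ≤ √(m * n) := Real.sqrt_le_sqrt (by gcongr)
  have hspec := (stopLevel_spec j y).1
  have hdiff : |trimmedSum (stopLevel j y) (dirSq y v) - trimmedSum k (dirSq y v)| ≤
      183600000 * M * √(m * n) := by
    have hpos : 0 ≤ 183600000 * M * √(m * n) := by positivity
    -- Overshooting is paid by `normScale`, at most `3 √n M r`, over `√k ≥ 50 √r`. Stopping below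
    -- `k` excludes `k = 128 * j`, the least possible level, so `k` is at most `2529 r` and `√(n k)`
    -- is within the rate.
    rcases le_or_gt k (stopLevel j y) with hle | hlt
    · have h1 := trimmedSum_le_stopLevel_add (hjk) (by omega) hle hv
      have h2 := trimmedSum_antitone (dirSq y v) hle
      have h3 : 110404 * normScale j y / √(k : ℝ) ≤ 183600000 * M * √(m * n) := by
        have hsr : 0 < √r := Real.sqrt_pos.2 hr
        have hsk : 50 * √r ≤ √(k : ℝ) := by
          refine Real.le_sqrt_of_sq_le ?_
          rw [mul_pow, Real.sq_sqrt hr.le]; linarith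
        have hsk0 : 0 < √(k : ℝ) := lt_of_lt_of_le (by positivity) hsk
        have e1 : √(r * n) = √r * √n := Real.sqrt_mul hr.le _
        rw [div_le_iff₀ hsk0]
        have e2 : √r * √r = r := Real.mul_self_sqrt hr.le
        calc 110404 * normScale j y ≤ 110404 * (3 * √n * (M * r)) := by gcongr
          _ = 331212 * M * √n * r := by ring
          _ = 331212 * M * √n * (√r * √r) := by rw [e2]
          _ = 331212 * M * (√r * √n) * √r := by ring
          _ ≤ 9180000000 * M * (√r * √n) * √r := by gcongr; norm_num
          _ = 183600000 * M * (√r * √n) * (50 * √r) := by ring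
          _ ≤ 183600000 * M * √(m * n) * √(k : ℝ) := by rw [← e1]; gcongr
      rw [abs_le]; constructor <;> linarith
    · have hkr : (k : ℝ) ≤ 2529 * r := hk.resolve_left (by omega)
      have h1 := trimmedSum_stopLevel_le_add hM.le (Real.sqrt_nonneg _) hj d2 hlt.le d3 hv
      have h2 := trimmedSum_antitone (dirSq y v) hlt.le
      simp only at h2
      have h3 : √(n * k : ℝ) ≤ 51 * √(m * n) := by
        refine Real.sqrt_le_iff.2 ⟨by positivity, ?_⟩
        rw [mul_pow, Real.sq_sqrt (by positivity)]
        have h5 : (k : ℝ) ≤ 2601 * m := by linarith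
        calc (n : ℝ) * k ≤ n * (2601 * m) := by gcongr
          _ = _ := by ring
      have h4 : 3600000 * M * √(n * k : ℝ) ≤ 3600000 * M * (51 * √(m * n)) := by gcongr
      rw [abs_le]; constructor <;> linarith
  have := abs_sub_le (trimmedSum (stopLevel j y) (dirSq y v)) (trimmedSum k (dirSq y v))
    (n * ∫ z, (inner ℝ z v : ℝ) ^ 2 ∂μ)
  have hpos : 0 < M * √(m * n) := by positivity
  linarith

/-- The base of the power is the level `B` whose exceedance probability is about `k / n` by the
`q`-th moment. Its constant is `48 = 8 * 6`: the `6` matches the smoothed variance, and `8 ^ (q / 2)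
≥ 64` absorbs the divisor `64`. -/
theorem integral_abs_inner_rpow_le_of_variance {q σ : ℝ} (hq4 : 4 ≤ q)
    (h2 : Integrable (fun x => ‖x‖ ^ 2) μ) (h0 : ∫ x, x ∂μ = 0) (hq : Integrable (fun x => ‖x‖ ^ q) μ)
    (hκ : 0 ≤ RobustCov.kappa μ q) (hσ : 0 ≤ σ) {n k : ℕ} (hn : 0 < n) (hk : 0 < k)
    {v : EuclideanSpace ℝ (Fin d)} (hv : ∫ x, (inner ℝ x v : ℝ) ^ 2 ∂μ ≤ 6 * σ) :
    ∫ x, |(inner ℝ x v : ℝ)| ^ q ∂μ ≤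
      (48 * RobustCov.kappa μ q ^ 2 * σ * ((n : ℝ) / k) ^ (2 / q)) ^ (q / 2) * (k / (64 * n)) := by
  have hn' : (0 : ℝ) < n := by exact_mod_cast hn
  have hk' : (0 : ℝ) < k := by exact_mod_cast hk
  have hvar : 0 ≤ ∫ x, (inner ℝ x v : ℝ) ^ 2 ∂μ := integral_nonneg fun x => sq_nonneg _
  refine (integral_abs_inner_rpow_le (by linarith) h2 h0 hq v).trans ?_
  have e1 : (48 * RobustCov.kappa μ q ^ 2 * σ * ((n : ℝ) / k) ^ (2 / q)) ^ (q / 2) =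
      8 ^ (q / 2) * RobustCov.kappa μ q ^ q * (6 * σ) ^ (q / 2) * (n / k) := by
    rw [show 48 * RobustCov.kappa μ q ^ 2 * σ * ((n : ℝ) / k) ^ (2 / q) =
      8 * RobustCov.kappa μ q ^ 2 * (6 * σ) * ((n : ℝ) / k) ^ (2 / q) by ring,
      Real.mul_rpow (by positivity) (by positivity), Real.mul_rpow (by positivity) (by positivity),
      Real.mul_rpow (by positivity) (by positivity), ← Real.rpow_mul (by positivity)]
    congr 1
    · congr 2
      rw [← Real.rpow_natCast, ← Real.rpow_mul hκ]
      congr 1; push_cast; ring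
    · rw [show 2 / q * (q / 2) = 1 by field_simp, Real.rpow_one]
  rw [e1]
  have e2 : (64 : ℝ) ≤ 8 ^ (q / 2) := by
    calc (64 : ℝ) = 8 ^ (2 : ℝ) := by norm_num
      _ ≤ 8 ^ (q / 2) := Real.rpow_le_rpow_of_exponent_le (by norm_num) (by linarith)
  have e3 : (∫ x, (inner ℝ x v : ℝ) ^ 2 ∂μ) ^ (q / 2) ≤ (6 * σ) ^ (q / 2) :=
    Real.rpow_le_rpow hvar hv (by linarith)
  have e4 : 0 ≤ RobustCov.kappa μ q ^ q := by positivity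
  calc RobustCov.kappa μ q ^ q * (∫ x, (inner ℝ x v : ℝ) ^ 2 ∂μ) ^ (q / 2)
      ≤ RobustCov.kappa μ q ^ q * (6 * σ) ^ (q / 2) := by gcongr
    _ = 64 * (RobustCov.kappa μ q ^ q * (6 * σ) ^ (q / 2)) / 64 := by ring
    _ ≤ 8 ^ (q / 2) * (RobustCov.kappa μ q ^ q * (6 * σ) ^ (q / 2)) / 64 := by gcongr
    _ = _ := by field_simp

theorem exists_integral_inner_sq_pos (h2 : Integrable (fun x => ‖x‖ ^ 2) μ) (h0 : ∫ x, x ∂μ = 0)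
    (hS : RobustCov.covMatrix μ ≠ 0) :
    ∃ v : EuclideanSpace ℝ (Fin d), 0 < ∫ x, (inner ℝ x v : ℝ) ^ 2 ∂μ := by
  by_contra hc
  push Not at hc
  refine absurd (opNorm_le_of_quadForm (A := RobustCov.covMatrix μ) covMatrix_isHermitian le_rfl
    fun v _ => ?_) (not_le.2 (opNorm_pos hS))
  rw [quadForm_covMatrix h2 h0, abs_of_nonneg (integral_nonneg fun x => sq_nonneg _)]
  exact hc v

/-- Uniform control of the trimmed quadratic form, with the trimming level of the estimator. -/
theorem measure_quadForm_deviation {p α η : ℝ} (hp4 : 4 ≤ p) (hp : Integrable (fun x => ‖x‖ ^ p) μ)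
    (h0 : ∫ x, x ∂μ = 0) (hS : RobustCov.covMatrix μ ≠ 0) (hα0 : 0 < α) (hα1 : α < 1) (hη : 0 ≤ η)
    (hn : 0 < n) :
    (Measure.pi fun _ : Fin n => μ) {x | ∃ y : Fin n → EuclideanSpace ℝ (Fin d),
      (({i | y i ≠ x i} : Set (Fin n)).ncard : ℝ) ≤ η * n ∧ ∃ v : EuclideanSpace ℝ (Fin d), ‖v‖ = 1 ∧
      400000000 * RobustCov.kappa μ 4 ^ 2 * RobustCov.opNorm (RobustCov.covMatrix μ) *
        (√(RobustCov.stableRank (RobustCov.covMatrix μ) / n) + √(Real.log (2 / α) / n)) +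
      1000000 * RobustCov.kappa μ p ^ 2 * RobustCov.opNorm (RobustCov.covMatrix μ) * η ^ (1 - 2 / p) <
        |trimmedSum (stopLevel ⌈24 * (η * n + Real.log (2 / α))⌉₊ y) (dirSq y v) / n -
          RobustCov.quadForm (RobustCov.covMatrix μ) v|} ≤
      ENNReal.ofReal α := by
  have hn' : (0 : ℝ) < n := by exact_mod_cast hn
  have h4 := integrable_norm_pow_four hp4 hp
  have h2 := integrable_sq_of_four h4
  have h4' : Integrable (fun x => ‖x‖ ^ (4 : ℝ)) μ := integrable_norm_rpow_of_le (by norm_num) hp4 hp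
  set σ := RobustCov.opNorm (RobustCov.covMatrix μ) with hσd
  have hσ0 : 0 < σ := opNorm_pos hS
  set T := ∫ x, ‖x‖ ^ 2 ∂μ with hTd
  set r := RobustCov.stableRank (RobustCov.covMatrix μ) with hrd
  set L := Real.log (2 / α) with hL
  have hrT : r * σ = T := by
    rw [hrd, RobustCov.stableRank, trace_covMatrix h2 h0, div_mul_cancel₀ _ hσ0.ne']
  have hσ : ∀ v : EuclideanSpace ℝ (Fin d), ∫ x, (inner ℝ x v : ℝ) ^ 2 ∂μ ≤ σ * ‖v‖ ^ 2 := fun v => by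
    rw [← quadForm_covMatrix h2 h0]; exact (le_abs_self _).trans (abs_quadForm_le _ v)
  have hσT : σ ≤ T := by
    refine opNorm_le_of_quadForm covMatrix_isHermitian (integral_nonneg fun x => by positivity) fun v hv => ?_
    rw [quadForm_covMatrix h2 h0, abs_of_nonneg (integral_nonneg fun x => sq_nonneg _)]
    refine integral_mono (integrable_inner_sq h2 v) h2 fun x => ?_
    have := abs_real_inner_le_norm x v
    rw [hv, mul_one] at this
    simp only
    rw [← sq_abs]
    gcongr
  have hT0 : 0 < T := hσ0.trans_le hσT
  have hr1 : 1 ≤ r := by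
    by_contra hc
    push Not at hc
    nlinarith
  have hex := exists_integral_inner_sq_pos μ h2 h0 hS
  have hκ4 := one_le_kappa (by norm_num) h2 h0 h4' hex
  have hκp := one_le_kappa (by linarith) h2 h0 hp hex
  -- Needed to absorb the rounding in `j`: since `128 ≤ 256 L`, the bound `128 j ≤ 6400 L` holds
  -- when `η n < L`.
  have hL0 : 69 / 100 < L := by
    have : Real.log 2 ≤ L := Real.log_le_log (by norm_num) (by rw [le_div_iff₀ hα0]; linarith)
    have := Real.log_two_gt_d9
    linarith
  set M := RobustCov.kappa μ 4 ^ 2 * σ with hM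
  have hM0 : 0 < M := by positivity
  have hvar0 : ∀ v : EuclideanSpace ℝ (Fin d), 0 ≤ ∫ x, (inner ℝ x v : ℝ) ^ 2 ∂μ :=
    fun v => integral_nonneg fun x => sq_nonneg _
  have hM4 : ∀ v : EuclideanSpace ℝ (Fin d), ‖v‖ ≤ 1 → ∫ x, (inner ℝ x v : ℝ) ^ 4 ∂μ ≤ M ^ 2 := fun v hv => by
    refine (integral_inner_four_le h4 h0 v).trans ?_
    have h1 : ∫ x, (inner ℝ x v : ℝ) ^ 2 ∂μ ≤ σ :=
      (hσ v).trans (mul_le_of_le_one_right hσ0.le (pow_le_one₀ (norm_nonneg _) hv))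
    calc _ ≤ RobustCov.kappa μ 4 ^ 4 * σ ^ 2 := by
          gcongr
      _ = M ^ 2 := by rw [hM]; ring
  have hM4' : ∀ v : EuclideanSpace ℝ (Fin d), ∫ x, (inner ℝ x v : ℝ) ^ 2 ∂μ ≤ 6 * σ →
      ∫ x, (inner ℝ x v : ℝ) ^ 4 ∂μ ≤ 36 * M ^ 2 := fun v hv => by
    refine (integral_inner_four_le h4 h0 v).trans ?_
    calc _ ≤ RobustCov.kappa μ 4 ^ 4 * (6 * σ) ^ 2 := by
          gcongr
      _ = 36 * M ^ 2 := by rw [hM]; ring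
  have hr4 : ∫ x, ‖x‖ ^ 4 ∂μ ≤ (M * r) ^ 2 := by
    refine (integral_norm_four_le h4 h0).trans (le_of_eq ?_)
    rw [← hTd, ← hrT, hM]; ring
  set j := ⌈24 * (η * n + L)⌉₊ with hj
  have hηn : 0 ≤ η * n := by positivity
  have hjl : 24 * (η * n + L) ≤ j := Nat.le_ceil _
  have hju : (j : ℝ) < 24 * (η * n + L) + 1 := Nat.ceil_lt_add_one (by positivity)
  have hj1 : 1 ≤ j := Nat.ceil_pos.2 (by positivity)
  have hrL : √((r + L) / n) ≤ √(r / n) + √(L / n) := by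
    rw [add_div]
    refine Real.sqrt_le_iff.2 ⟨by positivity, ?_⟩
    have h1 : √(r / n) ^ 2 = r / n := Real.sq_sqrt (by positivity)
    have h2 : √(L / n) ^ 2 = L / n := Real.sq_sqrt (by positivity)
    nlinarith [Real.sqrt_nonneg (r / n), Real.sqrt_nonneg (L / n),
      mul_nonneg (Real.sqrt_nonneg (r / n)) (Real.sqrt_nonneg (L / n))]
  -- The comparison level and the moment depend on the dominant term, and enter the analysis only.
  -- If corruption dominates, `k = 128 j` and `q = p`; if confidence does, `k = 128 j` and `q = 4`;
  -- if the stable rank does, `k` is `2528 r` rounded up and `q = 4`. For `q = 4` the bias is of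
  -- order `√(k / n)`, already the statistical rate.
  obtain ⟨k, q, hq4, hqi, hκq, hjk, hrk, hmk, hk, hfin⟩ : ∃ (k : ℕ) (q : ℝ), 4 ≤ q ∧
      Integrable (fun x => ‖x‖ ^ q) μ ∧ 1 ≤ RobustCov.kappa μ q ∧ 128 * j ≤ k ∧ 2528 * r ≤ k ∧
      1264 * (r + L) ≤ k ∧ (k = 128 * j ∨ (k : ℝ) ≤ 2529 * r) ∧
      144 * RobustCov.kappa μ q ^ 2 * σ * ((k : ℝ) / n) ^ (1 - 2 / q) ≤
        11520 * RobustCov.kappa μ 4 ^ 2 * σ * (√(r / n) + √(L / n)) +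
        1000000 * RobustCov.kappa μ p ^ 2 * σ * η ^ (1 - 2 / p) := by
    have hfour : ∀ k : ℕ, (k : ℝ) ≤ 6400 * (r + L) →
        144 * RobustCov.kappa μ 4 ^ 2 * σ * ((k : ℝ) / n) ^ (1 - 2 / (4 : ℝ)) ≤
        11520 * RobustCov.kappa μ 4 ^ 2 * σ * (√(r / n) + √(L / n)) +
        1000000 * RobustCov.kappa μ p ^ 2 * σ * η ^ (1 - 2 / p) := fun k hk => by
      have e1 : ((k : ℝ) / n) ^ (1 - 2 / (4 : ℝ)) ≤ 80 * √((r + L) / n) := by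
        rw [show 1 - 2 / (4 : ℝ) = 1 / 2 by norm_num, ← Real.sqrt_eq_rpow]
        refine Real.sqrt_le_iff.2 ⟨by positivity, ?_⟩
        rw [mul_pow, Real.sq_sqrt (by positivity), mul_div_assoc', div_le_div_iff_of_pos_right hn']
        linarith
      have e2 : 0 ≤ 1000000 * RobustCov.kappa μ p ^ 2 * σ * η ^ (1 - 2 / p) := by positivity
      calc _ ≤ 144 * RobustCov.kappa μ 4 ^ 2 * σ * (80 * (√(r / n) + √(L / n))) := by
            gcongr; exact e1.trans (by gcongr)
        _ ≤ _ := by linarith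
    have hcast : ((128 * j : ℕ) : ℝ) = 128 * j := by push_cast; ring
    rcases le_or_gt (2528 * r) (128 * j) with hc | hc
    · rcases le_or_gt L (η * n) with hc2 | hc2
      · refine ⟨128 * j, p, hp4, hp, hκp, le_rfl, by rw [hcast]; exact hc, by rw [hcast]; linarith,
          Or.inl rfl, ?_⟩
        have e1 : ((128 * j : ℕ) : ℝ) / n ≤ 6400 * η := by
          rw [hcast, div_le_iff₀ hn']; linarith
        have hex0 : 0 ≤ 1 - 2 / p := by
          rw [sub_nonneg, div_le_one (by linarith)]; linarith
        have hex1 : 1 - 2 / p ≤ 1 := by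
          have : 0 ≤ 2 / p := by positivity
          linarith
        have e2 : (((128 * j : ℕ) : ℝ) / n) ^ (1 - 2 / p) ≤ 6400 * η ^ (1 - 2 / p) := by
          calc (((128 * j : ℕ) : ℝ) / n) ^ (1 - 2 / p) ≤ (6400 * η) ^ (1 - 2 / p) :=
                Real.rpow_le_rpow (by positivity) e1 hex0
            _ = 6400 ^ (1 - 2 / p) * η ^ (1 - 2 / p) := Real.mul_rpow (by norm_num) hη
            _ ≤ 6400 * η ^ (1 - 2 / p) := by
              gcongr
              conv_rhs => rw [← Real.rpow_one 6400]
              exact Real.rpow_le_rpow_of_exponent_le (by norm_num) hex1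
        have e3 : 0 ≤ 11520 * RobustCov.kappa μ 4 ^ 2 * σ * (√(r / n) + √(L / n)) := by positivity
        have e4 : 0 ≤ RobustCov.kappa μ p ^ 2 * σ * η ^ (1 - 2 / p) := by positivity
        calc _ ≤ 144 * RobustCov.kappa μ p ^ 2 * σ * (6400 * η ^ (1 - 2 / p)) := by gcongr
          _ ≤ _ := by linarith
      · exact ⟨128 * j, 4, le_rfl, h4', hκ4, le_rfl, by rw [hcast]; exact hc, by rw [hcast]; linarith,
          Or.inl rfl, hfour _ (by rw [hcast]; linarith)⟩
    · have hu : ((⌈2528 * r⌉₊ : ℕ) : ℝ) < 2528 * r + 1 := Nat.ceil_lt_add_one (by positivity)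
      have hl : 2528 * r ≤ (⌈2528 * r⌉₊ : ℕ) := Nat.le_ceil _
      refine ⟨⌈2528 * r⌉₊, 4, le_rfl, h4', hκ4, ?_, hl, by linarith, Or.inr (by linarith),
        hfour _ (by linarith)⟩
      have : ((128 * j : ℕ) : ℝ) ≤ (⌈2528 * r⌉₊ : ℕ) := by rw [hcast]; linarith
      exact_mod_cast this
  have hk0 : 0 < k := by omega
  have hk0' : (0 : ℝ) < k := by exact_mod_cast hk0
  set B := 48 * RobustCov.kappa μ q ^ 2 * σ * ((n : ℝ) / k) ^ (2 / q) with hB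
  have key := measure_stopLevel_deviation (n := n) (σ := σ) (T := T) (M := M) (m := r + L) (r := r)
    (t := 6 * L) (N := η * n) (B := B) (q := q) (j := j) (k := k) μ h4 hn hM0 hσ rfl hT0
    (by rw [← hrT]; gcongr; linarith) hM4 hM4' (by linarith) (by linarith) hr4 (by linarith)
    (by linarith) (by positivity) (by linarith)
    (fun v => integrable_abs_inner_rpow (by linarith) hqi v)
    (fun v hv => integral_abs_inner_rpow_le_of_variance μ hq4 h2 h0 hqi (by linarith) hσ0.le hn hk0 hv)
    hηn hj1 (by linarith) hjk hmk hrk hk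
  refine (measure_mono ?_).trans (key.trans (ENNReal.ofReal_le_ofReal ?_))
  · rintro x ⟨y, hy, v, hv, hlt⟩
    refine ⟨y, hy, v, hv, ?_⟩
    rw [quadForm_covMatrix h2 h0] at hlt
    have e1 : trimmedSum (stopLevel j y) (dirSq y v) / n - ∫ x, (inner ℝ x v : ℝ) ^ 2 ∂μ =
        (trimmedSum (stopLevel j y) (dirSq y v) - n * ∫ x, (inner ℝ x v : ℝ) ^ 2 ∂μ) / n := by
      field_simp
    rw [e1, abs_div, abs_of_pos hn', lt_div_iff₀ hn'] at hlt
    refine lt_of_le_of_lt ?_ hlt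
    have e2 : √((r + L) * n) = √((r + L) / n) * n := by
      rw [show (r + L) * n = (r + L) / n * (n * n) by field_simp, Real.sqrt_mul (by positivity),
        Real.sqrt_mul_self hn'.le]
    have e3 : 3 * k * B = 144 * RobustCov.kappa μ q ^ 2 * σ * ((k : ℝ) / n) ^ (1 - 2 / q) * n := by
      have : ((k : ℝ) / n) ^ (1 - 2 / q) = k / n * ((n : ℝ) / k) ^ (2 / q) := by
        rw [Real.rpow_sub (by positivity), Real.rpow_one, ← inv_div (k : ℝ) n,
          Real.inv_rpow (by positivity), div_eq_mul_inv]
      rw [this, hB]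
      field_simp
      norm_num
    rw [e2, e3, ← mul_assoc, ← add_mul]
    refine mul_le_mul_of_nonneg_right ?_ hn'.le
    have e4 : 0 ≤ RobustCov.kappa μ 4 ^ 2 * σ * (√(r / n) + √(L / n)) := by positivity
    have e5 : 300000000 * M * √((r + L) / n) ≤ 300000000 * M * (√(r / n) + √(L / n)) := by gcongr
    rw [hM] at e5 ⊢
    linarith
  -- The confidence parameter `6 L` beats the union bound: `39 * (α / 2) ^ 6 ≤ α` because `39 < 64`.
  · have e1 : Real.exp (-(6 * L)) = (α / 2) ^ 6 := by
      rw [show -(6 * L) = ((6 : ℕ) : ℝ) * (-L) by push_cast; ring, Real.exp_nat_mul, Real.exp_neg, hL,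
        Real.exp_log (by positivity), inv_div]
    rw [e1]
    have e2 : α ^ 6 ≤ α := by
      calc α ^ 6 ≤ α ^ 1 := pow_le_pow_of_le_one hα0.le hα1.le (by norm_num)
        _ = α := pow_one α
    rw [div_pow]
    linarith

end Deviation

/-! ### Measurable selection of a positive semidefinite matrix. -/

noncomputable section

section Selection

variable {d n : ℕ}

instance secondCountableTopology_matrix : SecondCountableTopology (Matrix (Fin d) (Fin d) ℝ) :=
  inferInstanceAs (SecondCountableTopology (Fin d → Fin d → ℝ))

/-- The positive semidefinite matrices. -/
def psdMatrices (d : ℕ) : Set (Matrix (Fin d) (Fin d) ℝ) := {A | A.PosSemidef}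

instance nonempty_psdMatrices : Nonempty (psdMatrices d) :=
  ⟨⟨0, Matrix.PosSemidef.zero⟩⟩

/-- The supremum of a function over the unit sphere. -/
def sphereSup (g : EuclideanSpace ℝ (Fin d) → ℝ) : ℝ := sSup (g '' Metric.sphere 0 1)

theorem le_sphereSup {g : EuclideanSpace ℝ (Fin d) → ℝ} (hg : Continuous g)
    {v : EuclideanSpace ℝ (Fin d)} (hv : ‖v‖ = 1) : g v ≤ sphereSup g :=
  le_csSup ((isCompact_sphere 0 1).image hg).bddAbove ⟨v, by simpa using hv, rfl⟩

/-- Nonnegativity of `c` covers dimension zero, where the sphere is empty and the supremum is `0`.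
-/
theorem sphereSup_le {g : EuclideanSpace ℝ (Fin d) → ℝ} {c : ℝ} (hc : 0 ≤ c)
    (h : ∀ v, ‖v‖ = 1 → g v ≤ c) : sphereSup g ≤ c :=
  Real.sSup_le (by rintro _ ⟨v, hv, rfl⟩; exact h v (by simpa using hv)) hc

theorem continuous_sphereSup {X : Type*} [TopologicalSpace X] {g : X → EuclideanSpace ℝ (Fin d) → ℝ}
    (hg : Continuous (Function.uncurry g)) : Continuous fun x => sphereSup (g x) :=
  IsCompact.continuous_sSup (isCompact_sphere 0 1) hg

theorem continuous_quadForm :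
    Continuous fun z : Matrix (Fin d) (Fin d) ℝ × EuclideanSpace ℝ (Fin d) =>
      RobustCov.quadForm z.1 z.2 := by
  simp only [quadForm_eq_sum]
  fun_prop

theorem quadForm_sub (A B : Matrix (Fin d) (Fin d) ℝ) (v : EuclideanSpace ℝ (Fin d)) :
    RobustCov.quadForm (A - B) v = RobustCov.quadForm A v - RobustCov.quadForm B v := by
  simp only [RobustCov.quadForm, map_sub, sub_apply, inner_sub_right]

/-- The trimmed quadratic form of a sample. -/
def trimmedForm (k : ℕ) (y : Fin n → EuclideanSpace ℝ (Fin d)) (v : EuclideanSpace ℝ (Fin d)) : ℝ :=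
  trimmedSum k (dirSq y v) / n

theorem continuous_dirSq (i : Fin n) :
    Continuous fun z : (Fin n → EuclideanSpace ℝ (Fin d)) × EuclideanSpace ℝ (Fin d) =>
      dirSq z.1 z.2 i := by
  unfold dirSq; fun_prop

theorem continuous_trimmedForm (k : ℕ) :
    Continuous fun z : (Fin n → EuclideanSpace ℝ (Fin d)) × EuclideanSpace ℝ (Fin d) =>
      trimmedForm k z.1 z.2 :=
  (continuous_trimmedSum k continuous_dirSq).div_const _

theorem trimmedForm_nonneg (k : ℕ) (y : Fin n → EuclideanSpace ℝ (Fin d))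
    (v : EuclideanSpace ℝ (Fin d)) : 0 ≤ trimmedForm k y v :=
  div_nonneg (trimmedSum_nonneg k (dirSq_nonneg y v)) (Nat.cast_nonneg n)

/-- The distance of a quadratic form from the trimmed one. -/
def formDist (k : ℕ) (y : Fin n → EuclideanSpace ℝ (Fin d)) (A : Matrix (Fin d) (Fin d) ℝ) : ℝ :=
  sphereSup fun v => |RobustCov.quadForm A v - trimmedForm k y v|

theorem continuous_formDist (k : ℕ) :
    Continuous fun z : (Fin n → EuclideanSpace ℝ (Fin d)) × Matrix (Fin d) (Fin d) ℝ =>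
      formDist k z.1 z.2 := by
  refine continuous_sphereSup (g := fun (z : (Fin n → EuclideanSpace ℝ (Fin d)) × Matrix (Fin d) (Fin d) ℝ) v =>
    |RobustCov.quadForm z.2 v - trimmedForm k z.1 v|) ?_
  have h1 := continuous_quadForm.comp (f := fun z : ((Fin n → EuclideanSpace ℝ (Fin d)) ×
    Matrix (Fin d) (Fin d) ℝ) × EuclideanSpace ℝ (Fin d) => (z.1.2, z.2)) (by fun_prop)
  have h2 := (continuous_trimmedForm (n := n) (d := d) k).comp (f := fun z : ((Fin n → EuclideanSpace ℝ (Fin d)) ×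
    Matrix (Fin d) (Fin d) ℝ) × EuclideanSpace ℝ (Fin d) => (z.1.1, z.2)) (by fun_prop)
  exact (h1.sub h2).abs

theorem abs_sub_le_formDist (k : ℕ) (y : Fin n → EuclideanSpace ℝ (Fin d)) (A : Matrix (Fin d) (Fin d) ℝ)
    {v : EuclideanSpace ℝ (Fin d)} (hv : ‖v‖ = 1) :
    |RobustCov.quadForm A v - trimmedForm k y v| ≤ formDist k y A := by
  refine le_sphereSup (g := fun v => |RobustCov.quadForm A v - trimmedForm k y v|) ?_ hv
  have h1 := continuous_quadForm.comp (f := fun v : EuclideanSpace ℝ (Fin d) => (A, v)) (by fun_prop)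
  have h2 := (continuous_trimmedForm k).comp (f := fun v : EuclideanSpace ℝ (Fin d) => (y, v)) (by fun_prop)
  exact (h1.sub h2).abs

theorem formDist_nonneg (k : ℕ) (y : Fin n → EuclideanSpace ℝ (Fin d)) (A : Matrix (Fin d) (Fin d) ℝ) :
    0 ≤ formDist k y A :=
  Real.sSup_nonneg (by rintro _ ⟨v, -, rfl⟩; exact abs_nonneg _)

/-- The largest value of the trimmed quadratic form. -/
def formScale (k : ℕ) (y : Fin n → EuclideanSpace ℝ (Fin d)) : ℝ := sphereSup (trimmedForm k y)

theorem continuous_formScale (k : ℕ) :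
    Continuous fun y : Fin n → EuclideanSpace ℝ (Fin d) => formScale k y :=
  continuous_sphereSup (continuous_trimmedForm k)

theorem continuous_stopThreshold (j k : ℕ) :
    Continuous fun y : Fin n → EuclideanSpace ℝ (Fin d) => stopThreshold j k y := by
  have : Continuous fun y : Fin n → EuclideanSpace ℝ (Fin d) => normScale j y :=
    Real.continuous_sqrt.comp (continuous_trimmedSum j fun i => by fun_prop)
  exact (this.const_mul 27601).div_const _

/-- The strict inequalities make the condition open for fixed direction and index set, so the
uncountable union over directions does not harm measurability. -/
theorem isOpen_stopsAt (j k : ℕ) :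
    IsOpen {y : Fin n → EuclideanSpace ℝ (Fin d) | StopsAt j k y} := by
  have e : {y : Fin n → EuclideanSpace ℝ (Fin d) | StopsAt j k y} =
      ⋃ (v : EuclideanSpace ℝ (Fin d)) (_ : ‖v‖ = 1) (J : Finset (Fin n)) (_ : k < J.card),
        ⋂ i ∈ J, {y | stopThreshold j k y < dirSq y v i} := by
    ext y
    simp only [StopsAt, Set.mem_ofPred_eq, Set.mem_iUnion, Set.mem_iInter, exists_prop]
    refine exists_congr fun v => and_congr_right fun _ => ⟨fun h => ⟨_, h, fun i hi => ?_⟩, ?_⟩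
    · simpa using hi
    · rintro ⟨J, hJ, h⟩
      exact hJ.trans_le (Finset.card_le_card fun i hi => by simpa using h i hi)
  rw [e]
  refine isOpen_iUnion fun v => isOpen_iUnion fun _ => isOpen_iUnion fun J => isOpen_iUnion fun _ =>
    isOpen_biInter_finset fun i _ => isOpen_lt (continuous_stopThreshold j k) ?_
  exact (continuous_dirSq i).comp (f := fun y => (y, v)) (by fun_prop)

theorem measurable_stopLevel (j : ℕ) :
    Measurable fun y : Fin n → EuclideanSpace ℝ (Fin d) => stopLevel j y := by
  classical
  unfold stopLevel
  refine measurable_find _ fun k => ?_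
  by_cases h1 : 128 * j ≤ k
  · by_cases h2 : n ≤ k
    · simp [h1, h2]
    · simpa [h1, h2] using (isOpen_stopsAt j k).measurableSet
  · simp [h1]

theorem measurable_of_stopLevel (j : ℕ) {f : ℕ → (Fin n → EuclideanSpace ℝ (Fin d)) → ℝ}
    (hf : ∀ k, Continuous (f k)) : Measurable fun y => f (stopLevel j y) y :=
  (measurable_from_prod_countable_right (f := fun z : ℕ × (Fin n → EuclideanSpace ℝ (Fin d)) => f z.1 z.2)
    fun k => (hf k).measurable).comp ((measurable_stopLevel j).prodMk measurable_id)

/-- A dense sequence of positive semidefinite matrices. -/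
def psdSeq (d i : ℕ) : Matrix (Fin d) (Fin d) ℝ :=
  (TopologicalSpace.denseSeq (psdMatrices d) i).1

theorem exists_formDist_psdSeq_lt (k : ℕ) (y : Fin n → EuclideanSpace ℝ (Fin d))
    {A : Matrix (Fin d) (Fin d) ℝ} (hA : A.PosSemidef) {c : ℝ} (h : formDist k y A < c) :
    ∃ i, formDist k y (psdSeq d i) < c := by
  have hc : Continuous fun B : psdMatrices d => formDist k y B.1 :=
    (continuous_formDist k).comp (f := fun B : psdMatrices d => (y, B.1))
      (by fun_prop)
  exact (TopologicalSpace.denseRange_denseSeq _).exists_mem_open (isOpen_lt hc continuous_const)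
    ⟨⟨A, hA⟩, h⟩

/-- The matrices that approximate the trimmed form as well as any, up to the tolerance. -/
def IsNearOptimal (j : ℕ) (y : Fin n → EuclideanSpace ℝ (Fin d)) (i : ℕ) : Prop :=
  -- The tolerance must be proportional to the unknown `‖Σ‖`, so the scale of the trimmed form
  -- replaces it. When that scale vanishes no positive tolerance is available, and `covEstimator` is
  -- zero.
  formScale (stopLevel j y) y ≤ 0 ∨ formDist (stopLevel j y) y (psdSeq d i) <
    (⨅ l, formDist (stopLevel j y) y (psdSeq d l)) + formScale (stopLevel j y) y / n

theorem exists_isNearOptimal (hn : 0 < n) (j : ℕ) (y : Fin n → EuclideanSpace ℝ (Fin d)) :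
    ∃ i, IsNearOptimal j y i := by
  rcases le_or_gt (formScale (stopLevel j y) y) 0 with h | h
  · exact ⟨0, Or.inl h⟩
  · obtain ⟨i, hi⟩ := exists_lt_of_ciInf_lt (lt_add_of_pos_right
      (⨅ l, formDist (stopLevel j y) y (psdSeq d l)) (div_pos h (Nat.cast_pos.2 hn)))
    exact ⟨i, Or.inr hi⟩

open Classical in
/-- The robust estimator of the covariance. -/
def covEstimator (hn : 0 < n) (j : ℕ) (y : Fin n → EuclideanSpace ℝ (Fin d)) :
    Matrix (Fin d) (Fin d) ℝ :=
  if formScale (stopLevel j y) y ≤ 0 then 0 else psdSeq d (Nat.find (exists_isNearOptimal hn j y))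

theorem posSemidef_covEstimator (hn : 0 < n) (j : ℕ) (y : Fin n → EuclideanSpace ℝ (Fin d)) :
    (covEstimator hn j y).PosSemidef := by
  unfold covEstimator
  split_ifs
  · exact Matrix.PosSemidef.zero
  · exact (TopologicalSpace.denseSeq (psdMatrices d) _).2

theorem measurable_covEstimator (hn : 0 < n) (j : ℕ) (a b : Fin d) :
    Measurable fun y : Fin n → EuclideanSpace ℝ (Fin d) => covEstimator hn j y a b := by
  classical
  have hΛ : Measurable fun y : Fin n → EuclideanSpace ℝ (Fin d) => formScale (stopLevel j y) y :=
    measurable_of_stopLevel j continuous_formScale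
  have hf : ∀ i, Measurable fun y : Fin n → EuclideanSpace ℝ (Fin d) =>
      formDist (stopLevel j y) y (psdSeq d i) := fun i =>
    measurable_of_stopLevel j (f := fun k y => formDist k y (psdSeq d i)) fun k =>
      (continuous_formDist k).comp (f := fun y => (y, psdSeq d i)) (by fun_prop)
  have hs : MeasurableSet {y : Fin n → EuclideanSpace ℝ (Fin d) | formScale (stopLevel j y) y ≤ 0} :=
    measurableSet_le hΛ measurable_const
  have hfind : Measurable fun y : Fin n → EuclideanSpace ℝ (Fin d) =>
      Nat.find (exists_isNearOptimal hn j y) :=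
    measurable_find _ fun i => hs.union (measurableSet_lt (hf i) ((Measurable.iInf hf).add (hΛ.div_const _)))
  have hsel : Measurable fun y : Fin n → EuclideanSpace ℝ (Fin d) =>
      psdSeq d (Nat.find (exists_isNearOptimal hn j y)) a b :=
    (measurable_from_nat (f := fun i => psdSeq d i a b)).comp hfind
  have e : (fun y : Fin n → EuclideanSpace ℝ (Fin d) => covEstimator hn j y a b) = fun y =>
      if formScale (stopLevel j y) y ≤ 0 then 0 else psdSeq d (Nat.find (exists_isNearOptimal hn j y)) a b := by
    ext y
    unfold covEstimator
    split_ifs <;> rfl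
  rw [e]
  exact Measurable.ite hs measurable_const hsel

/-- The estimator inherits the accuracy of the trimmed form. -/
theorem opNorm_covEstimator_sub_le (hn : 0 < n) {j : ℕ} {y : Fin n → EuclideanSpace ℝ (Fin d)}
    {A : Matrix (Fin d) (Fin d) ℝ} (hA : A.PosSemidef) {ε : ℝ} (hε : 0 ≤ ε)
    (h : ∀ v : EuclideanSpace ℝ (Fin d), ‖v‖ = 1 →
      |trimmedForm (stopLevel j y) y v - RobustCov.quadForm A v| ≤ ε) :
    RobustCov.opNorm (covEstimator hn j y - A) ≤ 4 * ε + 2 * RobustCov.opNorm A / n := by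
  classical
  have hn' : (1 : ℝ) ≤ n := by exact_mod_cast hn
  have hA0 : 0 ≤ RobustCov.opNorm A := norm_nonneg _
  have hd : 0 ≤ RobustCov.opNorm A / n := by positivity
  have hq : ∀ v : EuclideanSpace ℝ (Fin d), ‖v‖ = 1 → RobustCov.quadForm A v ≤ RobustCov.opNorm A :=
    fun v hv => by
      have := (le_abs_self _).trans (abs_quadForm_le A v)
      rwa [hv, one_pow, mul_one] at this
  refine opNorm_le_of_quadForm ((posSemidef_covEstimator hn j y).isHermitian.sub hA.isHermitian)
    (by rw [mul_div_assoc]; positivity) fun v hv => ?_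
  rw [quadForm_sub]
  have hv' := abs_le.1 (h v hv)
  have hS := trimmedForm_nonneg (stopLevel j y) y v
  have hcont : Continuous (trimmedForm (stopLevel j y) y) :=
    (continuous_trimmedForm (stopLevel j y)).comp (f := fun v => (y, v)) (by fun_prop)
  have hSΛ := le_sphereSup hcont hv
  rcases le_or_gt (formScale (stopLevel j y) y) 0 with hΛ | hΛ
  · have e : RobustCov.quadForm (covEstimator hn j y) v = 0 := by
      rw [covEstimator, if_pos hΛ]; simp [RobustCov.quadForm]
    rw [e]
    have : trimmedForm (stopLevel j y) y v ≤ 0 := hSΛ.trans hΛ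
    rw [mul_div_assoc, abs_le]; constructor <;> linarith
  · have e : covEstimator hn j y = psdSeq d (Nat.find (exists_isNearOptimal hn j y)) := by
      rw [covEstimator, if_neg (not_le.2 hΛ)]
    have h1 := (Nat.find_spec (exists_isNearOptimal hn j y)).resolve_left (not_le.2 hΛ)
    rw [← e] at h1
    have hΛle : formScale (stopLevel j y) y ≤ RobustCov.opNorm A + ε :=
      sphereSup_le (by positivity) fun u hu => by
        have := (abs_le.1 (h u hu)).2
        linarith [hq u hu]
    have hΛn : formScale (stopLevel j y) y / n ≤ RobustCov.opNorm A / n + ε := by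
      have h3 : ε / n ≤ ε := div_le_self hε hn'
      calc formScale (stopLevel j y) y / n ≤ (RobustCov.opNorm A + ε) / n := by gcongr
        _ ≤ _ := by rw [add_div]; linarith
    have hfA : formDist (stopLevel j y) y A ≤ ε := sphereSup_le hε fun u hu => by
      rw [abs_sub_comm]; exact h u hu
    have hpos : 0 < formScale (stopLevel j y) y / n := by positivity
    -- Density costs one tolerance and near-optimality a second, so the selected matrix is within
    -- `ε` plus two tolerances of the trimmed form. One more `ε` leads to `A`, and each tolerance is
    -- at most `‖A‖ / n + ε`.
    obtain ⟨l, hl⟩ := exists_formDist_psdSeq_lt (stopLevel j y) y hA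
      (c := ε + formScale (stopLevel j y) y / n) (by linarith)
    have hinf : (⨅ l, formDist (stopLevel j y) y (psdSeq d l)) ≤ formDist (stopLevel j y) y (psdSeq d l) :=
      ciInf_le ⟨0, by rintro _ ⟨i, rfl⟩; exact formDist_nonneg _ _ _⟩ l
    have h2 := abs_le.1 (abs_sub_le_formDist (stopLevel j y) y (covEstimator hn j y) hv)
    rw [mul_div_assoc, abs_le]; constructor <;> linarith

end Selection

end

/-! ### Conclusion. -/

/-- Subadditivity suffices here, so neither the good nor the bad set has to be measurable. -/
theorem one_sub_le_measureReal {Ω : Type*} [MeasurableSpace Ω] {P : Measure Ω} [IsProbabilityMeasure P]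
    {G B : Set Ω} {α : ℝ} (hα : 0 ≤ α) (hB : P B ≤ ENNReal.ofReal α) (h : ∀ᵐ ω ∂P, ω ∉ B → ω ∈ G) :
    1 - α ≤ P.real G := by
  have h1 : (1 : ENNReal) ≤ P G + ENNReal.ofReal α := by
    calc (1 : ENNReal) = P Set.univ := measure_univ.symm
      _ ≤ P (G ∪ B) := measure_mono_ae (by
          filter_upwards [h] with ω hω _
          by_cases hb : ω ∈ B
          · exact Or.inr hb
          · exact Or.inl (hω hb))
      _ ≤ P G + P B := measure_union_le _ _
      _ ≤ _ := by gcongr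
  have h2 := ENNReal.toReal_mono (by finiteness) h1
  rw [ENNReal.toReal_add (by finiteness) (by finiteness), ENNReal.toReal_ofReal hα, ENNReal.toReal_one] at h2
  rw [measureReal_def]
  linarith

/-- Lets the selection tolerance `‖Σ‖ / n` disappear into the confidence term. -/
theorem one_div_le_two_mul_sqrt {α : ℝ} (hα0 : 0 < α) (hα1 : α < 1) {n : ℕ} (hn : 0 < n) :
    1 / (n : ℝ) ≤ 2 * √(Real.log (2 / α) / n) := by
  have hn' : (1 : ℝ) ≤ n := by exact_mod_cast hn
  have hL : 1 / 4 ≤ Real.log (2 / α) := by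
    have h1 : Real.log 2 ≤ Real.log (2 / α) :=
      Real.log_le_log (by norm_num) (by rw [le_div_iff₀ hα0]; linarith)
    have := Real.log_two_gt_d9
    linarith
  have h1 : 1 / (n : ℝ) / 2 ≤ √(Real.log (2 / α) / n) := by
    refine Real.le_sqrt_of_sq_le ?_
    rw [le_div_iff₀ (by positivity)]
    have h2 : (1 / (n : ℝ) / 2) ^ 2 * n = 1 / n / 4 := by field_simp; norm_num
    have h3 : 1 / (n : ℝ) ≤ 1 := by rw [div_le_one (by positivity)]; exact hn'
    rw [h2]; linarith
  linarith

theorem stableRank_covMatrix_nonneg {d : ℕ} {μ : Measure (EuclideanSpace ℝ (Fin d))}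
    [IsProbabilityMeasure μ] (h2 : Integrable (fun x => ‖x‖ ^ 2) μ) (h0 : ∫ x, x ∂μ = 0) :
    0 ≤ RobustCov.stableRank (RobustCov.covMatrix μ) := by
  rw [RobustCov.stableRank, trace_covMatrix h2 h0]
  exact div_nonneg (integral_nonneg fun x => by positivity) (norm_nonneg _)

theorem theorem1 :
    ∃ C : ℝ, 0 < C ∧
      ∀ (d n : ℕ) (α η : ℝ), 0 < α → α < 1 → 0 ≤ η → η < 1 / 2 →
      ∃ E : (Fin n → EuclideanSpace ℝ (Fin d)) → Matrix (Fin d) (Fin d) ℝ,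
        (∀ i j, Measurable fun y => E y i j) ∧ (∀ y, (E y).PosSemidef) ∧
        ∀ (p : ℝ), 4 ≤ p →
        ∀ (μ : Measure (EuclideanSpace ℝ (Fin d))) [IsProbabilityMeasure μ],
          Integrable (fun x => ‖x‖ ^ p) μ →
          ∫ x, x ∂μ = 0 →
          RobustCov.covMatrix μ ≠ 0 →
          η ≤ 1 / (C * RobustCov.kappa μ 4 ^ 4) →
          C * (RobustCov.stableRank (RobustCov.covMatrix μ) + Real.log (2 / α)) ≤ n →
        ∀ (Ω : Type*) [MeasurableSpace Ω] (P : Measure Ω) [IsProbabilityMeasure P]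
          (X Y : Fin n → Ω → EuclideanSpace ℝ (Fin d)),
          (∀ i, Measurable (X i)) →
          (∀ i, P.map (X i) = μ) →
          iIndepFun X P →
          (∀ i, Measurable (Y i)) →
          (∀ᵐ ω ∂P, (({i | Y i ω ≠ X i ω} : Set (Fin n)).ncard : ℝ) ≤ η * n) →
          1 - α ≤ P.real {ω |
            RobustCov.opNorm (E (fun i => Y i ω) - RobustCov.covMatrix μ) ≤
              C * RobustCov.kappa μ 4 ^ 2 * RobustCov.opNorm (RobustCov.covMatrix μ) *
                  (√(RobustCov.stableRank (RobustCov.covMatrix μ) / n) +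
                    √(Real.log (2 / α) / n)) +
                C * RobustCov.kappa μ p ^ 2 * RobustCov.opNorm (RobustCov.covMatrix μ) *
                  η ^ (1 - 2 / p)} := by

  refine ⟨2000000000, by norm_num, fun d n α η hα0 hα1 hη0 hη1 => ?_⟩
  have hL : 0 < Real.log (2 / α) := Real.log_pos (by rw [lt_div_iff₀ hα0]; linarith)
  rcases Nat.eq_zero_or_pos n with rfl | hn
  -- With no data any matrix will do, since the sample size condition fails: its left side is
  -- positive.
  · refine ⟨fun _ => 0, fun i j => measurable_const, fun _ => Matrix.PosSemidef.zero, ?_⟩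
    intro p hp4 μ _ hp h0 hS _ hn
    have := stableRank_covMatrix_nonneg (integrable_sq_of_four (integrable_norm_pow_four hp4 hp)) h0
    rw [Nat.cast_zero] at hn
    nlinarith
  refine ⟨covEstimator hn ⌈24 * (η * n + Real.log (2 / α))⌉₊, measurable_covEstimator hn _,
    posSemidef_covEstimator hn _, ?_⟩
  intro p hp4 μ _ hp h0 hS _ _ Ω _ P _ X Y hX hXμ hind hY hcont
  set j := ⌈24 * (η * n + Real.log (2 / α))⌉₊ with hj
  have hpi : P.map (fun ω i => X i ω) = Measure.pi fun _ : Fin n => μ := by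
    rw [(iIndepFun_iff_map_fun_eq_pi_map fun i => (hX i).aemeasurable).1 hind]
    simp only [hXμ]
  have hbad := measure_quadForm_deviation (n := n) μ hp4 hp h0 hS hα0 hα1 hη0 hn
  rw [← hj, ← hpi] at hbad
  -- The bad set quantifies over all corrupted samples and need not be measurable; the inequality
  -- between the measure of a preimage and the pushforward measure holds for arbitrary sets.
  refine one_sub_le_measureReal hα0.le
    ((Measure.le_map_apply (measurable_pi_lambda _ hX).aemeasurable _).trans hbad) ?_
  filter_upwards [hcont] with ω hω hgood
  simp only [Set.mem_preimage, Set.mem_ofPred_eq, not_exists, not_and, not_lt] at hgood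
  have h4 := integrable_norm_pow_four hp4 hp
  have h2 := integrable_sq_of_four h4
  have hσ : 0 ≤ RobustCov.opNorm (RobustCov.covMatrix μ) := norm_nonneg _
  have hκ : 1 ≤ RobustCov.kappa μ 4 := one_le_kappa (by norm_num) h2 h0
    (integrable_norm_rpow_of_le (by norm_num) hp4 hp) (exists_integral_inner_sq_pos μ h2 h0 hS)
  have key := opNorm_covEstimator_sub_le hn (j := j) (y := fun i => Y i ω) (covMatrix_posSemidef h2 h0)
    (by positivity) fun v hv => hgood (fun i => Y i ω) hω v hv
  refine key.trans ?_
  have h5 : RobustCov.opNorm (RobustCov.covMatrix μ) / n ≤ 2 * (RobustCov.kappa μ 4 ^ 2 *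
      RobustCov.opNorm (RobustCov.covMatrix μ) * √(Real.log (2 / α) / n)) := by
    rw [div_eq_mul_one_div]
    have h6 : RobustCov.opNorm (RobustCov.covMatrix μ) ≤ RobustCov.kappa μ 4 ^ 2 *
        RobustCov.opNorm (RobustCov.covMatrix μ) := le_mul_of_one_le_left hσ (one_le_pow₀ hκ)
    calc _ ≤ RobustCov.kappa μ 4 ^ 2 * RobustCov.opNorm (RobustCov.covMatrix μ) *
          (2 * √(Real.log (2 / α) / n)) :=
          mul_le_mul h6 (one_div_le_two_mul_sqrt hα0 hα1 hn) (by positivity) (by positivity)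
      _ = _ := by ring
  have p1 : 0 ≤ RobustCov.kappa μ 4 ^ 2 * RobustCov.opNorm (RobustCov.covMatrix μ) *
    √(RobustCov.stableRank (RobustCov.covMatrix μ) / n) := by positivity
  have p2 : 0 ≤ RobustCov.kappa μ 4 ^ 2 * RobustCov.opNorm (RobustCov.covMatrix μ) *
    √(Real.log (2 / α) / n) := by positivity
  have p3 : 0 ≤ RobustCov.kappa μ p ^ 2 * RobustCov.opNorm (RobustCov.covMatrix μ) * η ^ (1 - 2 / p) := by
    positivity
  rw [mul_div_assoc]
  linarith
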